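/- Let $R$ be a field of characteristic $0$, $\delta\in R$, $n\ge 0$. **Tableaux.** A node is $\pm(r,l)$ with $r,l\ge 1$ (row $r$, column $l$); put $\operatorname{res}(r,l)=\frac{\delta-1}{2}+l-r$, $\operatorname{res}(-\alpha)=-\operatorname{res}(\alpha)$, $\alpha_0=(1,1)$. Let $\widehat B_k=\{(\lambda,f): f\ge 0,\ \lambda\vdash k-2f\}$. An up-down tableau of shape $(\lambda,f)\in\widehat B_n$ is a sequence $\mathsf t=((\lambda^{(k)},f_k))_{0\le k\le n}$ with $(\lambda^{(k)},f_k)\in\widehat B_k$, $(\lambda^{(0)},f_0)=(\emptyset,0)$, $(\lambda^{(n)},f_n)=(\lambda,f)$, in which $\lambda^{(k)}$ arises from $\mathsf t_{k-1}=\lambda^{(k-1)}$ by adding or removing one node. It is identified with $(\alpha_1,\dots,\alpha_n)$, where $\alpha_k=\alpha$ if the node $\alpha$ is added and $\alpha_k=-\alpha$ if $\alpha$ is removed in step $k$; $\mathbf i_{\mathsf t}=(\operatorname{res}\alpha_1,\dots,\operatorname{res}\alpha_n)$; $\mathscr T^{ud}_n(\lambda)$ is the set of up-down tableaux of shape $(\lambda,f)$.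 Order pairs by $(\lambda,f)\unlhd(\mu,m)$ iff $f<m$, or $f=m$ and $\lambda_1+\dots+\lambda_j\le\mu_1+\dots+\mu_j$ for all $j$, and tableaux levelwise; $\mathsf t^{(\lambda,f)}$ is the unique maximal tableau of shape $(\lambda,f)$, $\mathbf i_\lambda$ its residue sequence. **Degree of a tableau.** Let $\mathscr A(\lambda)$, $\mathscr R(\lambda)$ be the sets of addable and removable nodes. If step $k$ leads from $\lambda$ to $\mu$ and adds or removes $\alpha=(r,l)$, its degree is $\#\{\beta\in\mathscr A(\lambda):\operatorname{res}\beta=\operatorname{res}\alpha,\ \operatorname{row}\beta>r\}-\#\{\beta\in\mathscr R(\lambda):\operatorname{res}\beta=\operatorname{res}\alpha,\ \operatorname{row}\beta>r\}$ if $\alpha$ is added, and $\#\{\beta\in\mathscr A(\mu):\operatorname{res}\beta=-\operatorname{res}\alpha,\ \operatorname{row}\beta\ne r\}-\#\{\beta\in\mathscr R(\mu):\operatorname{res}\beta=-\operatorname{res}\alpha\}+\delta_{\operatorname{res}\alpha,-1/2}$ if it is removed. $\deg\mathsf t$ is the sum of these degrees over $1\le k\le n$. **Sequences.** Let $P=(\frac{\delta-1}{2}+\mathbb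 Z)\cup(-\frac{\delta-1}{2}+\mathbb Z)$ and $\mathbf i\in P^n$. Let $A_{k,1},A_{k,2},A_{k,3},A_{k,4}$ be the sets of $r<k$ with $i_r=-i_k\pm1$, $i_r=i_k$, $i_r=i_k\pm1$, $i_r=-i_k$ respectively, and $$h_k(\mathbf i)=\delta_{i_k,-\frac{\delta-1}{2}}+\#A_{k,1}+2\#A_{k,2}-\delta_{i_k,\frac{\delta-1}{2}}-\#A_{k,3}-2\#A_{k,4}.$$ Let $P_{k,+}$: $i_k\ne0,-\frac12$ and $h_k=0$, or $i_k=-\frac12$ and $h_k=-1$; $P_{k,-}$: $i_k\neq0,-\frac12$ and $h_k=-2$, or $i_k=-\frac12$ and $h_k=-3$; $P_{k,0}$: all other $\mathbf i$. Let $\deg_k(\mathbf i)=1,-1,0$ on $P_{k,+},P_{k,-},P_{k,0}$. With $c=\frac{i_k-i_{k+1}}2$ let $a_k(\mathbf i)-\delta_{c,\frac{\delta-1}2}$ be $\#\{r<k: i_r=\pm1\}+1$ if $c=0$, $\#\{r<k:i_r=\pm1\}$ if $c=1$, $0$ if $c=\frac12$, and $\#\{r<k:i_r\in\{c,c-1,-c,-c+1\}\}$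 otherwise; write $\sigma_k=(-1)^{a_k(\mathbf i)}$. For $\mathbf i\in P_{k,0}$ let $z_k(\mathbf i)=\frac{1+\sigma_k}2$ if $i_k=0$; $\sigma_k(1+\delta_{i_k,-\frac12})$ if $i_k\ne 0$ and $-2\le h_k<0$; $0$ otherwise. The sequence $\mathbf i\cdot s_k$ is $\mathbf i$ with $i_k,i_{k+1}$ exchanged. Say that $\mathbf i,\mathbf j$ are $k$-linked if $i_r=j_r$ for all $r\ne k,k+1$, and that $\mathbf i$ is $k$-balanced if $i_k+i_{k+1}=0$. **The algebra.** $\mathscr G_n(\delta)$ is the unital associative $R$-algebra generated by $e(\mathbf i)$ ($\mathbf i\in P^n$), $y_k$ ($1\le k\le n$), $\psi_k,\epsilon_k$ ($1\le k<n$) with the following relations (for all admissible indices). 1. $y_1^{\delta_{i_1,(\delta-1)/2}}e(\mathbf i)=0$; $e(\mathbf i)e(\mathbf j)=\delta_{\mathbf i,\mathbf j}e(\mathbf i)$; $e(\mathbf i)\epsilon_k=\epsilon_ke(\mathbf i)=0$ if $\mathbf i$ is not $k$-balanced; $e(\mathbf i)\epsilon_ke(\mathbf j)=0$ if $\mathbf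 i,\mathbf j$ are not $k$-linked; $\sum_{\mathbf i}e(\mathbf i)=1$ (by the other relations only finitely many $e(\mathbf i)$ are non-zero). 2. $y_ke(\mathbf i)=e(\mathbf i)y_k$; $\psi_ke(\mathbf i)=e(\mathbf i\cdot s_k)\psi_k$; $y_ky_r=y_ry_k$; $y_k\psi_r=\psi_ry_k$ and $y_k\epsilon_r=\epsilon_ry_k$ if $k\ne r,r+1$; $\psi_k\psi_r=\psi_r\psi_k$, $\psi_k\epsilon_r=\epsilon_r\psi_k$, $\epsilon_k\epsilon_r=\epsilon_r\epsilon_k$ if $|k-r|>1$. 3. $e(\mathbf i)y_k\psi_k=e(\mathbf i)\psi_ky_{k+1}+e(\mathbf i)\epsilon_ke(\mathbf i\cdot s_k)-\delta_{i_k,i_{k+1}}e(\mathbf i)$; $e(\mathbf i)\psi_ky_k=e(\mathbf i)y_{k+1}\psi_k+e(\mathbf i)\epsilon_ke(\mathbf i\cdot s_k)-\delta_{i_k,i_{k+1}}e(\mathbf i)$. 4. $e(\mathbf i)\psi_k^2$ is $0$ if $i_k=i_{k+1}$, or if $i_k+i_{k+1}=0$ and $h_k(\mathbf i)\ne0$;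 $(y_{k+1}-y_k)e(\mathbf i)$ if $i_k=i_{k+1}+1$, $i_k+i_{k+1}\ne0$; $(y_k-y_{k+1})e(\mathbf i)$ if $i_k=i_{k+1}-1$, $i_k+i_{k+1}\ne0$; $e(\mathbf i)$ otherwise. 5. For $k$-balanced $\mathbf i$: $e(\mathbf i)\epsilon_ke(\mathbf i)=\sigma_ke(\mathbf i)$ if $\mathbf i\in P_{k,0}$, $i_k\ne\pm\frac12$; $e(\mathbf i)\epsilon_ke(\mathbf i)=-\sigma_k(y_{k+1}-y_k)e(\mathbf i)$ if $\mathbf i\in P_{k,+}$; $y_{k+1}e(\mathbf i)=y_ke(\mathbf i)-2\sigma_ky_ke(\mathbf i)\epsilon_ke(\mathbf i)=y_ke(\mathbf i)-2\sigma_ke(\mathbf i)\epsilon_ke(\mathbf i)y_k$ if $\mathbf i\in P_{k,0}$, $i_k=\frac12$; $e(\mathbf i)=\sigma_ke(\mathbf i)\epsilon_ke(\mathbf i)+2\sigma_{k-1}e(\mathbf i)\epsilon_{k-1}e(\mathbf i)-e(\mathbf i)\epsilon_{k-1}\epsilon_ke(\mathbf i)-e(\mathbf i)\epsilon_k\epsilon_{k-1}e(\mathbf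 i)$ if $k>1$, $\mathbf i\in P_{k,0}$, $-i_{k-1}=i_k=-\frac12$; $e(\mathbf i)=\sigma_ke(\mathbf i)(\epsilon_ky_k+y_k\epsilon_k)e(\mathbf i)$ if $\mathbf i\in P_{k,-}$; and for $k$-balanced $\mathbf j,\mathbf k$ that are $k$-linked to $\mathbf i$, $e(\mathbf j)\epsilon_ke(\mathbf i)\epsilon_ke(\mathbf k)$ is $z_k(\mathbf i)e(\mathbf j)\epsilon_ke(\mathbf k)$ if $\mathbf i\in P_{k,0}$, $0$ if $\mathbf i\in P_{k,-}$, and $\sigma_k(1+\delta_{i_k,-\frac12})\bigl(\sum_{A_{k,1}}y_r-2\sum_{A_{k,2}}y_r+\sum_{A_{k,3}}y_r-2\sum_{A_{k,4}}y_r\bigr)e(\mathbf j)\epsilon_ke(\mathbf k)$ if $\mathbf i\in P_{k,+}$. 6. $e(\mathbf i)\psi_k\epsilon_ke(\mathbf j)$ is $\sigma_ke(\mathbf i)\epsilon_ke(\mathbf j)$ and $e(\mathbf j)\epsilon_k\psi_ke(\mathbf i)$ is $\sigma_ke(\mathbf j)\epsilon_ke(\mathbf i)$ if $\mathbf i\in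 P_{k,+}$ and $i_k\ne0,-\frac12$; both are $0$ otherwise. 7. For $1<k<n$: $e(\mathbf j)\epsilon_k\epsilon_{k-1}\psi_ke(\mathbf i)=e(\mathbf j)\epsilon_k\psi_{k-1}e(\mathbf i)$, $e(\mathbf i)\psi_k\epsilon_{k-1}\epsilon_ke(\mathbf j)=e(\mathbf i)\psi_{k-1}\epsilon_ke(\mathbf j)$, $e(\mathbf i)\epsilon_k\epsilon_{k-1}\epsilon_ke(\mathbf j)=e(\mathbf i)\epsilon_ke(\mathbf j)$, $e(\mathbf i)\epsilon_{k-1}\epsilon_k\epsilon_{k-1}e(\mathbf j)=e(\mathbf i)\epsilon_{k-1}e(\mathbf j)$. For $1\le k<n$: $e(\mathbf i)\epsilon_ke(\mathbf j)(y_k+y_{k+1})=0$. 8. For $1<k<n$ put $(u,v,w)=(i_{k-1},i_k,i_{k+1})$ and $\mathbf j=\mathbf i\cdot s_ks_{k-1}s_k$. Then $e(\mathbf i)(\psi_k\psi_{k-1}\psi_k-\psi_{k-1}\psi_k\psi_{k-1})$ is given by the first case that applies: $e(\mathbf i)\epsilon_k\epsilon_{k-1}e(\mathbf j)$ if $v+w=0$,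 $u\ne\pm v$, $u=\pm(v-1)$; $-e(\mathbf i)\epsilon_k\epsilon_{k-1}e(\mathbf j)$ if $v+w=0$, $u\ne\pm v$, $u=\pm(v+1)$; $e(\mathbf i)\epsilon_{k-1}\epsilon_ke(\mathbf j)$ if $u+v=0$, $w\ne\pm v$, $w=\pm(v-1)$; $-e(\mathbf i)\epsilon_{k-1}\epsilon_ke(\mathbf j)$ if $u+v=0$, $w\ne\pm v$, $w=\pm(v+1)$; $-\sigma_{k-1}e(\mathbf i)\epsilon_{k-1}e(\mathbf j)$ if $u=-v=w$, $v\ne0,\pm\frac12$, $h_k(\mathbf i)=0$; $\sigma_ke(\mathbf i)\epsilon_ke(\mathbf j)$ if $u=-v=w$, $v\neq0,\pm\frac12$, $h_{k-1}(\mathbf i)=0$; $e(\mathbf i)$ if $u+v\ne0\ne v+w$ and $u=w=v-1$; $-e(\mathbf i)$ if $u+v\ne0\ne v+w$ and $u=w=v+1$; $0$ otherwise. **Grading.** Give $e(\mathbf i)$ degree $0$, $y_k$ degree $2$, $e(\mathbf i)\psi_k$ degree $1$ if $i_k=i_{k+1}\pm1$, $-2$ if $i_k=i_{k+1}$, $0$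 otherwise, and $e(\mathbf i)\epsilon_ke(\mathbf j)$ degree $\deg_k(\mathbf i)+\deg_k(\mathbf j)$. The component of degree $d$ of $\mathscr G_n(\delta)$ is the span of the products of these elements whose degrees add up to $d$; an element has degree $d$ if it lies in that component. **The elements $\psi_{\mathsf{st}}$.** Let $(\lambda,f)\in\widehat B_n$ and $\mathsf t=(\alpha_1,\dots,\alpha_n)\in\mathscr T^{ud}_n(\lambda)$. The head of $\mathsf t$ is the largest $h$ such that $\mathsf t$ begins with $h$ pairs $\alpha_0,-\alpha_0$. If $h<f$, let $b$ be the smallest index $>2h$ with $\alpha_b<0$ and $a$ the largest index $<b$ with $\alpha_a=-\alpha_b$; put $\mathsf t^{(1)}=(\alpha_0,-\alpha_0,\alpha_1,\dots,\hat\alpha_a,\dots,\hat\alpha_b,\dots,\alpha_n)$, an up-down tableau of the same shape with head $h+1$, and $$\epsilon_{\mathsf t^{(1)}\to\mathsf t}=e(\mathbf i_{\mathsf t^{(1)}})\,\epsilon_{2h+2}\epsilon_{2h+3}\cdots\epsilon_a\,\psi_{a+1}\psi_{a+2}\cdots\psi_{b-1}\,e(\mathbf i_{\mathsf t}).$$ Iterating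 gives $\mathsf t=\mathsf t^{(0)},\mathsf t^{(1)},\dots,\mathsf t^{(f-h)}=:h(\mathsf t)$; put $\epsilon_{\mathsf t}=\epsilon_{\mathsf t^{(f-h)}\to\mathsf t^{(f-h-1)}}\cdots\epsilon_{\mathsf t^{(1)}\to\mathsf t^{(0)}}$, and $\epsilon_{\mathsf t}=e(\mathbf i_{\mathsf t})$ if $h=f$. Let $d(\mathsf t)\in\langle s_{2f+1},\dots,s_{n-1}\rangle\subseteq\mathfrak S_n$ be the element with $\mathsf t^{(\lambda,f)}d(\mathsf t)=h(\mathsf t)$, where $s_k$ acts from the right by exchanging the $k$-th and the $(k+1)$-st node; choose a reduced expression $d(\mathsf t)=s_{k_1}\cdots s_{k_l}$ and put $\psi_{\mathsf t}=\psi_{k_1}\cdots\psi_{k_l}$. Put $e_{(\lambda,f)}=e(\mathbf i_\lambda)\epsilon_1\epsilon_3\cdots\epsilon_{2f-1}e(\mathbf i_\lambda)$ and let $*$ be the anti-involution of $\mathscr G_n(\delta)$ that fixes all the generators. For $\mathsf s,\mathsf t\in\mathscr T^{ud}_n(\lambda)$ let $\psi_{\mathsf{st}}=\epsilon_{\mathsf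 s}^*\psi_{\mathsf s}^*\,e_{(\lambda,f)}\,\psi_{\mathsf t}\epsilon_{\mathsf t}$. **Proposition.** For all $(\lambda,f)\in\widehat B_n$ and $\mathsf s,\mathsf t\in\mathscr T^{ud}_n(\lambda)$, and all choices of the reduced expressions, $\psi_{\mathsf{st}}$ is homogeneous of degree $\deg\mathsf s+\deg\mathsf t$ in $\mathscr G_n(\delta)$. -/

import Mathlib

open scoped Classical

namespace BrauerKLR

noncomputable section

/-! ## Residues -/

/-- The set `P` of residues: all elements `±(δ-1)/2 + m` with `m` an integer. -/
def resSet {R : Type*} [Field R] (δ : R) : Set R :=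
  {x | ∃ m : ℤ, x = (δ - 1) / 2 + m ∨ x = -((δ - 1) / 2) + m}

/-- Residue sequences `i ∈ P ^ n`.  All positions are counted from `0`. -/
abbrev Seq {R : Type*} [Field R] (δ : R) (n : ℕ) : Type _ := Fin n → resSet δ

/-- The lower of the two consecutive positions `k, k + 1`. -/
def lo {n k : ℕ} (h : k + 1 < n) : Fin n := ⟨k, Nat.lt_of_succ_lt h⟩

/-- The upper of the two consecutive positions `k, k + 1`. -/
def hi {n k : ℕ} (h : k + 1 < n) : Fin n := ⟨k + 1, h⟩

section Sequences

variable {R : Type*} [Field R] {δ : R} {n : ℕ}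

/-- The sequence `i · s_k`, obtained by exchanging the entries at positions `k` and `k + 1`. -/
def Seq.swap (i : Seq δ n) {k : ℕ} (h : k + 1 < n) : Seq δ n :=
  fun r => i (Equiv.swap (lo h) (hi h) r)

/-- `i_k + i_{k+1} = 0`. -/
def Seq.ZeroSum (i : Seq δ n) {k : ℕ} (h : k + 1 < n) : Prop :=
  (i (lo h) : R) + (i (hi h) : R) = 0

/-- `i` and `j` have the same entries at all positions other than `k` and `k + 1`. -/
def Seq.AgreeOff (i j : Seq δ n) {k : ℕ} (h : k + 1 < n) : Prop :=
  ∀ r : Fin n, r ≠ lo h → r ≠ hi h → i r = j r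

/-- `A_{k,1} = {r < k | i_r = -i_k ± 1}`. -/
def Seq.setA1 (i : Seq δ n) (k : Fin n) : Finset (Fin n) :=
  Finset.univ.filter fun r => r < k ∧ ((i r : R) = -(i k : R) + 1 ∨ (i r : R) = -(i k : R) - 1)

/-- `A_{k,2} = {r < k | i_r = i_k}`. -/
def Seq.setA2 (i : Seq δ n) (k : Fin n) : Finset (Fin n) :=
  Finset.univ.filter fun r => r < k ∧ (i r : R) = (i k : R)

/-- `A_{k,3} = {r < k | i_r = i_k ± 1}`. -/
def Seq.setA3 (i : Seq δ n) (k : Fin n) : Finset (Fin n) :=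
  Finset.univ.filter fun r => r < k ∧ ((i r : R) = (i k : R) + 1 ∨ (i r : R) = (i k : R) - 1)

/-- `A_{k,4} = {r < k | i_r = -i_k}`. -/
def Seq.setA4 (i : Seq δ n) (k : Fin n) : Finset (Fin n) :=
  Finset.univ.filter fun r => r < k ∧ (i r : R) = -(i k : R)

/-- The integer `h_k(i)`. -/
def Seq.hval (i : Seq δ n) (k : Fin n) : ℤ :=
  (if (i k : R) = -((δ - 1) / 2) then 1 else 0) + (i.setA1 k).card + 2 * (i.setA2 k).card
    - (if (i k : R) = (δ - 1) / 2 then 1 else 0) - (i.setA3 k).card - 2 * (i.setA4 k).card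

/-- `i ∈ P_{k,+}`. -/
def Seq.IsPlus (i : Seq δ n) (k : Fin n) : Prop :=
  ((i k : R) ≠ 0 ∧ (i k : R) ≠ -(1 / 2) ∧ i.hval k = 0) ∨ ((i k : R) = -(1 / 2) ∧ i.hval k = -1)

/-- `i ∈ P_{k,-}`. -/
def Seq.IsMinus (i : Seq δ n) (k : Fin n) : Prop :=
  ((i k : R) ≠ 0 ∧ (i k : R) ≠ -(1 / 2) ∧ i.hval k = -2) ∨ ((i k : R) = -(1 / 2) ∧ i.hval k = -3)

/-- `i ∈ P_{k,0}`. -/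
def Seq.IsZero (i : Seq δ n) (k : Fin n) : Prop := ¬ i.IsPlus k ∧ ¬ i.IsMinus k

/-- The integer `deg_k(i)`, which is `1`, `-1`, `0` on `P_{k,+}`, `P_{k,-}`, `P_{k,0}`. -/
def Seq.degK (i : Seq δ n) (k : Fin n) : ℤ :=
  if i.IsPlus k then 1 else if i.IsMinus k then -1 else 0

/-- The number `a_k(i)`; here `c = (i_k - i_{k+1}) / 2`. -/
def Seq.aval (i : Seq δ n) {k : ℕ} (h : k + 1 < n) : ℕ :=
  let c : R := ((i (lo h) : R) - (i (hi h) : R)) / 2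
  let d : ℕ := if c = (δ - 1) / 2 then 1 else 0
  let ones : ℕ :=
    (Finset.univ.filter fun r : Fin n => r < lo h ∧ ((i r : R) = -1 ∨ (i r : R) = 1)).card
  if c = 0 then ones + 1 + d
  else if c = 1 then ones + d
  else if c = 1 / 2 then d
  else (Finset.univ.filter fun r : Fin n => r < lo h ∧
      ((i r : R) = c ∨ (i r : R) = c - 1 ∨ (i r : R) = -c ∨ (i r : R) = -c + 1)).card + d

/-- The sign `(-1) ^ a_k(i)`, as an element of `R`. -/
def Seq.sgn (i : Seq δ n) {k : ℕ} (h : k + 1 < n) : R := (-1) ^ i.aval h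

/-- The factor `1 + δ_{i_k, -1/2}`. -/
def Seq.halfFactor (i : Seq δ n) (k : Fin n) : R := if (i k : R) = -(1 / 2) then 2 else 1

/-- The number `z_k(i)`, only used for `i ∈ P_{k,0}`. -/
def Seq.zval (i : Seq δ n) {k : ℕ} (h : k + 1 < n) : R :=
  if (i (lo h) : R) = 0 then (1 + i.sgn h) / 2
  else if -2 ≤ i.hval (lo h) ∧ i.hval (lo h) < 0 then i.sgn h * i.halfFactor (lo h)
  else 0

end Sequences

/-! ## The algebra -/

/-- The generators: idempotents `e(i)`, dots `y_k` (`k` a position), crossings `ψ_k` and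
cup-caps `ε_k`, the last two acting at the positions `k, k + 1`. -/
inductive Gen {R : Type*} [Field R] (δ : R) (n : ℕ) : Type _
  | e (i : Seq δ n) : Gen δ n
  | y (k : Fin n) : Gen δ n
  | psi (k : ℕ) (h : k + 1 < n) : Gen δ n
  | eps (k : ℕ) (h : k + 1 < n) : Gen δ n

section Presentation

variable {R : Type*} [Field R] {δ : R} {n : ℕ}

/-- `e(i)` in the free algebra. -/
def fE (i : Seq δ n) : FreeAlgebra R (Gen δ n) := FreeAlgebra.ι R (Gen.e i)

/-- `y_k` in the free algebra. -/
def fY (k : Fin n) : FreeAlgebra R (Gen δ n) := FreeAlgebra.ι R (Gen.y k)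

/-- `ψ_k` in the free algebra. -/
def fPsi {k : ℕ} (h : k + 1 < n) : FreeAlgebra R (Gen δ n) := FreeAlgebra.ι R (Gen.psi k h)

/-- `ε_k` in the free algebra. -/
def fEps {k : ℕ} (h : k + 1 < n) : FreeAlgebra R (Gen δ n) := FreeAlgebra.ι R (Gen.eps k h)

/-- The right hand side of the relation for `e(i) ψ_k ^ 2`. -/
def invRhs (i : Seq δ n) {k : ℕ} (h : k + 1 < n) : FreeAlgebra R (Gen δ n) :=
  if i (lo h) = i (hi h) ∨ (i.ZeroSum h ∧ i.hval (lo h) ≠ 0) then 0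
  else if (i (lo h) : R) = (i (hi h) : R) + 1 ∧ ¬ i.ZeroSum h then (fY (hi h) - fY (lo h)) * fE i
  else if (i (lo h) : R) = (i (hi h) : R) - 1 ∧ ¬ i.ZeroSum h then (fY (lo h) - fY (hi h)) * fE i
  else fE i

/-- The linear combination of dots that a bubble labelled by `i ∈ P_{k,+}` is worth. -/
def bubble (i : Seq δ n) {k : ℕ} (h : k + 1 < n) : FreeAlgebra R (Gen δ n) :=
  (i.sgn h * i.halfFactor (lo h)) •
    (∑ r ∈ i.setA1 (lo h), fY r - 2 * ∑ r ∈ i.setA2 (lo h), fY r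
      + ∑ r ∈ i.setA3 (lo h), fY r - 2 * ∑ r ∈ i.setA4 (lo h), fY r)

/-- The right hand side of the braid relation at the positions `k, k + 1, k + 2`.  The entries
of `i` there are `u, v, w`, and `j = i · s_{k+1} s_k s_{k+1}`. -/
def braidRhs (i : Seq δ n) {k : ℕ} (h : k + 1 < n) (h' : k + 1 + 1 < n) :
    FreeAlgebra R (Gen δ n) :=
  let u : R := i (lo h)
  let v : R := i (hi h)
  let w : R := i (hi h')
  let j : Seq δ n := ((i.swap h').swap h).swap h'
  if v + w = 0 ∧ u ≠ v ∧ u ≠ -v ∧ (u = v - 1 ∨ u = -(v - 1)) then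
    fE i * fEps h' * fEps h * fE j
  else if v + w = 0 ∧ u ≠ v ∧ u ≠ -v ∧ (u = v + 1 ∨ u = -(v + 1)) then
    -(fE i * fEps h' * fEps h * fE j)
  else if u + v = 0 ∧ w ≠ v ∧ w ≠ -v ∧ (w = v - 1 ∨ w = -(v - 1)) then
    fE i * fEps h * fEps h' * fE j
  else if u + v = 0 ∧ w ≠ v ∧ w ≠ -v ∧ (w = v + 1 ∨ w = -(v + 1)) then
    -(fE i * fEps h * fEps h' * fE j)
  else if u = -v ∧ w = -v ∧ v ≠ 0 ∧ v ≠ 1 / 2 ∧ v ≠ -(1 / 2) ∧ i.hval (hi h) = 0 then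
    -(i.sgn h • (fE i * fEps h * fE j))
  else if u = -v ∧ w = -v ∧ v ≠ 0 ∧ v ≠ 1 / 2 ∧ v ≠ -(1 / 2) ∧ i.hval (lo h) = 0 then
    i.sgn h' • (fE i * fEps h' * fE j)
  else if u + v ≠ 0 ∧ v + w ≠ 0 ∧ u = w ∧ u = v - 1 then fE i
  else if u + v ≠ 0 ∧ v + w ≠ 0 ∧ u = w ∧ u = v + 1 then -fE i
  else 0

/-- The defining relations of `G_n(δ)`, except for `∑ e(i) = 1`. -/
inductive Rel : FreeAlgebra R (Gen δ n) → FreeAlgebra R (Gen δ n) → Prop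
  -- idempotent relations
  | first_dot (i : Seq δ n) (h : 0 < n) :
      Rel (fY ⟨0, h⟩ ^ (if (i ⟨0, h⟩ : R) = (δ - 1) / 2 then 1 else 0) * fE i) 0
  | idem (i j : Seq δ n) : Rel (fE i * fE j) (if i = j then fE i else 0)
  | e_eps (i : Seq δ n) (k : ℕ) (h : k + 1 < n) (hi0 : ¬ i.ZeroSum h) : Rel (fE i * fEps h) 0
  | eps_e (i : Seq δ n) (k : ℕ) (h : k + 1 < n) (hi0 : ¬ i.ZeroSum h) : Rel (fEps h * fE i) 0
  | e_eps_e (i j : Seq δ n) (k : ℕ) (h : k + 1 < n) (hij : ¬ i.AgreeOff j h) :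
      Rel (fE i * fEps h * fE j) 0
  -- commutation relations
  | y_e (i : Seq δ n) (k : Fin n) : Rel (fY k * fE i) (fE i * fY k)
  | psi_e (i : Seq δ n) (k : ℕ) (h : k + 1 < n) : Rel (fPsi h * fE i) (fE (i.swap h) * fPsi h)
  | y_y (k r : Fin n) : Rel (fY k * fY r) (fY r * fY k)
  | y_psi (k : Fin n) (r : ℕ) (h : r + 1 < n) (h1 : k ≠ lo h) (h2 : k ≠ hi h) :
      Rel (fY k * fPsi h) (fPsi h * fY k)
  | y_eps (k : Fin n) (r : ℕ) (h : r + 1 < n) (h1 : k ≠ lo h) (h2 : k ≠ hi h) :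
      Rel (fY k * fEps h) (fEps h * fY k)
  | psi_psi (k r : ℕ) (hk : k + 1 < n) (hr : r + 1 < n) (hkr : k + 1 < r ∨ r + 1 < k) :
      Rel (fPsi hk * fPsi hr) (fPsi hr * fPsi hk)
  | psi_eps (k r : ℕ) (hk : k + 1 < n) (hr : r + 1 < n) (hkr : k + 1 < r ∨ r + 1 < k) :
      Rel (fPsi hk * fEps hr) (fEps hr * fPsi hk)
  | eps_eps (k r : ℕ) (hk : k + 1 < n) (hr : r + 1 < n) (hkr : k + 1 < r ∨ r + 1 < k) :
      Rel (fEps hk * fEps hr) (fEps hr * fEps hk)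
  -- essential commutation relations
  | y_lo_psi (i : Seq δ n) (k : ℕ) (h : k + 1 < n) :
      Rel (fE i * fY (lo h) * fPsi h)
        (fE i * fPsi h * fY (hi h) + fE i * fEps h * fE (i.swap h)
          - (if i (lo h) = i (hi h) then fE i else 0))
  | psi_y_lo (i : Seq δ n) (k : ℕ) (h : k + 1 < n) :
      Rel (fE i * fPsi h * fY (lo h))
        (fE i * fY (hi h) * fPsi h + fE i * fEps h * fE (i.swap h)
          - (if i (lo h) = i (hi h) then fE i else 0))
  -- inverse relations
  | psi_sq (i : Seq δ n) (k : ℕ) (h : k + 1 < n) : Rel (fE i * fPsi h ^ 2) (invRhs i h)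
  -- essential idempotent relations
  | ess_zero (i : Seq δ n) (k : ℕ) (h : k + 1 < n) (hs : i.ZeroSum h) (h0 : i.IsZero (lo h))
      (h1 : (i (lo h) : R) ≠ 1 / 2) (h2 : (i (lo h) : R) ≠ -(1 / 2)) :
      Rel (fE i * fEps h * fE i) (i.sgn h • fE i)
  | ess_plus (i : Seq δ n) (k : ℕ) (h : k + 1 < n) (hs : i.ZeroSum h) (h0 : i.IsPlus (lo h)) :
      Rel (fE i * fEps h * fE i) (-(i.sgn h • ((fY (hi h) - fY (lo h)) * fE i)))
  | ess_half_left (i : Seq δ n) (k : ℕ) (h : k + 1 < n) (hs : i.ZeroSum h) (h0 : i.IsZero (lo h))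
      (h1 : (i (lo h) : R) = 1 / 2) :
      Rel (fY (hi h) * fE i)
        (fY (lo h) * fE i - (2 * i.sgn h) • (fY (lo h) * fE i * fEps h * fE i))
  | ess_half_right (i : Seq δ n) (k : ℕ) (h : k + 1 < n) (hs : i.ZeroSum h) (h0 : i.IsZero (lo h))
      (h1 : (i (lo h) : R) = 1 / 2) :
      Rel (fY (hi h) * fE i)
        (fY (lo h) * fE i - (2 * i.sgn h) • (fE i * fEps h * fE i * fY (lo h)))
  | ess_half_three (i : Seq δ n) (k : ℕ) (h : k + 1 < n) (h' : k + 1 + 1 < n)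
      (h0 : i.IsZero (hi h)) (hu : (i (lo h) : R) = 1 / 2) (hv : (i (hi h) : R) = -(1 / 2))
      (hw : (i (hi h') : R) = 1 / 2) :
      Rel (fE i)
        (i.sgn h' • (fE i * fEps h' * fE i) + (2 * i.sgn h) • (fE i * fEps h * fE i)
          - fE i * fEps h * fEps h' * fE i - fE i * fEps h' * fEps h * fE i)
  | ess_minus (i : Seq δ n) (k : ℕ) (h : k + 1 < n) (hs : i.ZeroSum h) (h0 : i.IsMinus (lo h)) :
      Rel (fE i)
        (i.sgn h • (fE i * (fEps h * fY (lo h) + fY (lo h) * fEps h) * fE i))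
  | bubble_zero (i j l : Seq δ n) (k : ℕ) (h : k + 1 < n)
      (hi0 : i.ZeroSum h) (hj0 : j.ZeroSum h) (hl0 : l.ZeroSum h)
      (hij : i.AgreeOff j h) (hil : i.AgreeOff l h) (h0 : i.IsZero (lo h)) :
      Rel (fE j * fEps h * fE i * fEps h * fE l) (i.zval h • (fE j * fEps h * fE l))
  | bubble_minus (i j l : Seq δ n) (k : ℕ) (h : k + 1 < n)
      (hi0 : i.ZeroSum h) (hj0 : j.ZeroSum h) (hl0 : l.ZeroSum h)
      (hij : i.AgreeOff j h) (hil : i.AgreeOff l h) (h0 : i.IsMinus (lo h)) :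
      Rel (fE j * fEps h * fE i * fEps h * fE l) 0
  | bubble_plus (i j l : Seq δ n) (k : ℕ) (h : k + 1 < n)
      (hi0 : i.ZeroSum h) (hj0 : j.ZeroSum h) (hl0 : l.ZeroSum h)
      (hij : i.AgreeOff j h) (hil : i.AgreeOff l h) (h0 : i.IsPlus (lo h)) :
      Rel (fE j * fEps h * fE i * fEps h * fE l) (bubble i h * (fE j * fEps h * fE l))
  -- untwist relations
  | untwist_left (i j : Seq δ n) (k : ℕ) (h : k + 1 < n) :
      Rel (fE i * fPsi h * fEps h * fE j)
        (if i.IsPlus (lo h) ∧ (i (lo h) : R) ≠ 0 ∧ (i (lo h) : R) ≠ -(1 / 2) then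
          i.sgn h • (fE i * fEps h * fE j) else 0)
  | untwist_right (i j : Seq δ n) (k : ℕ) (h : k + 1 < n) :
      Rel (fE j * fEps h * fPsi h * fE i)
        (if i.IsPlus (lo h) ∧ (i (lo h) : R) ≠ 0 ∧ (i (lo h) : R) ≠ -(1 / 2) then
          i.sgn h • (fE j * fEps h * fE i) else 0)
  -- tangle relations
  | tangle_psi_right (i j : Seq δ n) (k : ℕ) (h : k + 1 < n) (h' : k + 1 + 1 < n) :
      Rel (fE j * fEps h' * fEps h * fPsi h' * fE i) (fE j * fEps h' * fPsi h * fE i)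
  | tangle_psi_left (i j : Seq δ n) (k : ℕ) (h : k + 1 < n) (h' : k + 1 + 1 < n) :
      Rel (fE i * fPsi h' * fEps h * fEps h' * fE j) (fE i * fPsi h * fEps h' * fE j)
  | tangle_up (i j : Seq δ n) (k : ℕ) (h : k + 1 < n) (h' : k + 1 + 1 < n) :
      Rel (fE i * fEps h' * fEps h * fEps h' * fE j) (fE i * fEps h' * fE j)
  | tangle_down (i j : Seq δ n) (k : ℕ) (h : k + 1 < n) (h' : k + 1 + 1 < n) :
      Rel (fE i * fEps h * fEps h' * fEps h * fE j) (fE i * fEps h * fE j)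
  | eps_y (i j : Seq δ n) (k : ℕ) (h : k + 1 < n) :
      Rel (fE i * fEps h * fE j * (fY (lo h) + fY (hi h))) 0
  -- braid relations
  | braid (i : Seq δ n) (k : ℕ) (h : k + 1 < n) (h' : k + 1 + 1 < n) :
      Rel (fE i * (fPsi h' * fPsi h * fPsi h' - fPsi h * fPsi h' * fPsi h)) (braidRhs i h h')

end Presentation

/-- The algebra with all the defining relations except for `∑ e(i) = 1`. -/
abbrev PreG {R : Type*} [Field R] (δ : R) (n : ℕ) : Type _ :=
  RingQuot (Rel : FreeAlgebra R (Gen δ n) → FreeAlgebra R (Gen δ n) → Prop)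

/-- The projection of the free algebra to `PreG δ n`. -/
def toPreG {R : Type*} [Field R] (δ : R) (n : ℕ) : FreeAlgebra R (Gen δ n) →ₐ[R] PreG δ n :=
  RingQuot.mkAlgHom R Rel

section FiniteSupport

variable {R : Type*} [Field R] {δ : R} {n : ℕ}

theorem toPreG_rel {a b : FreeAlgebra R (Gen δ n)} (h : Rel a b) :
    toPreG δ n a = toPreG δ n b := RingQuot.mkAlgHom_rel R h

theorem swap_swap (i : Seq δ n) {k : ℕ} (h : k + 1 < n) : (i.swap h).swap h = i := by
  funext r
  simp [Seq.swap]

/-- If the entry of `i` at `k` is not `(δ-1)/2` and cannot be reached from an earlier entry,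
then `e(i) = 0`. -/
theorem e_eq_zero (k : ℕ) : ∀ (hk : k < n) (i : Seq δ n),
    (i ⟨k, hk⟩ : R) ≠ (δ - 1) / 2 →
    (∀ r : Fin n, r.val < k → (i ⟨k, hk⟩ : R) ≠ i r ∧ (i ⟨k, hk⟩ : R) ≠ -(i r : R) ∧
      (i ⟨k, hk⟩ : R) ≠ (i r : R) + 1 ∧ (i ⟨k, hk⟩ : R) ≠ (i r : R) - 1) →
    toPreG δ n (fE i) = 0 := by
  induction k with
  | zero =>
    intro hk i h0 _
    have := toPreG_rel (Rel.first_dot i hk)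
    simpa [h0] using this
  | succ k ih =>
    intro hk i h0 hr
    have hlo : lo hk = (⟨k, Nat.lt_of_succ_lt hk⟩ : Fin n) := rfl
    have hhi : hi hk = (⟨k + 1, hk⟩ : Fin n) := rfl
    obtain ⟨q1, q2, q3, q4⟩ := hr (lo hk) (Nat.lt_succ_self k)
    rw [← hhi] at q1 q2 q3 q4 h0
    have hsw : toPreG δ n (fE (i.swap hk)) = 0 := by
      refine ih (Nat.lt_of_succ_lt hk) _ ?_ ?_
      · rw [← hlo]
        simpa [Seq.swap] using h0
      · intro r hrk
        have e1 : i.swap hk r = i r := by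
          have a1 : r ≠ lo hk := fun h => by rw [h] at hrk; exact lt_irrefl _ hrk
          have a2 : r ≠ hi hk := fun h => by
            rw [h] at hrk; exact absurd hrk (by simp [hi])
          simp [Seq.swap, Equiv.swap_apply_of_ne_of_ne a1 a2]
        have e2 : i.swap hk ⟨k, Nat.lt_of_succ_lt hk⟩ = i (hi hk) := by
          rw [← hlo]
          simp [Seq.swap]
        rw [e1, e2]
        exact hr r (Nat.lt_succ_of_lt hrk)
    have hz : ¬ i.ZeroSum hk := by
      intro h
      apply q2
      unfold Seq.ZeroSum at h
      linear_combination h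
    have hinv : invRhs i hk = fE i := by
      unfold invRhs
      rw [if_neg, if_neg, if_neg]
      · rintro ⟨h, -⟩
        exact q3 (by linear_combination -h)
      · rintro ⟨h, -⟩
        exact q4 (by linear_combination -h)
      · rintro (h | ⟨h, -⟩)
        · exact q1 (by rw [h])
        · exact hz h
    have h1 := toPreG_rel (Rel.psi_sq i k hk)
    have h2 := toPreG_rel (Rel.psi_e (i.swap hk) k hk)
    rw [swap_swap] at h2
    rw [hinv, pow_two, ← mul_assoc, map_mul, ← h2, map_mul, hsw, mul_zero, zero_mul] at h1
    exact h1.symm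

/-- The residues that can be reached from `(δ-1)/2` in `m` moves `x ↦ x, -x, x + 1, x - 1`. -/
def reach (δ : R) : ℕ → Set R
  | 0 => {(δ - 1) / 2}
  | m + 1 => reach δ m ∪ (fun x => -x) '' reach δ m ∪ (fun x => x + 1) '' reach δ m
      ∪ (fun x => x - 1) '' reach δ m

theorem reach_finite (m : ℕ) : (reach δ m).Finite := by
  induction m with
  | zero => exact Set.finite_singleton _
  | succ m ih => exact ((ih.union (ih.image _)).union (ih.image _)).union (ih.image _)

theorem reach_mono : Monotone (reach δ) :=
  monotone_nat_of_le_succ fun _ _ hx => Or.inl (Or.inl (Or.inl hx))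

/-- Only finitely many of the idempotents `e(i)` are non-zero. -/
theorem finite_support : (Function.support fun i : Seq δ n => toPreG δ n (fE i)).Finite := by
  have hfin : (Set.univ.pi fun k : Fin n => reach δ k.val).Finite :=
    Set.Finite.pi fun k : Fin n => reach_finite k.val
  have hinj : Function.Injective fun (i : Seq δ n) (k : Fin n) => (i k : R) := by
    intro i j h
    funext k
    exact Subtype.ext (congrFun h k)
  refine (hfin.preimage (f := fun (i : Seq δ n) (k : Fin n) => (i k : R)) hinj.injOn).subset ?_
  intro i hi0
  rw [Function.mem_support] at hi0
  have key : ∀ (k : ℕ) (hk : k < n), (i ⟨k, hk⟩ : R) ∈ reach δ k := by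
    intro k
    induction k using Nat.strong_induction_on with
    | _ k ih =>
      intro hk
      by_contra hcon
      apply hi0
      have hbase : (δ - 1) / 2 ∈ reach δ k := reach_mono (Nat.zero_le k) rfl
      refine e_eq_zero k hk i (fun h => hcon (h ▸ hbase)) ?_
      intro r hr
      have hmem := ih r.val hr r.isLt
      have hle : reach δ (r.val + 1) ⊆ reach δ k := reach_mono hr
      refine ⟨fun h => hcon (hle ?_), fun h => hcon (hle ?_), fun h => hcon (hle ?_),
        fun h => hcon (hle ?_)⟩
      · rw [h]; exact Or.inl (Or.inl (Or.inl hmem))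
      · rw [h]; exact Or.inl (Or.inl (Or.inr ⟨_, hmem, rfl⟩))
      · rw [h]; exact Or.inl (Or.inr ⟨_, hmem, rfl⟩)
      · rw [h]; exact Or.inr ⟨_, hmem, rfl⟩
  intro k _
  exact key k.val k.isLt

end FiniteSupport

/-- The relation `∑ e(i) = 1`; the sum is finite by `finite_support`. -/
inductive UnitRel {R : Type*} [Field R] (δ : R) (n : ℕ) : PreG δ n → PreG δ n → Prop
  | sum_e : UnitRel δ n (∑ᶠ i : Seq δ n, toPreG δ n (fE i)) 1

/-- The graded algebra `G_n(δ)`. -/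
abbrev G {R : Type*} [Field R] (δ : R) (n : ℕ) : Type _ := RingQuot (UnitRel δ n)

/-- The image of a generator in `G_n(δ)`. -/
def gen {R : Type*} [Field R] {δ : R} {n : ℕ} (g : Gen δ n) : G δ n :=
  RingQuot.mkAlgHom R (UnitRel δ n) (toPreG δ n (FreeAlgebra.ι R g))

/-! ## The grading -/

section Grading

variable {R : Type*} [Field R] {δ : R} {n : ℕ}

/-- The degree of `e(i) ψ_k`. -/
def psiDeg (i : Seq δ n) {k : ℕ} (h : k + 1 < n) : ℤ :=
  if (i (lo h) : R) = (i (hi h) : R) + 1 ∨ (i (lo h) : R) = (i (hi h) : R) - 1 then 1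
  else if i (lo h) = i (hi h) then -2
  else 0

/-- `HomMonomial d x`: the element `x` is a product of homogeneous generators `e(i)`, `y_k`,
`e(i) ψ_k` and `e(i) ε_k e(j)` whose degrees add up to `d`. -/
inductive HomMonomial : ℤ → G δ n → Prop
  | idem (i : Seq δ n) : HomMonomial 0 (gen (Gen.e i))
  | dot (k : Fin n) : HomMonomial 2 (gen (Gen.y k))
  | cross (i : Seq δ n) (k : ℕ) (h : k + 1 < n) :
      HomMonomial (psiDeg i h) (gen (Gen.e i) * gen (Gen.psi k h))
  | cupcap (i j : Seq δ n) (k : ℕ) (h : k + 1 < n) :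
      HomMonomial (i.degK (lo h) + j.degK (lo h))
        (gen (Gen.e i) * gen (Gen.eps k h) * gen (Gen.e j))
  | mul (c d : ℤ) (x z : G δ n) (hx : HomMonomial c x) (hz : HomMonomial d z) :
      HomMonomial (c + d) (x * z)

/-- The component of degree `d` of `G_n(δ)`. -/
def homogeneous (δ : R) (n : ℕ) (d : ℤ) : Submodule R (G δ n) :=
  Submodule.span R {x | HomMonomial d x}

end Grading

/-! ## Up-down tableaux -/

/-- Signed nodes: `(true, (r, c))` is the positive node in row `r` and column `c` (both counted
from `0`), and `(false, (r, c))` is its negative. -/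
abbrev SignedNode : Type := Bool × (ℕ × ℕ)

/-- The negative `-α` of a node. -/
def negNode (a : SignedNode) : SignedNode := (!a.1, a.2)

/-- The positive node in the first row and first column. -/
def alpha0 : SignedNode := (true, (0, 0))

/-- The residue of a positive node. -/
def nodeRes {R : Type*} [Field R] (δ : R) (b : ℕ × ℕ) : R := (δ - 1) / 2 + b.2 - b.1

/-- The residue of a signed node, `res (-α) = - res α`. -/
def signedRes {R : Type*} [Field R] (δ : R) (a : SignedNode) : R :=
  if a.1 then nodeRes δ a.2 else -nodeRes δ a.2

theorem signedRes_mem {R : Type*} [Field R] (δ : R) (a : SignedNode) :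
    signedRes δ a ∈ resSet δ := by
  unfold signedRes nodeRes resSet
  split
  · exact ⟨(a.2.2 : ℤ) - a.2.1, Or.inl (by push_cast; ring)⟩
  · exact ⟨(a.2.1 : ℤ) - a.2.2, Or.inr (by push_cast; ring)⟩

/-- `b` is an addable node of `lam`. -/
def IsAddable (lam : YoungDiagram) (b : ℕ × ℕ) : Prop :=
  b ∉ lam ∧ ∃ mu : YoungDiagram, mu.cells = insert b lam.cells

/-- `b` is a removable node of `lam`. -/
def IsRemovable (lam : YoungDiagram) (b : ℕ × ℕ) : Prop :=
  b ∈ lam ∧ ∃ mu : YoungDiagram, mu.cells = lam.cells.erase b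

/-- `mu` is obtained from `lam` by adding the node `a` if `a` is positive, and by removing the
node `-a` if `a` is negative. -/
def IsStep (lam mu : YoungDiagram) (a : SignedNode) : Prop :=
  if a.1 then a.2 ∉ lam ∧ mu.cells = insert a.2 lam.cells
  else a.2 ∈ lam ∧ mu.cells = lam.cells.erase a.2

/-- Up-down tableaux of size `n` and shape `(lam, f)`: paths from `(∅, 0)` to `(lam, f)` in the
branching graph of the Brauer algebras, whose vertices at level `k` are the pairs `(μ, m)` with
`|μ| + 2 m = k`.  At level `k` the path is at `(shape k, mult k)`; the signed node `node k` is
the one by which levels `k` and `k + 1` differ (it is determined by the path). -/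
@[ext]
structure UpDownTableau (n : ℕ) (lam : YoungDiagram) (f : ℕ) where
  /-- the partition at each level -/
  shape : Fin (n + 1) → YoungDiagram
  /-- the second component at each level -/
  mult : Fin (n + 1) → ℕ
  /-- the signed node added or removed in each step -/
  node : Fin n → SignedNode
  start : shape 0 = ⊥
  card_eq : ∀ k, (shape k).card + 2 * mult k = k
  finish_shape : shape (Fin.last n) = lam
  finish_mult : mult (Fin.last n) = f
  step : ∀ k : Fin n, IsStep (shape k.castSucc) (shape k.succ) (node k)

/-- The dominance order on pairs `(partition, natural number)`. -/
def PairDom (lam : YoungDiagram) (f : ℕ) (mu : YoungDiagram) (m : ℕ) : Prop :=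
  f < m ∨ (f = m ∧
    ∀ j : ℕ, ∑ r ∈ Finset.range j, lam.rowLen r ≤ ∑ r ∈ Finset.range j, mu.rowLen r)

/-- The degree of the step from `lam` to `mu` in which the signed node `a` is added. -/
def stepDeg {R : Type*} [Field R] (δ : R) (lam mu : YoungDiagram) (a : SignedNode) : ℤ :=
  if a.1 then
    ({b : ℕ × ℕ | IsAddable lam b ∧ nodeRes δ b = nodeRes δ a.2 ∧ a.2.1 < b.1}.ncard : ℤ)
      - {b : ℕ × ℕ | IsRemovable lam b ∧ nodeRes δ b = nodeRes δ a.2 ∧ a.2.1 < b.1}.ncard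
  else
    ({b : ℕ × ℕ | IsAddable mu b ∧ nodeRes δ b = -nodeRes δ a.2 ∧ b.1 ≠ a.2.1}.ncard : ℤ)
      - {b : ℕ × ℕ | IsRemovable mu b ∧ nodeRes δ b = -nodeRes δ a.2}.ncard
      + (if nodeRes δ a.2 = -(1 / 2) then 1 else 0)

namespace UpDownTableau

variable {n : ℕ} {lam : YoungDiagram} {f : ℕ}

/-- The dominance order on up-down tableaux, `s ⊴ t`. -/
def Dom (s t : UpDownTableau n lam f) : Prop :=
  ∀ k : Fin (n + 1), PairDom (s.shape k) (s.mult k) (t.shape k) (t.mult k)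

/-- The degree of an up-down tableau. -/
def deg {R : Type*} [Field R] (δ : R) (t : UpDownTableau n lam f) : ℤ :=
  ∑ k : Fin n, stepDeg δ (t.shape k.castSucc) (t.shape k.succ) (t.node k)

/-- An up-down tableau as a list of signed nodes. -/
def word (t : UpDownTableau n lam f) : List SignedNode := List.ofFn t.node

end UpDownTableau

/-! ## The elements `ψ_st` -/

/-- The residue sequence of a list of `n` signed nodes. -/
def resSeq {R : Type*} [Field R] (δ : R) (n : ℕ) (w : List SignedNode) : Seq δ n :=
  fun k => ⟨signedRes δ (w.getD k alpha0), signedRes_mem δ _⟩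

/-- The head of an up-down tableau: the number of pairs `(α₀, -α₀)` that it begins with. -/
def head : List SignedNode → ℕ
  | a :: b :: l => if a = alpha0 ∧ b = negNode alpha0 then head l + 1 else 0
  | _ => 0

/-- The position of the first negative node after the initial pairs `(α₀, -α₀)`. -/
def posB (w : List SignedNode) : ℕ :=
  ((List.range w.length).find? fun b =>
    decide (2 * head w ≤ b ∧ (w.getD b alpha0).1 = false)).getD 0

/-- The last position before `posB w` that holds the negative of the node at `posB w`. -/
def posA (w : List SignedNode) : ℕ :=
  ((List.range (posB w)).reverse.find? fun a =>
    decide (w.getD a alpha0 = negNode (w.getD (posB w) alpha0))).getD 0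

/-- One step `s → t` of the standard reduction sequence: `s = reduceStep t` arises by deleting
the first nontrivial removable pair of `t`, and putting `(α₀, -α₀)` in front. -/
def reduceStep (w : List SignedNode) : List SignedNode :=
  alpha0 :: negNode alpha0 :: ((w.eraseIdx (posB w)).eraseIdx (posA w))

section Words

variable {R : Type*} [Field R]

/-- The one-letter word `ψ_k`. -/
def psiLetter (δ : R) (n k : ℕ) : List (Gen δ n) :=
  if h : k + 1 < n then [Gen.psi k h] else []

/-- The one-letter word `ε_k`. -/
def epsLetter (δ : R) (n k : ℕ) : List (Gen δ n) :=
  if h : k + 1 < n then [Gen.eps k h] else []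

/-- The word `ε_{s → t} = e(i_s) ε_{2h+1} ⋯ ε_a ψ_{a+1} ⋯ ψ_{b-1} e(i_t)`, where `s` is the
reduction of `t`, `h` is the head of `t`, and `a < b` are the positions of the pair of `t` that
is deleted (all indices counted from `0`). -/
def epsStep (δ : R) (n : ℕ) (t : List SignedNode) : List (Gen δ n) :=
  [Gen.e (resSeq δ n (reduceStep t))]
    ++ (List.Ico (2 * head t + 1) (posA t + 1)).flatMap (epsLetter δ n)
    ++ (List.Ico (posA t + 1) (posB t)).flatMap (psiLetter δ n)
    ++ [Gen.e (resSeq δ n t)]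

/-- The word `ε_t = ε_{t^(m) → t^(m-1)} ⋯ ε_{t^(1) → t^(0)}` of a standard reduction sequence of
length `m`; if `m = 0` it is `e(i_t)`. -/
def epsSeq (δ : R) (n : ℕ) : ℕ → List SignedNode → List (Gen δ n)
  | 0, t => [Gen.e (resSeq δ n t)]
  | 1, t => epsStep δ n t
  | m + 2, t => epsSeq δ n (m + 1) (reduceStep t) ++ epsStep δ n t

/-- The word `ψ_{k_1} ⋯ ψ_{k_l}`. -/
def psiWord (δ : R) (n : ℕ) (ks : List ℕ) : List (Gen δ n) := ks.flatMap (psiLetter δ n)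

/-- The word `e(i) ε_0 ε_2 ⋯ ε_{2f-2} e(i)`, where `i` is the residue sequence of `t0`. -/
def idemWord (δ : R) (n f : ℕ) (t0 : List SignedNode) : List (Gen δ n) :=
  [Gen.e (resSeq δ n t0)] ++ (List.range f).flatMap (fun m => epsLetter δ n (2 * m))
    ++ [Gen.e (resSeq δ n t0)]

/-- The element of `G_n(δ)` that a word in the generators stands for. -/
def evalWord {δ : R} {n : ℕ} (w : List (Gen δ n)) : G δ n := (w.map gen).prod

end Words

/-- The list obtained by exchanging the entries at positions `k` and `k + 1`. -/
def swapAt (w : List SignedNode) (k : ℕ) : List SignedNode :=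
  (w.set k (w.getD (k + 1) alpha0)).set (k + 1) (w.getD k alpha0)

/-- The permutation `s_{k_1} ⋯ s_{k_l}`. -/
def wordPerm (ks : List ℕ) : Equiv.Perm ℕ := (ks.map fun k => Equiv.swap k (k + 1)).prod

/-- `ks` is a reduced expression `s_{k_1} ⋯ s_{k_l}` of an element of the subgroup of the
symmetric group that permutes the last `n - 2f` of `n` positions. -/
def IsReducedWord (n f : ℕ) (ks : List ℕ) : Prop :=
  (∀ k ∈ ks, 2 * f ≤ k ∧ k + 1 < n) ∧
    ∀ ks' : List ℕ, wordPerm ks' = wordPerm ks → ks.length ≤ ks'.length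

namespace UpDownTableau

variable {n : ℕ} {lam : YoungDiagram} {f : ℕ}

/-- The length `f - h` of the reduction sequences of `t`, where `h ≤ f` is its head. -/
def redLength (t : UpDownTableau n lam f) : ℕ := f - head t.word

/-- The last tableau `h(t)` of the standard reduction sequence of `t`. -/
def reduced (t : UpDownTableau n lam f) : List SignedNode := reduceStep^[t.redLength] t.word

/-- `t0` is maximal in the dominance order among the up-down tableaux of its shape. -/
def IsMaximal (t0 : UpDownTableau n lam f) : Prop :=
  ∀ u : UpDownTableau n lam f, t0.Dom u → u = t0

/-- `ks` is a reduced expression of the permutation `d(t)` of the last `n - 2f` positions with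
`t0 · d(t) = h(t)`. -/
def IsExpression (t0 t : UpDownTableau n lam f) (ks : List ℕ) : Prop :=
  IsReducedWord n f ks ∧ ks.foldl swapAt t0.word = t.reduced

/-- The element `ψ_st = ε_s^* ψ_s^* e_{(λ,f)} ψ_t ε_t` of `G_n(δ)`, formed with the reduced
expressions `ws` and `wt` of `d(s)` and `d(t)`.  The anti-involution `*` fixes all generators,
that is, it reverses words. -/
def psiST {R : Type*} [Field R] (δ : R) (t0 s t : UpDownTableau n lam f) (ws wt : List ℕ) :
    G δ n :=
  evalWord ((epsSeq δ n s.redLength s.word).reverse ++ (psiWord δ n ws).reverse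
    ++ idemWord δ n f t0.word ++ psiWord δ n wt ++ epsSeq δ n t.redLength t.word)

end UpDownTableau

end

end BrauerKLR

namespace BrauerKLR

/-! ## Addable and removable nodes -/

/-! A product of generators is homogeneous as soon as the idempotents that can be inserted between
its factors are forced; its degree is then the sum of the degrees of the factors. So two things are
needed: in each factor of `psiST` all intermediate residue sequences are determined, and the degrees
add up correctly.

Degrees. In characteristic zero residues separate diagonals, so additions have degree 0
(`stepDeg_pos`) and only removals count. Write `remDeg δ mu b` for the degree of removing `b` so as
to reach `mu`. The number of addable minus removable nodes of a given residue is a sum over the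
nodes of the partition (`numAdd_sub_numRem`). Hence `h_k` of the residue sequence of a walk depends
only on the partition reached before step k (`hval_resSeq`), and `deg_k` is `remDeg` of the node if
it is about to be added, and minus `remDeg` if it is about to be removed (`degK_add`,
`degK_remove`).

One reduction step. Along a chain of cup-caps the inner contributions cancel in pairs
(`homWord_epsRun`). The crossings that follow move the removal of `b` past later additions, and each
one measures the change of `remDeg` (`crossDeg_eq`, `rigidWord_psiRun`). Altogether the step has the
degree of the tableau minus the degree of its reduction.

Conclusion. The fully reduced tableau consists of f pairs (α₀, -α₀) followed by additions, so it has
degree f·c with c = `remDeg δ ⊥ (0, 0)`, and ε_t has degree deg t - f·c. A reduced expression of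
d(t) only crosses nodes that are incomparable, hence at least two diagonals apart, so ψ_t has degree
0 (`rigidWord_psiWord_of_reduced`). The middle factor has degree 2f·c (`cupWord_mem`), and the terms
with c cancel. -/

theorem mem_of_le_of_insert {lam mu : YoungDiagram} {b c : ℕ × ℕ}
    (h : mu.cells = insert b lam.cells) (hc : c ≤ b) (hne : c ≠ b) : c ∈ lam := by
  have hb : b ∈ mu := by rw [← YoungDiagram.mem_cells, h]; exact Finset.mem_insert_self _ _
  have hcm : c ∈ mu.cells := mu.isLowerSet hc hb
  rw [h] at hcm
  exact (Finset.mem_insert.1 hcm).resolve_left hne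

theorem IsAddable.mem_of_lt {lam : YoungDiagram} {b c : ℕ × ℕ} (h : IsAddable lam b)
    (hc : c ≤ b) (hne : c ≠ b) : c ∈ lam := by
  obtain ⟨-, mu, hmu⟩ := h
  exact mem_of_le_of_insert hmu hc hne

theorem IsAddable.eq_of_le {lam : YoungDiagram} {b c : ℕ × ℕ} (hb : IsAddable lam b)
    (hc : IsAddable lam c) (h : c ≤ b) : c = b := by
  by_contra hne
  exact hc.1 (hb.mem_of_lt h hne)

/-- Nodes on equal or adjacent diagonals are comparable. -/
theorem le_or_le_of_diagonal {b c : ℕ × ℕ} (h : ((b.2 : ℤ) - b.1) - (c.2 - c.1) ≤ 1)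
    (h' : -1 ≤ ((b.2 : ℤ) - b.1) - (c.2 - c.1)) : b ≤ c ∨ c ≤ b := by
  rw [Prod.le_def, Prod.le_def]
  omega

/-- Addable nodes form an antichain, whereas nodes on equal or adjacent diagonals are comparable.
The adjacent case matters for residue -1/2 and for crossings at residue 0. -/
theorem IsAddable.eq_of_diagonal {lam : YoungDiagram} {b c : ℕ × ℕ} (hb : IsAddable lam b)
    (hc : IsAddable lam c) (h : ((b.2 : ℤ) - b.1) - (c.2 - c.1) ≤ 1)
    (h' : -1 ≤ ((b.2 : ℤ) - b.1) - (c.2 - c.1)) : b = c := by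
  rcases le_or_le_of_diagonal h h' with h | h
  · exact hc.eq_of_le hb h
  · exact (hb.eq_of_le hc h).symm

theorem IsRemovable.eq_of_le {lam : YoungDiagram} {b c : ℕ × ℕ} (hb : IsRemovable lam b)
    (hc : c ∈ lam) (h : b ≤ c) : b = c := by
  obtain ⟨hb1, mu, hmu⟩ := hb
  by_contra hne
  have : c ∈ mu.cells := by
    rw [hmu]; exact Finset.mem_erase.2 ⟨fun h => hne h.symm, hc⟩
  have : b ∈ mu.cells := mu.isLowerSet h this
  rw [hmu] at this
  simp at this

theorem IsRemovable.eq_of_diagonal {lam : YoungDiagram} {b c : ℕ × ℕ} (hb : IsRemovable lam b)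
    (hc : IsRemovable lam c) (h : ((b.2 : ℤ) - b.1) = (c.2 - c.1)) : b = c := by
  rcases le_or_le_of_diagonal (b := b) (c := c) (by omega) (by omega) with h | h
  · exact hb.eq_of_le hc.1 h
  · exact (hc.eq_of_le hb.1 h).symm

theorem IsAddable.not_isRemovable_of_diagonal {lam : YoungDiagram} {b c : ℕ × ℕ}
    (hb : IsAddable lam b) (hc : IsRemovable lam c)
    (h : ((b.2 : ℤ) - b.1) = (c.2 - c.1)) : False := by
  have hne : b ≠ c := fun h => hb.1 (h ▸ hc.1)
  have h1 : ¬ b ≤ c := fun h => hb.1 (lam.isLowerSet h hc.1)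
  rw [Prod.le_def] at h1
  -- On a common diagonal `b` lies strictly to the lower right of `c`, so the right neighbour of `c`
  -- is weakly above and to the left of `b`, and it is not `b` because its diagonal differs. It
  -- therefore belongs to `lam` and blocks the removal of `c`.
  have h2 : (c.1, c.2 + 1) ∈ lam := by
    refine hb.mem_of_lt ?_ ?_
    · rw [Prod.le_def]; dsimp only; omega
    · intro h3; rw [← h3] at h; simp at h
  have := hc.eq_of_le h2 (by rw [Prod.le_def]; simp)
  have := congrArg Prod.snd this
  simp at this

theorem isAddable_iff {lam : YoungDiagram} {r c : ℕ} :
    IsAddable lam (r, c) ↔ c = lam.rowLen r ∧ (r = 0 ∨ lam.rowLen r < lam.rowLen (r - 1)) := by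
  constructor
  · intro h
    have h0 := h.1
    rw [YoungDiagram.mem_iff_lt_rowLen] at h0
    have hc : c = lam.rowLen r := by
      by_contra hne
      have : (r, c - 1) ∈ lam := h.mem_of_lt (by rw [Prod.le_def]; dsimp only; omega)
        (by intro h3; have := congrArg Prod.snd h3; dsimp only at this; omega)
      rw [YoungDiagram.mem_iff_lt_rowLen] at this
      omega
    refine ⟨hc, ?_⟩
    by_contra hcon
    push Not at hcon
    have : (r - 1, c) ∈ lam := h.mem_of_lt (by rw [Prod.le_def]; dsimp only; omega)
      (by intro h3; have := congrArg Prod.fst h3; dsimp only at this; omega)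
    rw [YoungDiagram.mem_iff_lt_rowLen] at this
    omega
  · rintro ⟨rfl, h⟩
    refine ⟨by simp [YoungDiagram.mem_iff_lt_rowLen], ⟨insert (r, lam.rowLen r) lam.cells, ?_⟩, rfl⟩
    intro a b hba ha
    simp only [Finset.coe_insert, Set.mem_insert_iff, Finset.mem_coe,
      YoungDiagram.mem_cells] at ha ⊢
    rcases ha with rfl | ha
    · obtain ⟨b1, b2⟩ := b
      rw [Prod.le_def] at hba
      dsimp only at hba
      by_cases hb1 : b1 = r
      · subst hb1
        rw [YoungDiagram.mem_iff_lt_rowLen, Prod.mk.injEq]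
        omega
      · right
        rw [YoungDiagram.mem_iff_lt_rowLen]
        have := lam.rowLen_anti b1 (r - 1) (by omega)
        omega
    · exact Or.inr (lam.isLowerSet hba ha)

theorem isRemovable_iff {lam : YoungDiagram} {r c : ℕ} :
    IsRemovable lam (r, c) ↔ c + 1 = lam.rowLen r ∧ lam.rowLen (r + 1) < lam.rowLen r := by
  constructor
  · intro h
    have h0 := h.1
    rw [YoungDiagram.mem_iff_lt_rowLen] at h0
    have h1 : (r, c + 1) ∉ lam := fun h1 => by
      have := h.eq_of_le h1 (by rw [Prod.le_def]; simp)
      simp at this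
    have h2 : (r + 1, c) ∉ lam := fun h1 => by
      have := h.eq_of_le h1 (by rw [Prod.le_def]; simp)
      simp at this
    rw [YoungDiagram.mem_iff_lt_rowLen] at h1 h2
    omega
  · rintro ⟨hc, h⟩
    refine ⟨by rw [YoungDiagram.mem_iff_lt_rowLen]; omega, ⟨lam.cells.erase (r, c), ?_⟩, rfl⟩
    intro a b hba ha
    simp only [Finset.coe_erase, Set.mem_sdiff, Finset.mem_coe, YoungDiagram.mem_cells,
      Set.mem_singleton_iff] at ha ⊢
    refine ⟨lam.isLowerSet hba ha.1, ?_⟩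
    rintro rfl
    obtain ⟨a1, a2⟩ := a
    rw [Prod.le_def] at hba
    dsimp only at hba
    have h3 := ha.1
    have h4 := ha.2
    rw [YoungDiagram.mem_iff_lt_rowLen] at h3
    rw [Prod.mk.injEq] at h4
    by_cases h5 : a1 = r
    · subst h5; omega
    · have := lam.rowLen_anti (r + 1) a1 (by omega)
      omega

/-! ## Counting nodes of a given residue -/

section Counting

variable {R : Type*} [Field R] (δ : R)

/-- `1` if `a = b`, and `0` otherwise. -/
noncomputable def ind (a b : R) : ℤ := if a = b then 1 else 0

theorem nodeRes_eq_iff [CharZero R] {b c : ℕ × ℕ} :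
    nodeRes δ b = nodeRes δ c ↔ ((b.2 : ℤ) - b.1) = (c.2 - c.1) := by
  unfold nodeRes
  rw [add_sub_assoc, add_sub_assoc, add_right_inj]
  constructor
  · intro h; exact_mod_cast (by push_cast; exact h : (((b.2 : ℤ) - b.1 : ℤ) : R) = ((c.2 - c.1 : ℤ) : R))
  · intro h; exact_mod_cast congrArg (Int.cast : ℤ → R) h

theorem nodeRes_eq_add_one_iff [CharZero R] {b c : ℕ × ℕ} :
    nodeRes δ b = nodeRes δ c + 1 ↔ ((b.2 : ℤ) - b.1) = (c.2 - c.1) + 1 := by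
  have := nodeRes_eq_iff δ (b := b) (c := (c.1, c.2 + 1))
  have h2 : nodeRes δ (c.1, c.2 + 1) = nodeRes δ c + 1 := by unfold nodeRes; push_cast; ring
  rw [h2] at this
  rw [this]; push_cast
  constructor <;> intro h <;> omega

/-- The number of addable nodes of residue `x`. -/
noncomputable def numAdd (lam : YoungDiagram) (x : R) : ℕ :=
  {b : ℕ × ℕ | IsAddable lam b ∧ nodeRes δ b = x}.ncard

/-- The number of removable nodes of residue `x`. -/
noncomputable def numRem (lam : YoungDiagram) (x : R) : ℕ :=
  {b : ℕ × ℕ | IsRemovable lam b ∧ nodeRes δ b = x}.ncard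

/-- The contribution of a node of residue `v` to the defect at `x`. -/
noncomputable def nodeDefect (x v : R) : ℤ := ind (v + 1) x + ind (v - 1) x - 2 * ind v x

/-- Each row holds at most one candidate, given by `g`, so counting nodes becomes a sum over rows,
in which telescoping is possible. -/
theorem ncard_eq_sum_range {p : ℕ × ℕ → Prop} (g : ℕ → ℕ × ℕ) (N : ℕ) (q : ℕ → Prop)
    [DecidablePred q] (hg : ∀ r, (g r).1 = r) (h : ∀ b, p b ↔ b.1 < N ∧ b = g b.1 ∧ q b.1) :
    ({b | p b}.ncard : ℤ) = ∑ r ∈ Finset.range N, if q r then 1 else 0 := by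
  have : {b | p b} = (((Finset.range N).filter q).image g : Finset (ℕ × ℕ)) := by
    ext b
    simp only [Set.mem_ofPred_eq, h, Finset.coe_image, Finset.coe_filter, Finset.mem_range,
      Set.mem_image]
    constructor
    · rintro ⟨h1, h2, h3⟩; exact ⟨b.1, ⟨h1, h3⟩, h2.symm⟩
    · rintro ⟨r, ⟨h1, h2⟩, rfl⟩
      rw [hg]; exact ⟨h1, rfl, h2⟩
  rw [this, Set.ncard_coe_finset, Finset.card_image_of_injective, Finset.sum_boole]
  · intro a b hab
    rw [← hg a, ← hg b, hab]

theorem sum_cells_eq (lam : YoungDiagram) (F : ℕ × ℕ → ℤ) :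
    ∑ b ∈ lam.cells, F b
      = ∑ r ∈ Finset.range (lam.colLen 0), ∑ c ∈ Finset.range (lam.rowLen r), F (r, c) := by
  apply Finset.sum_finset_product
  rintro ⟨r, c⟩
  simp only [YoungDiagram.mem_cells, Finset.mem_range]
  rw [← YoungDiagram.mem_iff_lt_rowLen, ← YoungDiagram.mem_iff_lt_colLen]
  exact ⟨fun h => ⟨lam.isLowerSet (Prod.mk_le_mk.2 ⟨le_rfl, Nat.zero_le _⟩) h, h⟩, fun h => h.2⟩

/-- `nodeDefect x` is a second difference in the residue, and residues grow by one along a row, so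
only terms at the two ends of the row survive. -/
theorem sum_row_nodeDefect (r m : ℕ) (x : R) :
    ∑ c ∈ Finset.range m, nodeDefect x (nodeRes δ (r, c))
      = (ind (nodeRes δ (r, m)) x - ind (nodeRes δ (r, m) - 1) x)
        - (ind (nodeRes δ (r, 0)) x - ind (nodeRes δ (r, 0) - 1) x) := by
  induction m with
  | zero => simp
  | succ m ih =>
    rw [Finset.sum_range_succ, ih]
    have : nodeRes δ (r, m + 1) = nodeRes δ (r, m) + 1 := by unfold nodeRes; push_cast; ring
    rw [this, nodeDefect, add_sub_cancel_right]
    ring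

theorem rowLen_eq_zero {lam : YoungDiagram} {r : ℕ} (h : lam.colLen 0 ≤ r) : lam.rowLen r = 0 := by
  by_contra hne
  have : (r, 0) ∈ lam := YoungDiagram.mem_iff_lt_rowLen.2 (by omega)
  rw [YoungDiagram.mem_iff_lt_colLen] at this
  omega

/-- The number of addable minus the number of removable nodes of residue `x`. -/
theorem numAdd_sub_numRem (lam : YoungDiagram) (x : R) :
    (numAdd δ lam x : ℤ) - numRem δ lam x
      = ind ((δ - 1) / 2) x + ∑ b ∈ lam.cells, nodeDefect x (nodeRes δ b) := by
  set L := lam.colLen 0 with hL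
  have h0 : ∀ r, L ≤ r → lam.rowLen r = 0 := fun r hr => rowLen_eq_zero hr
  -- There are `L + 1` rows because the empty row `L` may receive a node, while removable nodes lie
  -- in the first `L` rows.
  have hA : (numAdd δ lam x : ℤ) = ∑ r ∈ Finset.range (L + 1),
      if (r = 0 ∨ lam.rowLen r < lam.rowLen (r - 1)) ∧ nodeRes δ (r, lam.rowLen r) = x
        then 1 else 0 := by
    refine ncard_eq_sum_range (fun r => (r, lam.rowLen r)) _ _ (fun _ => rfl) ?_
    rintro ⟨r, c⟩
    rw [isAddable_iff]
    dsimp only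
    constructor
    · rintro ⟨⟨rfl, h⟩, h1⟩
      refine ⟨?_, rfl, h, h1⟩
      rcases h with h | h
      · omega
      · by_contra hr
        rw [h0 (r - 1) (by omega)] at h
        omega
    · rintro ⟨-, h, h1, h2⟩
      have h := congrArg Prod.snd h
      dsimp only at h
      exact ⟨⟨h, h1⟩, h ▸ h2⟩
  have hR : (numRem δ lam x : ℤ) = ∑ r ∈ Finset.range L,
      if lam.rowLen (r + 1) < lam.rowLen r ∧ nodeRes δ (r, lam.rowLen r) - 1 = x
        then 1 else 0 := by
    have hres : ∀ r, 0 < lam.rowLen r →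
        nodeRes δ (r, lam.rowLen r - 1) = nodeRes δ (r, lam.rowLen r) - 1 := by
      intro r hr
      unfold nodeRes
      dsimp only
      rw [Nat.cast_sub (by omega)]
      push_cast; ring
    refine ncard_eq_sum_range (fun r => (r, lam.rowLen r - 1)) _ _ (fun _ => rfl) ?_
    rintro ⟨r, c⟩
    rw [isRemovable_iff]
    dsimp only
    constructor
    · rintro ⟨⟨hc, h⟩, h1⟩
      have hc' : c = lam.rowLen r - 1 := by omega
      refine ⟨?_, by rw [hc'], h, ?_⟩
      · by_contra hr
        rw [h0 r (by omega)] at h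
        omega
      · rw [← hres r (by omega), ← hc', h1]
    · rintro ⟨-, h, h1, h2⟩
      have h := congrArg Prod.snd h
      dsimp only at h
      rw [← hres r (by omega), ← h] at h2
      exact ⟨⟨by omega, h1⟩, h2⟩
  rw [hA, hR, sum_cells_eq, Finset.sum_congr rfl (fun r _ => sum_row_nodeDefect δ r _ x),
    Finset.sum_range_succ']
  -- The terms at the row starts telescope down the first column.
  have h1 : ∀ N, ∑ r ∈ Finset.range N, (ind (nodeRes δ (r, 0)) x - ind (nodeRes δ (r, 0) - 1) x)
      = ind ((δ - 1) / 2) x - ind ((δ - 1) / 2 - N) x := by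
    intro N
    induction N with
    | zero => simp
    | succ N ih =>
      rw [Finset.sum_range_succ, ih]
      simp only [nodeRes, Nat.cast_zero, add_zero, Nat.cast_succ, sub_sub]
      ring
  -- The conditions on row lengths can be dropped: if rows `r` and `r + 1` are equally long, neither
  -- candidate exists, but their residues agree and the two indicators cancel.
  have h2 : ∀ r, (if (r + 1 = 0 ∨ lam.rowLen (r + 1) < lam.rowLen (r + 1 - 1)) ∧
        nodeRes δ (r + 1, lam.rowLen (r + 1)) = x then (1 : ℤ) else 0)
      - (if lam.rowLen (r + 1) < lam.rowLen r ∧ nodeRes δ (r, lam.rowLen r) - 1 = x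
          then 1 else 0)
      = ind (nodeRes δ (r + 1, lam.rowLen (r + 1))) x - ind (nodeRes δ (r, lam.rowLen r) - 1) x := by
    intro r
    have h3 : r + 1 ≠ 0 := by omega
    by_cases h : lam.rowLen (r + 1) < lam.rowLen r
    · simp [h, ind]
    · have h4 : lam.rowLen (r + 1) = lam.rowLen r :=
        le_antisymm (lam.rowLen_anti _ _ (by omega)) (by omega)
      have h5 : nodeRes δ (r + 1, lam.rowLen r) = nodeRes δ (r, lam.rowLen r) - 1 := by
        unfold nodeRes; push_cast; ring
      simp [h4, h5]
  have h6 : ∀ N, ∑ r ∈ Finset.range N, ind (nodeRes δ (r + 1, lam.rowLen (r + 1))) x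
      = ∑ r ∈ Finset.range N, ind (nodeRes δ (r, lam.rowLen r)) x
        + ind (nodeRes δ (N, lam.rowLen N)) x - ind (nodeRes δ (0, lam.rowLen 0)) x := by
    intro N
    rw [eq_sub_iff_add_eq, ← Finset.sum_range_succ,
      ← Finset.sum_range_succ' (fun r => ind (nodeRes δ (r, lam.rowLen r)) x)]
  have h7 := Finset.sum_congr rfl (fun r (_ : r ∈ Finset.range L) => h2 r)
  rw [Finset.sum_sub_distrib, Finset.sum_sub_distrib, h6] at h7
  -- The empty row `L` ends where it starts, so its term cancels the one left over by the first
  -- column.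
  have h8 : nodeRes δ (L, lam.rowLen L) = (δ - 1) / 2 - L := by
    rw [h0 L le_rfl]; simp [nodeRes]
  rw [h8] at h7
  rw [Finset.sum_sub_distrib, h1, Finset.sum_sub_distrib]
  have h9 : (if (0 = 0 ∨ lam.rowLen 0 < lam.rowLen (0 - 1)) ∧ nodeRes δ (0, lam.rowLen 0) = x
      then (1 : ℤ) else 0) = ind (nodeRes δ (0, lam.rowLen 0)) x := by simp [ind]
  rw [h9]
  linarith

end Counting

/-! ## Degrees of steps -/

section Degrees

variable {R : Type*} [Field R] (δ : R)

theorem eq_of_nodeRes [CharZero R] {lam : YoungDiagram} {b c : ℕ × ℕ}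
    (hb : IsAddable lam b) (hc : IsAddable lam c)
    (h : nodeRes δ b = nodeRes δ c ∨ nodeRes δ b = nodeRes δ c + 1 ∨
      nodeRes δ c = nodeRes δ b + 1) : b = c := by
  rw [nodeRes_eq_iff, nodeRes_eq_add_one_iff, nodeRes_eq_add_one_iff] at h
  exact hb.eq_of_diagonal hc (by omega) (by omega)

theorem numAdd_eq_one [CharZero R] {lam : YoungDiagram} {b : ℕ × ℕ} (hb : IsAddable lam b) :
    numAdd δ lam (nodeRes δ b) = 1 := by
  unfold numAdd
  rw [Set.ncard_eq_one]
  refine ⟨b, Set.ext fun c => ⟨fun h => ?_, fun h => ?_⟩⟩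
  · exact eq_of_nodeRes δ h.1 hb (Or.inl h.2)
  · rw [Set.mem_singleton_iff] at h
    subst h; exact ⟨hb, rfl⟩

theorem numRem_eq_zero [CharZero R] {lam : YoungDiagram} {b : ℕ × ℕ} (hb : IsAddable lam b) :
    numRem δ lam (nodeRes δ b) = 0 := by
  unfold numRem
  convert Set.ncard_empty (ℕ × ℕ)
  refine Set.eq_empty_of_forall_notMem fun c h => ?_
  exact hb.not_isRemovable_of_diagonal h.1 ((nodeRes_eq_iff δ).1 h.2.symm)

theorem ncard_le_one_of_subsingleton {α : Type*} {s : Set α} (hs : s.Subsingleton) :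
    s.ncard ≤ 1 := by
  rcases hs.eq_empty_or_singleton with rfl | ⟨a, rfl⟩ <;> simp

theorem numAdd_le_one [CharZero R] (lam : YoungDiagram) (x : R) : numAdd δ lam x ≤ 1 :=
  ncard_le_one_of_subsingleton fun _ h _ h' =>
    eq_of_nodeRes δ h.1 h'.1 (Or.inl (h.2.trans h'.2.symm))

theorem numRem_le_one [CharZero R] (lam : YoungDiagram) (x : R) : numRem δ lam x ≤ 1 :=
  ncard_le_one_of_subsingleton fun _ h _ h' =>
    h.1.eq_of_diagonal h'.1 ((nodeRes_eq_iff δ).1 (h.2.trans h'.2.symm))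

/-- Needed at residue x = -1/2, where -x = x + 1 is the residue of an adjacent diagonal. -/
theorem numAdd_add_one_eq_zero [CharZero R] {lam : YoungDiagram} {b : ℕ × ℕ}
    (hb : IsAddable lam b) : numAdd δ lam (nodeRes δ b + 1) = 0 := by
  unfold numAdd
  convert Set.ncard_empty (ℕ × ℕ)
  refine Set.eq_empty_of_forall_notMem fun c h => ?_
  have := eq_of_nodeRes δ h.1 hb (Or.inr (Or.inl h.2))
  subst this
  have := h.2
  simp at this

/-- The degree of the removal of the node `b` that leads to the partition `mu`. -/
noncomputable def remDeg (mu : YoungDiagram) (b : ℕ × ℕ) : ℤ := stepDeg δ mu mu (false, b)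

theorem stepDeg_neg (lam mu : YoungDiagram) (b : ℕ × ℕ) :
    stepDeg δ lam mu (false, b) = remDeg δ mu b := by
  simp [stepDeg, remDeg]

/-- A competing node of the same residue would lie on the diagonal of `b`, which has no other
addable and no removable node. Hence the degree of a tableau comes from its removals alone. -/
theorem stepDeg_pos [CharZero R] {lam mu : YoungDiagram} {b : ℕ × ℕ} (hb : IsAddable lam b) :
    stepDeg δ lam mu (true, b) = 0 := by
  have h1 : {c : ℕ × ℕ | IsAddable lam c ∧ nodeRes δ c = nodeRes δ b ∧ b.1 < c.1} = ∅ := by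
    refine Set.eq_empty_of_forall_notMem fun c h => ?_
    have := eq_of_nodeRes δ h.1 hb (Or.inl h.2.1)
    subst this
    exact lt_irrefl _ h.2.2
  have h2 : {c : ℕ × ℕ | IsRemovable lam c ∧ nodeRes δ c = nodeRes δ b ∧ b.1 < c.1} = ∅ := by
    refine Set.eq_empty_of_forall_notMem fun c h => ?_
    exact hb.not_isRemovable_of_diagonal h.1 ((nodeRes_eq_iff δ).1 h.2.1.symm)
  simp [stepDeg, h1, h2]

/-- For residue 0 the nodes counted lie on the diagonal of `b` itself, and the row condition
excludes `b`, the only candidate. -/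
theorem remDeg_of_eq_zero [CharZero R] {mu : YoungDiagram} {b : ℕ × ℕ} (hb : IsAddable mu b)
    (h0 : nodeRes δ b = 0) : remDeg δ mu b = 0 := by
  have h1 : {c : ℕ × ℕ | IsAddable mu c ∧ nodeRes δ c = -nodeRes δ b ∧ c.1 ≠ b.1} = ∅ := by
    refine Set.eq_empty_of_forall_notMem fun c h => ?_
    have := eq_of_nodeRes δ h.1 hb (Or.inl (by rw [h.2.1, h0, neg_zero]))
    exact h.2.2 (by rw [this])
  have h2 : {c : ℕ × ℕ | IsRemovable mu c ∧ nodeRes δ c = -nodeRes δ b} = ∅ := by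
    refine Set.eq_empty_of_forall_notMem fun c h => ?_
    exact hb.not_isRemovable_of_diagonal h.1
      ((nodeRes_eq_iff δ).1 (by rw [h.2, h0, neg_zero]))
  have h3 : nodeRes δ b ≠ -(1 / 2) := by rw [h0]; norm_num
  simp only [remDeg, stepDeg, h1, h2]
  rw [if_neg h3]
  simp

theorem IsAddable.eq_of_fst {lam : YoungDiagram} {b c : ℕ × ℕ} (hb : IsAddable lam b)
    (hc : IsAddable lam c) (h : b.1 = c.1) : b = c := by
  obtain ⟨b1, b2⟩ := b
  obtain ⟨c1, c2⟩ := c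
  dsimp only at h
  subst h
  rw [isAddable_iff] at hb hc
  rw [hb.1, hc.1]

/-- The row condition is void here: the only addable node in the row of `b` is `b`, whose nonzero
residue is not its own negative. So `remDeg` becomes a difference to which `numAdd_sub_numRem`
applies. -/
theorem remDeg_of_ne_zero [CharZero R] {mu : YoungDiagram} {b : ℕ × ℕ} (hb : IsAddable mu b)
    (h0 : nodeRes δ b ≠ 0) :
    remDeg δ mu b = (numAdd δ mu (-nodeRes δ b) : ℤ) - numRem δ mu (-nodeRes δ b)
      + if nodeRes δ b = -(1 / 2) then 1 else 0 := by
  have h1 : {c : ℕ × ℕ | IsAddable mu c ∧ nodeRes δ c = -nodeRes δ b ∧ c.1 ≠ b.1}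
      = {c : ℕ × ℕ | IsAddable mu c ∧ nodeRes δ c = -nodeRes δ b} := by
    refine Set.ext fun c => ⟨fun h => ⟨h.1, h.2.1⟩, fun h => ⟨h.1, h.2, fun h3 => ?_⟩⟩
    have := h.1.eq_of_fst hb h3
    rw [this] at h
    exact h0 (self_eq_neg.1 h.2)
  simp [remDeg, stepDeg, h1, numAdd, numRem]

/-- The integer `h_k(i)` in terms of the partition at level `k`, where `x = i_k`. -/
noncomputable def defect (lam : YoungDiagram) (x : R) : ℤ :=
  ((numAdd δ lam (-x) : ℤ) - numRem δ lam (-x)) - ((numAdd δ lam x : ℤ) - numRem δ lam x)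

/-- The degree `deg_k(i)` in terms of `i_k` and `h_k(i)`. -/
noncomputable def degOf (x : R) (h : ℤ) : ℤ :=
  if (x ≠ 0 ∧ x ≠ -(1 / 2) ∧ h = 0) ∨ (x = -(1 / 2) ∧ h = -1) then 1
  else if (x ≠ 0 ∧ x ≠ -(1 / 2) ∧ h = -2) ∨ (x = -(1 / 2) ∧ h = -3) then -1 else 0

theorem degK_eq_degOf {n : ℕ} (i : Seq δ n) (k : Fin n) :
    i.degK k = degOf (i k : R) (i.hval k) := by
  unfold Seq.degK degOf Seq.IsPlus Seq.IsMinus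
  congr

theorem degOf_zero [CharZero R] (h : ℤ) : degOf (0 : R) h = 0 := by
  simp [degOf]

/-- Each of the two counts is 0 or 1. At residue -1/2 the extra summand 1 does no harm, since no
addable node has residue 1/2 then. -/
theorem remDeg_bounds [CharZero R] {mu : YoungDiagram} {b : ℕ × ℕ} (hb : IsAddable mu b) :
    -1 ≤ remDeg δ mu b ∧ remDeg δ mu b ≤ 1 := by
  by_cases h0 : nodeRes δ b = 0
  · rw [remDeg_of_eq_zero δ hb h0]; omega
  · rw [remDeg_of_ne_zero δ hb h0]
    have h1 := numAdd_le_one δ mu (-nodeRes δ b)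
    have h2 := numRem_le_one δ mu (-nodeRes δ b)
    by_cases h3 : nodeRes δ b = -(1 / 2)
    · have h4 := numAdd_add_one_eq_zero δ hb
      rw [show nodeRes δ b + 1 = - nodeRes δ b by rw [h3]; norm_num] at h4
      rw [if_pos h3]; omega
    · rw [if_neg h3]; omega

theorem defect_of_addable [CharZero R] {mu : YoungDiagram} {b : ℕ × ℕ} (hb : IsAddable mu b)
    (h0 : nodeRes δ b ≠ 0) :
    defect δ mu (nodeRes δ b)
      = remDeg δ mu b - 1 - if nodeRes δ b = -(1 / 2) then 1 else 0 := by
  rw [defect, numAdd_eq_one δ hb, numRem_eq_zero δ hb, remDeg_of_ne_zero δ hb h0]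
  push_cast; ring

/-- By `defect_of_addable` the defect is `remDeg` minus 1, or minus 2 at residue -1/2. The values of
`h_k` that define P_{k,+} and P_{k,-} are exactly those for which `remDeg` is 1 and -1. -/
theorem degOf_add [CharZero R] {mu : YoungDiagram} {b : ℕ × ℕ} (hb : IsAddable mu b) :
    degOf (nodeRes δ b) (defect δ mu (nodeRes δ b)) = remDeg δ mu b := by
  by_cases h0 : nodeRes δ b = 0
  · rw [remDeg_of_eq_zero δ hb h0, h0, degOf_zero]
  · rw [defect_of_addable δ hb h0]
    obtain ⟨h1, h2⟩ := remDeg_bounds δ hb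
    generalize remDeg δ mu b = d at *
    generalize nodeRes δ b = x at *
    unfold degOf
    have h3 : d = -1 ∨ d = 0 ∨ d = 1 := by omega
    by_cases hx : x = -(1 / 2)
    · simp only [hx]
      rcases h3 with rfl | rfl | rfl <;> norm_num
    · simp only [hx, h0, not_false_eq_true, ne_eq, true_and, false_and, or_false, if_false]
      rcases h3 with rfl | rfl | rfl <;> norm_num

theorem defect_neg (lam : YoungDiagram) (x : R) : defect δ lam (-x) = -defect δ lam x := by
  unfold defect; rw [neg_neg]; ring

theorem defect_eq_sum (lam : YoungDiagram) (x : R) :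
    defect δ lam x = ind ((δ - 1) / 2) (-x) - ind ((δ - 1) / 2) x
      + ∑ b ∈ lam.cells, (nodeDefect (-x) (nodeRes δ b) - nodeDefect x (nodeRes δ b)) := by
  rw [defect, numAdd_sub_numRem, numAdd_sub_numRem, Finset.sum_sub_distrib]
  ring

theorem IsStep.isAddable {lam mu : YoungDiagram} {b : ℕ × ℕ} (h : IsStep lam mu (true, b)) :
    IsAddable lam b := ⟨h.1, mu, h.2⟩

theorem isStep_true_iff {lam mu : YoungDiagram} {b : ℕ × ℕ} :
    IsStep lam mu (true, b) ↔ b ∉ lam ∧ mu.cells = insert b lam.cells := by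
  simp [IsStep]

theorem isStep_false_iff {lam mu : YoungDiagram} {b : ℕ × ℕ} :
    IsStep lam mu (false, b) ↔ IsStep mu lam (true, b) := by
  rw [isStep_true_iff]
  simp only [IsStep, Bool.false_eq_true, if_false]
  constructor
  · rintro ⟨h1, h2⟩
    rw [← YoungDiagram.mem_cells, h2]
    refine ⟨by simp, ?_⟩
    rw [Finset.insert_erase h1]
  · rintro ⟨h1, h2⟩
    rw [← YoungDiagram.mem_cells, h2]
    refine ⟨by simp, ?_⟩
    rw [Finset.erase_insert h1]

theorem IsStep.unique {lam mu nu : YoungDiagram} {a : SignedNode} (h : IsStep lam mu a)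
    (h' : IsStep lam nu a) : mu = nu := by
  obtain ⟨s, b⟩ := a
  apply YoungDiagram.ext
  cases s
  · simp only [IsStep, Bool.false_eq_true, if_false] at h h'
    rw [h.2, h'.2]
  · rw [isStep_true_iff] at h h'
    rw [h.2, h'.2]

/-- If `a` is added to `mu`, the sums over the nodes change by the value at `a`. -/
theorem IsStep.sum_cells {lam mu : YoungDiagram} {b : ℕ × ℕ} (h : IsStep lam mu (true, b))
    (F : ℕ × ℕ → ℤ) : ∑ c ∈ mu.cells, F c = ∑ c ∈ lam.cells, F c + F b := by
  rw [isStep_true_iff] at h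
  rw [h.2, Finset.sum_insert h.1]; ring

/-- The defect is odd in the residue, and the node `b` changes it by an explicit amount. Passing
from `mu` to `lam` and from x to -x thus turns `remDeg` - 1 into -`remDeg` - 1, and the correction
at -1/2 moves to x = 1/2, that is, to i_k = -x = -1/2. So the degree changes sign. -/
theorem degOf_neg [CharZero R] {lam mu : YoungDiagram} {b : ℕ × ℕ}
    (h : IsStep mu lam (true, b)) :
    degOf (-nodeRes δ b) (defect δ lam (-nodeRes δ b)) = -remDeg δ mu b := by
  have hb := h.isAddable
  by_cases h0 : nodeRes δ b = 0
  · rw [remDeg_of_eq_zero δ hb h0, h0, neg_zero, degOf_zero, neg_zero]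
  · have h1 : defect δ lam (-nodeRes δ b)
        = -remDeg δ mu b - 1 - if nodeRes δ b = 1 / 2 then 1 else 0 := by
      rw [defect_eq_sum, h.sum_cells, ← add_assoc, ← defect_eq_sum, defect_neg,
        defect_of_addable δ hb h0]
      generalize nodeRes δ b = x at *
      unfold nodeDefect ind
      have e1 : x ≠ -x := fun h => h0 (self_eq_neg.1 h)
      have e2 : x + 1 ≠ x := by simp
      have e3 : x - 1 ≠ x := by simp
      have e4 : x + 1 = -x ↔ x = -(1 / 2) := by
        constructor
        · intro h; linear_combination h / 2
        · intro h; linear_combination 2 * h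
      have e5 : x - 1 = -x ↔ x = 1 / 2 := by
        constructor
        · intro h; linear_combination h / 2
        · intro h; linear_combination 2 * h
      simp only [neg_neg, e1, e2, e3, e4, e5, if_true, if_false]
      ring
    rw [h1]
    obtain ⟨h1, h2⟩ := remDeg_bounds δ hb
    generalize remDeg δ mu b = d at *
    generalize nodeRes δ b = x at *
    unfold degOf
    have h3 : d = -1 ∨ d = 0 ∨ d = 1 := by omega
    have e6 : -x = -(1 / 2) ↔ x = 1 / 2 := neg_inj
    have e7 : -x ≠ 0 := neg_ne_zero.2 h0
    by_cases hx : x = 1 / 2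
    · rw [if_pos hx]
      rcases h3 with rfl | rfl | rfl <;> simp [hx]
    · rw [if_neg hx]
      simp only [e6, hx, ne_eq, e7, not_false_eq_true, true_and, false_and, or_false]
      rcases h3 with rfl | rfl | rfl <;> norm_num

/-- The degree of a crossing of two strands with residues `u` and `v`. -/
noncomputable def crossDeg (u v : R) : ℤ :=
  if u = v + 1 ∨ u = v - 1 then 1 else if u = v then -2 else 0

theorem psiDeg_eq_crossDeg {n : ℕ} (i : Seq δ n) {k : ℕ} (h : k + 1 < n) :
    psiDeg i h = crossDeg (i (lo h) : R) (i (hi h) : R) := by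
  unfold psiDeg crossDeg
  simp only [Subtype.ext_iff]

theorem crossDeg_comm [CharZero R] (u v : R) : crossDeg u v = crossDeg v u := by
  unfold crossDeg
  have h1 : u = v + 1 ↔ v = u - 1 := by
    constructor <;> intro h <;> linear_combination -h
  have h2 : u = v - 1 ↔ v = u + 1 := by
    constructor <;> intro h <;> linear_combination -h
  simp only [h1, h2, or_comm (a := v = u - 1), eq_comm (a := u) (b := v)]

/-- Two nodes `a ≠ b` can be added to `nu`.  Moving the removal of `a` past the addition of
`b` changes the degree by the degree of the crossing. -/
theorem crossDeg_eq [CharZero R] {nu nu2 : YoungDiagram} {a b : ℕ × ℕ} (ha : IsAddable nu a)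
    (ha2 : IsAddable nu2 a) (hb : IsStep nu nu2 (true, b)) :
    crossDeg (-nodeRes δ a) (nodeRes δ b) = remDeg δ nu2 a - remDeg δ nu a := by
  have hne : b ≠ a := by
    rintro rfl
    apply ha2.1
    rw [isStep_true_iff] at hb
    rw [← YoungDiagram.mem_cells, hb.2]
    simp
  -- At residue 0 both removal degrees vanish, and the crossing has degree 0 because two distinct
  -- addable nodes never lie on equal or adjacent diagonals.
  by_cases h0 : nodeRes δ a = 0
  · rw [remDeg_of_eq_zero δ ha h0, remDeg_of_eq_zero δ ha2 h0]
    have h1 : ¬ (nodeRes δ b = nodeRes δ a ∨ nodeRes δ b = nodeRes δ a + 1 ∨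
      nodeRes δ a = nodeRes δ b + 1) := fun h => hne (eq_of_nodeRes δ hb.isAddable ha h)
    push Not at h1
    rw [h0] at h1
    rw [h0, neg_zero, crossDeg, if_neg, if_neg]
    · rfl
    · exact fun h => h1.1 h.symm
    · rintro (h | h)
      · exact h1.2.2 h
      · exact h1.2.1 (by linear_combination -h)
  -- Both removal degrees count nodes at the residue of `-a`. Adding `b` changes this count by
  -- `nodeDefect`, whose values 1, -2, 0 are those of the crossing degree.
  · rw [remDeg_of_ne_zero δ ha h0, remDeg_of_ne_zero δ ha2 h0, numAdd_sub_numRem,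
      numAdd_sub_numRem, hb.sum_cells]
    generalize nodeRes δ a = x
    generalize nodeRes δ b = y
    unfold crossDeg nodeDefect ind
    have e1 : -x = y + 1 ↔ y + 1 = -x := eq_comm
    have e2 : -x = y - 1 ↔ y - 1 = -x := eq_comm
    have e3 : -x = y ↔ y = -x := eq_comm
    rw [e1, e2, e3]
    by_cases h1 : y = -x
    · subst h1; simp
    · by_cases h2 : y + 1 = -x
      · have h3 : y - 1 ≠ -x := fun h => by
          have : (2 : R) = 0 := by linear_combination h2 - h
          norm_num at this
        simp [h1, h2, h3]
      · simp [h1, h2]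

end Degrees

/-! ## Walks in the branching graph -/

section Walks

variable {R : Type*} [Field R] {δ : R}

/-- `Walk δ lam w mu d`: the signed nodes `w` lead from `lam` to `mu` by steps of total
degree `d`. -/
inductive Walk (δ : R) : YoungDiagram → List SignedNode → YoungDiagram → ℤ → Prop
  | nil (lam : YoungDiagram) : Walk δ lam [] lam 0
  | cons {lam mu nu : YoungDiagram} {a : SignedNode} {w : List SignedNode} {d : ℤ}
      (h : IsStep lam mu a) (hw : Walk δ mu w nu d) :
      Walk δ lam (a :: w) nu (stepDeg δ lam mu a + d)

theorem walk_cons_iff {lam nu : YoungDiagram} {a : SignedNode} {w : List SignedNode} {d : ℤ} :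
    Walk δ lam (a :: w) nu d ↔ ∃ mu d', IsStep lam mu a ∧ Walk δ mu w nu d' ∧
      d = stepDeg δ lam mu a + d' := by
  constructor
  · rintro ⟨⟩
    exact ⟨_, _, ‹_›, ‹_›, rfl⟩
  · rintro ⟨mu, d', h, hw, rfl⟩
    exact Walk.cons h hw

theorem walk_append_iff {lam nu : YoungDiagram} {u v : List SignedNode} {d : ℤ} :
    Walk δ lam (u ++ v) nu d ↔ ∃ mu d₁ d₂, Walk δ lam u mu d₁ ∧ Walk δ mu v nu d₂ ∧
      d = d₁ + d₂ := by
  induction u generalizing lam d with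
  | nil =>
    constructor
    · intro h; exact ⟨lam, 0, d, Walk.nil _, h, by ring⟩
    · rintro ⟨mu, d₁, d₂, ⟨⟩, h, rfl⟩
      rwa [zero_add]
  | cons a u ih =>
    rw [List.cons_append, walk_cons_iff]
    constructor
    · rintro ⟨mu, d', h, hw, rfl⟩
      obtain ⟨ka, d₁, d₂, h₁, h₂, rfl⟩ := ih.1 hw
      exact ⟨ka, _, d₂, Walk.cons h h₁, h₂, by ring⟩
    · rintro ⟨ka, d₁, d₂, h₁, h₂, rfl⟩
      obtain ⟨mu, d', h, hw, rfl⟩ := walk_cons_iff.1 h₁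
      exact ⟨mu, d' + d₂, h, ih.2 ⟨ka, d', d₂, hw, h₂, rfl⟩, by ring⟩

theorem Walk.append {lam mu nu : YoungDiagram} {u v : List SignedNode} {d d' : ℤ}
    (h : Walk δ lam u mu d) (h' : Walk δ mu v nu d') : Walk δ lam (u ++ v) nu (d + d') :=
  walk_append_iff.2 ⟨_, _, _, h, h', rfl⟩

theorem Walk.singleton {lam mu : YoungDiagram} {a : SignedNode} (h : IsStep lam mu a) :
    Walk δ lam [a] mu (stepDeg δ lam mu a) := by
  have := Walk.cons h (Walk.nil (δ := δ) mu)
  rwa [add_zero] at this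

theorem Walk.unique {lam mu nu : YoungDiagram} {w : List SignedNode} {d d' : ℤ}
    (h : Walk δ lam w mu d) (h' : Walk δ lam w nu d') : mu = nu ∧ d = d' := by
  induction w generalizing lam d d' with
  | nil => cases h; cases h'; exact ⟨rfl, rfl⟩
  | cons a w ih =>
    obtain ⟨ka, e, h₁, h₂, rfl⟩ := walk_cons_iff.1 h
    obtain ⟨ka', e', h₁', h₂', rfl⟩ := walk_cons_iff.1 h'
    obtain rfl := h₁.unique h₁'
    obtain ⟨rfl, rfl⟩ := ih h₂ h₂'
    exact ⟨rfl, rfl⟩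

theorem Walk.deg_eq_zero [CharZero R] {lam mu : YoungDiagram} {w : List SignedNode} {d : ℤ}
    (h : Walk δ lam w mu d) (hpos : ∀ a ∈ w, a.1 = true) : d = 0 := by
  induction h with
  | nil => rfl
  | @cons lam mu nu a w d h hw ih =>
    obtain ⟨s, b⟩ := a
    obtain rfl : s = true := hpos _ List.mem_cons_self
    rw [ih fun a ha => hpos a (List.mem_cons_of_mem _ ha), stepDeg_pos δ h.isAddable, add_zero]

/-- A function that is odd in the residue sums along a walk to the sum over the nodes. -/
theorem Walk.sum_cells {lam mu : YoungDiagram} {w : List SignedNode} {d : ℤ}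
    (h : Walk δ lam w mu d) (F : R → ℤ) (hF : ∀ x, F (-x) = -F x) :
    ∑ b ∈ mu.cells, F (nodeRes δ b)
      = ∑ b ∈ lam.cells, F (nodeRes δ b) + (w.map fun a => F (signedRes δ a)).sum := by
  induction h with
  | nil => simp
  | @cons lam mu nu a w d h hw ih =>
    rw [ih, List.map_cons, List.sum_cons, ← add_assoc]
    congr 1
    obtain ⟨s, b⟩ := a
    cases s
    · rw [(isStep_false_iff.1 h).sum_cells]
      simp [signedRes, hF]
    · rw [h.sum_cells]
      simp [signedRes]

/-- Comparing sizes shows that a walk from the empty partition to shape (λ, f) contains exactly f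
removals. -/
theorem Walk.card {lam mu : YoungDiagram} {w : List SignedNode} {d : ℤ}
    (h : Walk δ lam w mu d) :
    mu.card + 2 * w.countP (fun a => !a.1) = lam.card + w.length := by
  induction h with
  | nil => simp
  | @cons lam mu nu a w d h hw ih =>
    obtain ⟨s, b⟩ := a
    cases s
    · rw [isStep_false_iff, isStep_true_iff] at h
      have h1 : lam.card = mu.card + 1 := by
        rw [YoungDiagram.card, h.2, Finset.card_insert_of_notMem h.1]
      simp; omega
    · rw [isStep_true_iff] at h
      have h1 : mu.card = lam.card + 1 := by
        rw [YoungDiagram.card, h.2, Finset.card_insert_of_notMem h.1]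
      simp; omega

theorem walk_ofFn {n : ℕ} (shape : Fin (n + 1) → YoungDiagram) (node : Fin n → SignedNode)
    (h : ∀ k : Fin n, IsStep (shape k.castSucc) (shape k.succ) (node k)) :
    Walk δ (shape 0) (List.ofFn node) (shape (Fin.last n))
      (∑ k : Fin n, stepDeg δ (shape k.castSucc) (shape k.succ) (node k)) := by
  induction n with
  | zero => simpa using Walk.nil _
  | succ n ih =>
    rw [List.ofFn_succ, Fin.sum_univ_succ]
    exact Walk.cons (h 0) (ih (fun k => shape k.succ) (fun k => node k.succ) fun k => h k.succ)

theorem UpDownTableau.walk {n : ℕ} {lam : YoungDiagram} {f : ℕ} (t : UpDownTableau n lam f) :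
    Walk δ ⊥ t.word lam (t.deg δ) := by
  have := walk_ofFn (δ := δ) t.shape t.node t.step
  rwa [t.start, t.finish_shape] at this

theorem UpDownTableau.length_word {n : ℕ} {lam : YoungDiagram} {f : ℕ}
    (t : UpDownTableau n lam f) : t.word.length = n := by simp [UpDownTableau.word]

/-! ## Residue sequences of walks -/

theorem sum_fin_lt {n k : ℕ} (hk : k < n) (f : ℕ → ℤ) :
    ∑ r : Fin n, (if r < (⟨k, hk⟩ : Fin n) then f r else 0) = ∑ r ∈ Finset.range k, f r := by
  have := Fin.sum_univ_eq_sum_range (fun r => if r < k then f r else 0) n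
  simp only [Fin.lt_def]
  rw [this, ← Finset.sum_filter]
  congr 1
  ext r
  simp only [Finset.mem_filter, Finset.mem_range]
  omega

theorem sum_range_getD (L : List SignedNode) (a : SignedNode) (f : SignedNode → ℤ) :
    ∑ r ∈ Finset.range L.length, f (L.getD r a) = (L.map f).sum := by
  induction L with
  | nil => simp
  | cons b L ih =>
    rw [List.length_cons, Finset.sum_range_succ', List.map_cons, List.sum_cons, ← ih]
    simp [add_comm]

theorem card_filter_lt {n : ℕ} (k : Fin n) (p : Fin n → Prop)
    [DecidablePred p] :
    ((Finset.univ.filter fun r => r < k ∧ p r).card : ℤ)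
      = ∑ r : Fin n, if r < k then (if p r then 1 else 0) else 0 := by
  rw [Finset.card_filter]
  push_cast
  refine Finset.sum_congr rfl fun r _ => ?_
  by_cases h : r < k <;> simp [h]

/-- The sets A_{k,1} and A_{k,4} assemble to `nodeDefect` at -i_k, and A_{k,2} and A_{k,3} to minus
`nodeDefect` at i_k. The count for ±1 splits into two indicators because 2 ≠ 0. -/
theorem hval_eq_sum [CharZero R] {n : ℕ} (i : Seq δ n) (k : Fin n) :
    i.hval k = ind ((δ - 1) / 2) (-(i k : R)) - ind ((δ - 1) / 2) (i k : R)
      + ∑ r : Fin n, if r < k then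
          nodeDefect (-(i k : R)) (i r : R) - nodeDefect (i k : R) (i r : R) else 0 := by
  unfold Seq.hval Seq.setA1 Seq.setA2 Seq.setA3 Seq.setA4
  rw [card_filter_lt, card_filter_lt, card_filter_lt, card_filter_lt]
  have h1 : ∀ r : Fin n, (if r < k then nodeDefect (-(i k : R)) (i r : R)
        - nodeDefect (i k : R) (i r : R) else 0)
      = (if r < k then (if (i r : R) = -(i k : R) + 1 ∨ (i r : R) = -(i k : R) - 1 then 1 else 0)
          else 0)
        + 2 * (if r < k then (if (i r : R) = (i k : R) then 1 else 0) else 0)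
        - (if r < k then (if (i r : R) = (i k : R) + 1 ∨ (i r : R) = (i k : R) - 1 then 1 else 0)
          else 0)
        - 2 * (if r < k then (if (i r : R) = -(i k : R) then 1 else 0) else 0) := by
    intro r
    by_cases hr : r < k
    · have key : ∀ x v : R, (if v = x + 1 ∨ v = x - 1 then (1 : ℤ) else 0)
          = ind (v + 1) x + ind (v - 1) x := by
        intro x v
        have e1 : v = x + 1 ↔ v - 1 = x := by
          constructor <;> intro h <;> linear_combination h
        have e2 : v = x - 1 ↔ v + 1 = x := by
          constructor <;> intro h <;> linear_combination h
        rw [ind, ind]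
        simp only [e1, e2]
        by_cases h1 : v - 1 = x
        · have h2 : v + 1 ≠ x := fun h => by
            have : (2 : R) = 0 := by linear_combination h - h1
            norm_num at this
          simp [h1, h2]
        · simp [h1]
      simp only [if_pos hr, key]
      simp only [nodeDefect, ind]
      ring
    · simp [hr]
  simp only [h1, Finset.sum_sub_distrib, Finset.sum_add_distrib, ← Finset.mul_sum]
  have e1 : (i k : R) = -((δ - 1) / 2) ↔ (δ - 1) / 2 = -(i k : R) := by
    constructor <;> intro h <;> linear_combination h
  have e2 : (i k : R) = (δ - 1) / 2 ↔ (δ - 1) / 2 = (i k : R) := eq_comm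
  simp only [ind, e1, e2]
  ring

/-- A second difference is symmetric. Consequently the summand of `h_k` is odd in i_r, so a removal
undoes the contribution of an addition. -/
theorem nodeDefect_neg (x v : R) : nodeDefect x (-v) = nodeDefect (-x) v := by
  unfold nodeDefect ind
  have e1 : -v + 1 = x ↔ v - 1 = -x := by
    constructor <;> intro h <;> linear_combination -h
  have e2 : -v - 1 = x ↔ v + 1 = -x := by
    constructor <;> intro h <;> linear_combination -h
  have e3 : -v = x ↔ v = -x := by
    constructor <;> intro h <;> linear_combination -h
  simp only [e1, e2, e3]
  ring

theorem resSeq_val {n : ℕ} (w : List SignedNode) (k : Fin n) :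
    (resSeq δ n w k : R) = signedRes δ (w.getD k alpha0) := rfl

/-- The integer `h_k` of the residue sequence of a walk is the defect of its partition. -/
theorem hval_resSeq [CharZero R] {n : ℕ} {L Q : List SignedNode} {lam : YoungDiagram} {d : ℤ}
    (h : Walk δ ⊥ L lam d) (k : Fin n) (hk : k.val = L.length) :
    (resSeq δ n (L ++ Q)).hval k = defect δ lam (resSeq δ n (L ++ Q) k : R) := by
  rw [hval_eq_sum, defect_eq_sum]
  congr 1
  set x : R := (resSeq δ n (L ++ Q) k : R)
  -- By oddness the sum over the earlier steps collapses to a sum over the nodes still present in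
  -- `lam`.
  have h1 := h.sum_cells (fun v => nodeDefect (-x) v - nodeDefect x v) (by
    intro v; rw [nodeDefect_neg, nodeDefect_neg, neg_neg]; ring)
  rw [h1, ← sum_range_getD L alpha0, ← hk]
  simp only [YoungDiagram.cells_bot, Finset.sum_empty, zero_add]
  rw [← sum_fin_lt k.isLt]
  refine Finset.sum_congr rfl fun r _ => ?_
  by_cases hr : r < k
  · have : (L ++ Q).getD r alpha0 = L.getD r alpha0 :=
      List.getD_append _ _ _ _ (by rw [← hk]; exact hr)
    simp only [if_pos hr, resSeq_val, this, Fin.eta]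
  · simp [hr]

theorem degK_resSeq [CharZero R] {n : ℕ} {L Q : List SignedNode} {lam : YoungDiagram} {d : ℤ}
    (h : Walk δ ⊥ L lam d) (a : SignedNode) (k : Fin n) (hk : k.val = L.length) :
    (resSeq δ n (L ++ a :: Q)).degK k = degOf (signedRes δ a) (defect δ lam (signedRes δ a)) := by
  have h1 : (resSeq δ n (L ++ a :: Q) k : R) = signedRes δ a := by
    rw [resSeq_val, hk]; simp
  rw [degK_eq_degOf, hval_resSeq h k hk, h1]

theorem degK_add [CharZero R] {n : ℕ} {L Q : List SignedNode} {lam : YoungDiagram} {d : ℤ}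
    (h : Walk δ ⊥ L lam d) {b : ℕ × ℕ} (hb : IsAddable lam b) (k : Fin n)
    (hk : k.val = L.length) :
    (resSeq δ n (L ++ (true, b) :: Q)).degK k = remDeg δ lam b := by
  rw [degK_resSeq h _ k hk]
  exact degOf_add δ hb

theorem degK_remove [CharZero R] {n : ℕ} {L Q : List SignedNode} {lam mu : YoungDiagram} {d : ℤ}
    (h : Walk δ ⊥ L lam d) {b : ℕ × ℕ} (hb : IsStep mu lam (true, b)) (k : Fin n)
    (hk : k.val = L.length) :
    (resSeq δ n (L ++ (false, b) :: Q)).degK k = -remDeg δ mu b := by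
  rw [degK_resSeq h _ k hk]
  exact degOf_neg δ hb

end Walks

/-! ## Homogeneous words -/

section Algebra

variable {R : Type*} [Field R] {δ : R} {n : ℕ}

/-- The projection of the free algebra to `G δ n`. -/
noncomputable def toG (δ : R) (n : ℕ) : FreeAlgebra R (Gen δ n) →ₐ[R] G δ n :=
  (RingQuot.mkAlgHom R (UnitRel δ n)).comp (toPreG δ n)

theorem toG_rel {a b : FreeAlgebra R (Gen δ n)} (h : Rel a b) : toG δ n a = toG δ n b := by
  simp only [toG, AlgHom.comp_apply, toPreG_rel h]

theorem toG_ι (g : Gen δ n) : toG δ n (FreeAlgebra.ι R g) = gen g := rfl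

/-- The image of `e(i)` in `G δ n`. -/
noncomputable abbrev eG (i : Seq δ n) : G δ n := gen (Gen.e i)

/-- The image of `ψ_k` in `G δ n`. -/
noncomputable abbrev psiG {k : ℕ} (h : k + 1 < n) : G δ n := gen (Gen.psi k h)

/-- The image of `ε_k` in `G δ n`. -/
noncomputable abbrev epsG {k : ℕ} (h : k + 1 < n) : G δ n := gen (Gen.eps k h)

theorem eG_mul_eG (i j : Seq δ n) : eG i * eG j = if i = j then eG i else 0 := by
  have := toG_rel (Rel.idem i j)
  rw [map_mul] at this
  refine this.trans ?_
  split <;> simp [fE, toG_ι]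

theorem eG_mul_self (i : Seq δ n) : eG i * eG i = eG i := by simp [eG_mul_eG]

theorem eG_mul_of_ne {i j : Seq δ n} (h : i ≠ j) : eG i * eG j = 0 := by simp [eG_mul_eG, h]

theorem eG_mul_epsG {i : Seq δ n} {k : ℕ} (h : k + 1 < n) (hi : ¬ i.ZeroSum h) :
    eG i * epsG h = 0 := by
  simpa [fE, fEps, toG_ι] using toG_rel (Rel.e_eps i k h hi)

theorem epsG_mul_eG {i : Seq δ n} {k : ℕ} (h : k + 1 < n) (hi : ¬ i.ZeroSum h) :
    epsG h * eG i = 0 := by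
  simpa [fE, fEps, toG_ι] using toG_rel (Rel.eps_e i k h hi)

theorem eG_mul_epsG_mul_eG {i j : Seq δ n} {k : ℕ} (h : k + 1 < n) (hij : ¬ i.AgreeOff j h) :
    eG i * epsG h * eG j = 0 := by
  simpa [fE, fEps, toG_ι] using toG_rel (Rel.e_eps_e i j k h hij)

theorem psiG_mul_eG (i : Seq δ n) {k : ℕ} (h : k + 1 < n) :
    psiG h * eG i = eG (i.swap h) * psiG h := by
  simpa [fE, fPsi, toG_ι] using toG_rel (Rel.psi_e i k h)

theorem exists_sum_eG : ∃ S : Finset (Seq δ n), ∑ i ∈ S, eG i = (1 : G δ n) := by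
  refine ⟨(finite_support (δ := δ) (n := n)).toFinset, ?_⟩
  have h := RingQuot.mkAlgHom_rel R (UnitRel.sum_e (δ := δ) (n := n))
  rw [finsum_eq_sum _ finite_support, map_sum, map_one] at h
  exact h

/-- An idempotent may be inserted if all the others give zero. -/
theorem mul_eq_mul_eG_mul (x z : G δ n) (j : Seq δ n) (h : ∀ j', j' ≠ j → x * eG j' * z = 0) :
    x * z = x * eG j * z := by
  obtain ⟨S, hS⟩ := exists_sum_eG (δ := δ) (n := n)
  have h1 : x * z = ∑ i ∈ S, x * eG i * z := by
    rw [← Finset.sum_mul, ← Finset.mul_sum, hS, mul_one]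
  rw [h1]
  refine Finset.sum_eq_single j (fun i _ hi => h i hi) fun hj => ?_
  -- If `j` does not occur in the finite decomposition of 1, orthogonality to all its summands kills
  -- `eG j`, so the claim still holds.
  have h2 : eG j = 0 := by
    rw [← one_mul (eG j), ← hS, Finset.sum_mul]
    exact Finset.sum_eq_zero fun i hi => eG_mul_of_ne fun hij => hj (hij ▸ hi)
  rw [h2, mul_zero, zero_mul]

theorem mul_eq_zero_of_forall (x z : G δ n) (h : ∀ j, x * eG j * z = 0) : x * z = 0 := by
  obtain ⟨S, hS⟩ := exists_sum_eG (δ := δ) (n := n)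
  rw [← mul_one x, ← hS, Finset.mul_sum, Finset.sum_mul]
  exact Finset.sum_eq_zero fun j _ => h j

theorem mul_mem_homogeneous {c d : ℤ} {x z : G δ n} (hx : x ∈ homogeneous δ n c)
    (hz : z ∈ homogeneous δ n d) : x * z ∈ homogeneous δ n (c + d) := by
  unfold homogeneous at *
  have h := Submodule.mul_mem_mul hx hz
  rw [Submodule.span_mul_span] at h
  refine Submodule.span_mono ?_ h
  rintro _ ⟨a, ha, b, hb, rfl⟩
  exact HomMonomial.mul c d a b ha hb

theorem mem_homogeneous {d : ℤ} {x : G δ n} (h : HomMonomial d x) : x ∈ homogeneous δ n d :=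
  Submodule.subset_span h

theorem evalWord_append (v w : List (Gen δ n)) : evalWord (v ++ w) = evalWord v * evalWord w := by
  simp [evalWord]

theorem evalWord_singleton (g : Gen δ n) : evalWord [g] = gen g := by simp [evalWord]

theorem evalWord_nil : evalWord ([] : List (Gen δ n)) = 1 := by simp [evalWord]

/-- The word `w`, taken between `e(i)` and `e(j)`, and the reversed word, taken between `e(j)`
and `e(i)`, are homogeneous of degree `d`. -/
structure HomWord (i j : Seq δ n) (d : ℤ) (w : List (Gen δ n)) : Prop where
  mem : eG i * evalWord w * eG j ∈ homogeneous δ n d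
  rev_mem : eG j * evalWord w.reverse * eG i ∈ homogeneous δ n d

theorem HomWord.nil (i : Seq δ n) : HomWord i i 0 [] := by
  have : eG i ∈ homogeneous δ n 0 := mem_homogeneous (HomMonomial.idem i)
  constructor <;> simpa [evalWord_nil, eG_mul_self] using this

/-- The two vanishing conditions force the idempotent at the junction, once for the word and once
for its image under the anti-involution. -/
theorem HomWord.append {i j l : Seq δ n} {c d : ℤ} {v w : List (Gen δ n)} (hv : HomWord i j c v)
    (hw : HomWord j l d w)
    (h : ∀ j', j' ≠ j → eG i * evalWord v * eG j' * (evalWord w * eG l) = 0)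
    (h' : ∀ j', j' ≠ j → eG l * evalWord w.reverse * eG j' * (evalWord v.reverse * eG i) = 0) :
    HomWord i l (c + d) (v ++ w) := by
  constructor
  · have e : eG i * evalWord (v ++ w) * eG l
        = (eG i * evalWord v * eG j) * (eG j * evalWord w * eG l) := by
      calc _ = (eG i * evalWord v) * (evalWord w * eG l) := by
            rw [evalWord_append]; simp only [mul_assoc]
        _ = eG i * evalWord v * eG j * (evalWord w * eG l) := mul_eq_mul_eG_mul _ _ j h
        _ = eG i * evalWord v * (eG j * eG j) * (evalWord w * eG l) := by rw [eG_mul_self]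
        _ = _ := by simp only [mul_assoc]
    rw [e]
    exact mul_mem_homogeneous hv.mem hw.mem
  · have e : eG l * evalWord (v ++ w).reverse * eG i
        = (eG l * evalWord w.reverse * eG j) * (eG j * evalWord v.reverse * eG i) := by
      calc _ = (eG l * evalWord w.reverse) * (evalWord v.reverse * eG i) := by
            rw [List.reverse_append, evalWord_append]; simp only [mul_assoc]
        _ = eG l * evalWord w.reverse * eG j * (evalWord v.reverse * eG i) :=
            mul_eq_mul_eG_mul _ _ j h'
        _ = eG l * evalWord w.reverse * (eG j * eG j) * (evalWord v.reverse * eG i) := by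
            rw [eG_mul_self]
        _ = _ := by simp only [mul_assoc]
    rw [e, add_comm c d]
    exact mul_mem_homogeneous hw.rev_mem hv.rev_mem

theorem HomWord.psi [CharZero R] (i : Seq δ n) {k : ℕ} (h : k + 1 < n) :
    HomWord i (i.swap h) (psiDeg i h) [Gen.psi k h] := by
  have e : psiDeg (i.swap h) h = psiDeg i h := by
    rw [psiDeg_eq_crossDeg, psiDeg_eq_crossDeg, crossDeg_comm]
    simp [Seq.swap]
  constructor
  · rw [evalWord_singleton, mul_assoc, psiG_mul_eG, swap_swap, ← mul_assoc, eG_mul_self]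
    exact mem_homogeneous (HomMonomial.cross i k h)
  · rw [List.reverse_singleton, evalWord_singleton, mul_assoc, psiG_mul_eG, ← mul_assoc,
      eG_mul_self, ← e]
    exact mem_homogeneous (HomMonomial.cross _ k h)

theorem swap_injective {k : ℕ} (h : k + 1 < n) {i j : Seq δ n} (hij : i.swap h = j.swap h) :
    i = j := by rw [← swap_swap i h, hij, swap_swap]

/-- A homogeneous word for which the first idempotent is determined by the last one. -/
structure RigidWord (i l : Seq δ n) (d : ℤ) (w : List (Gen δ n)) : Prop
    extends HomWord i l d w where
  zero : ∀ i', i' ≠ i → eG i' * (evalWord w * eG l) = 0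
  rev_zero : ∀ i', i' ≠ i → eG l * evalWord w.reverse * eG i' = 0

theorem RigidWord.nil (i : Seq δ n) : RigidWord i i 0 [] := by
  refine ⟨HomWord.nil i, fun i' h => ?_, fun i' h => ?_⟩
  · rw [evalWord_nil, one_mul, eG_mul_of_ne h]
  · rw [List.reverse_nil, evalWord_nil, mul_one, eG_mul_of_ne h.symm]

theorem HomWord.append_rigid {i j l : Seq δ n} {c d : ℤ} {v w : List (Gen δ n)}
    (hv : HomWord i j c v) (hw : RigidWord j l d w) : HomWord i l (c + d) (v ++ w) := by
  refine hv.append hw.toHomWord (fun j' hj' => ?_) fun j' hj' => ?_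
  · rw [mul_assoc, hw.zero j' hj', mul_zero]
  · rw [hw.rev_zero j' hj', zero_mul]

/-- Orthogonality of the idempotents: a leading idempotent makes any homogeneous word rigid. This
restores rigidity after a chain of cup-caps. -/
theorem HomWord.cons_e {i l : Seq δ n} {d : ℤ} {w : List (Gen δ n)} (hw : HomWord i l d w) :
    RigidWord i l d (Gen.e i :: w) := by
  have e : evalWord (Gen.e i :: w) = eG i * evalWord w := by
    rw [← List.singleton_append, evalWord_append, evalWord_singleton]
  have e' : evalWord (Gen.e i :: w).reverse = evalWord w.reverse * eG i := by
    rw [List.reverse_cons, evalWord_append, evalWord_singleton]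
  refine ⟨⟨?_, ?_⟩, fun i' hi' => ?_, fun i' hi' => ?_⟩
  · rw [e, ← mul_assoc, eG_mul_self]; exact hw.mem
  · rw [e', mul_assoc, mul_assoc, eG_mul_self, ← mul_assoc]; exact hw.rev_mem
  · rw [e, ← mul_assoc, ← mul_assoc, eG_mul_of_ne hi', zero_mul, zero_mul]
  · rw [e', mul_assoc, mul_assoc, eG_mul_of_ne hi'.symm, mul_zero, mul_zero]

theorem RigidWord.single_e (i : Seq δ n) : RigidWord i i 0 [Gen.e i] := (HomWord.nil i).cons_e

theorem RigidWord.append {i j l : Seq δ n} {c d : ℤ} {v w : List (Gen δ n)}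
    (hv : RigidWord i j c v) (hw : RigidWord j l d w) : RigidWord i l (c + d) (v ++ w) := by
  refine ⟨hv.toHomWord.append_rigid hw, fun i' hi' => ?_, fun i' hi' => ?_⟩
  · have e : evalWord (v ++ w) * eG l = evalWord v * eG j * (evalWord w * eG l) := by
      rw [evalWord_append, mul_assoc]
      exact mul_eq_mul_eG_mul _ _ _ fun j' hj' => by rw [mul_assoc, hw.zero j' hj', mul_zero]
    rw [e, ← mul_assoc, hv.zero i' hi', zero_mul]
  · have e : eG l * evalWord (v ++ w).reverse
        = eG l * evalWord w.reverse * eG j * evalWord v.reverse := by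
      rw [List.reverse_append, evalWord_append, ← mul_assoc]
      exact mul_eq_mul_eG_mul _ _ _ fun j' hj' => by rw [hw.rev_zero j' hj', zero_mul]
    rw [e, mul_assoc, mul_assoc, ← mul_assoc (eG j), hv.rev_zero i' hi', mul_zero]

/-- A crossing carries e(i) to e(i · s_k), and this map on sequences is injective, so rigidity
survives. -/
theorem RigidWord.psi_cons [CharZero R] {i l : Seq δ n} {k : ℕ} (h : k + 1 < n) {d : ℤ}
    {w : List (Gen δ n)} (hw : RigidWord (i.swap h) l d w) :
    RigidWord i l (psiDeg i h + d) (Gen.psi k h :: w) := by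
  refine ⟨(HomWord.psi i h).append_rigid hw, fun i' hi' => ?_, fun i' hi' => ?_⟩
  · have e : eG i' * psiG h = psiG h * eG (i'.swap h) := by rw [psiG_mul_eG, swap_swap]
    rw [← List.singleton_append, evalWord_append, evalWord_singleton, mul_assoc, ← mul_assoc, e,
      mul_assoc, hw.zero _ fun h1 => hi' (swap_injective h h1), mul_zero]
  · rw [List.reverse_cons, evalWord_append, evalWord_singleton, mul_assoc, mul_assoc, psiG_mul_eG,
      ← mul_assoc, ← mul_assoc, hw.rev_zero _ fun h1 => hi' (swap_injective h h1), zero_mul]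

/-- No rigidity is claimed: the relations do not make the sequence on one side of a single cup-cap
determine the one on the other side. -/
theorem HomWord.eps (i j : Seq δ n) {k : ℕ} (h : k + 1 < n) :
    HomWord i j (i.degK (lo h) + j.degK (lo h)) [Gen.eps k h] := by
  constructor
  · rw [evalWord_singleton]
    exact mem_homogeneous (HomMonomial.cupcap i j k h)
  · rw [List.reverse_singleton, evalWord_singleton, add_comm]
    exact mem_homogeneous (HomMonomial.cupcap j i k h)

theorem eG_mul_epsG_mul_epsG {i j : Seq δ n} {k : ℕ} (h : k + 1 < n) (h' : k + 1 + 1 < n)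
    (hij : ¬ (i.AgreeOff j h ∧ j.ZeroSum h ∧ j.ZeroSum h')) :
    eG i * epsG h * eG j * epsG h' = 0 := by
  by_cases h1 : i.AgreeOff j h
  · by_cases h2 : j.ZeroSum h
    · rw [mul_assoc _ (eG j), eG_mul_epsG h' fun h3 => hij ⟨h1, h2, h3⟩, mul_zero]
    · rw [mul_assoc (eG i), epsG_mul_eG h h2, mul_zero, zero_mul]
  · rw [eG_mul_epsG_mul_eG h h1, zero_mul]

theorem epsG_mul_epsG_mul_eG {i j : Seq δ n} {k : ℕ} (h : k + 1 < n) (h' : k + 1 + 1 < n)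
    (hij : ¬ (i.AgreeOff j h ∧ j.ZeroSum h ∧ j.ZeroSum h')) :
    epsG h' * eG j * (epsG h * eG i) = 0 := by
  by_cases h1 : i.AgreeOff j h
  · by_cases h2 : j.ZeroSum h
    · rw [epsG_mul_eG h' fun h3 => hij ⟨h1, h2, h3⟩, zero_mul]
    · rw [mul_assoc, ← mul_assoc (eG j), eG_mul_epsG h h2, zero_mul, mul_zero]
  · rw [mul_assoc, ← mul_assoc (eG j), eG_mul_epsG_mul_eG h, mul_zero]
    exact fun h2 => h1 fun r h3 h4 => (h2 r h3 h4).symm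

/-- The sequence between `ε_k` and `ε_{k+1}` is determined by the one before `ε_k`. -/
theorem eq_of_agreeOff {i j j' : Seq δ n} {k : ℕ} (h : k + 1 < n) (h' : k + 1 + 1 < n)
    (hj : i.AgreeOff j h ∧ j.ZeroSum h ∧ j.ZeroSum h')
    (hj' : i.AgreeOff j' h ∧ j'.ZeroSum h ∧ j'.ZeroSum h') : j' = j := by
  obtain ⟨h1, h2, h3⟩ := hj
  obtain ⟨h1', h2', h3'⟩ := hj'
  have e0 : hi h' ≠ lo h := by simp [hi, lo]; omega
  have e1 : hi h' ≠ hi h := by simp [hi]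
  have e2 : lo h' = hi h := rfl
  -- The entry at position k + 2 is untouched by the first cup-cap. Balance at k + 1 then fixes the
  -- entry at k + 1, and balance at k the one at k.
  have a1 : j' (hi h') = j (hi h') := (h1' _ e0 e1).symm.trans (h1 _ e0 e1)
  unfold Seq.ZeroSum at *
  rw [e2] at h3 h3'
  have a2 : j' (hi h) = j (hi h) := Subtype.ext (by
    rw [a1] at h3'; linear_combination h3' - h3)
  have a3 : j' (lo h) = j (lo h) := Subtype.ext (by
    rw [a2] at h2'; linear_combination h2' - h2)
  funext r
  by_cases r1 : r = lo h
  · rw [r1, a3]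
  · by_cases r2 : r = hi h
    · rw [r2, a2]
    · exact (h1' r r1 r2).symm.trans (h1 r r1 r2)

/-- The following letter ε_{k+1} is part of the statement because it is what pins down the sequence
after ε_k. -/
theorem HomWord.eps_cons {i j l : Seq δ n} {k : ℕ} (h : k + 1 < n) (h' : k + 1 + 1 < n) {d : ℤ}
    {w : List (Gen δ n)} (hj : i.AgreeOff j h ∧ j.ZeroSum h ∧ j.ZeroSum h')
    (hw : HomWord j l d (Gen.eps (k + 1) h' :: w)) :
    HomWord i l (i.degK (lo h) + j.degK (lo h) + d) (Gen.eps k h :: Gen.eps (k + 1) h' :: w) := by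
  refine (HomWord.eps i j h).append hw (fun j' hj' => ?_) fun j' hj' => ?_
  · rw [evalWord_singleton, ← List.singleton_append, evalWord_append, evalWord_singleton,
      mul_assoc (epsG h'), ← mul_assoc, eG_mul_epsG_mul_epsG h h', zero_mul]
    exact fun h1 => hj' (eq_of_agreeOff h h' hj h1)
  · rw [List.reverse_singleton, evalWord_singleton, List.reverse_cons, evalWord_append,
      evalWord_singleton, ← mul_assoc (eG l), mul_assoc _ (epsG h'), mul_assoc _ (epsG h' * eG j'),
      epsG_mul_epsG_mul_eG h h', mul_zero]
    exact fun h1 => hj' (eq_of_agreeOff h h' hj h1)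

end Algebra

/-! ## Chains of cup-caps and crossings -/

section Chains

variable {R : Type*} [Field R] {δ : R} {n : ℕ}

theorem resSeq_lo {L Q : List SignedNode} (a b : SignedNode) {k : ℕ} (h : k + 1 < n)
    (hk : k = L.length) : (resSeq δ n (L ++ a :: b :: Q) (lo h) : R) = signedRes δ a := by
  subst hk; simp [resSeq_val, lo]

theorem resSeq_hi {L Q : List SignedNode} (a b : SignedNode) {k : ℕ} (h : k + 1 < n)
    (hk : k = L.length) : (resSeq δ n (L ++ a :: b :: Q) (hi h) : R) = signedRes δ b := by
  subst hk
  rw [resSeq_val]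
  simp [hi]

theorem getD_append_cons_cons {L Q : List SignedNode} (a b a' b' : SignedNode) {r : ℕ}
    (h : r ≠ L.length) (h' : r ≠ L.length + 1) :
    (L ++ a :: b :: Q).getD r alpha0 = (L ++ a' :: b' :: Q).getD r alpha0 := by
  rcases lt_or_ge r L.length with hr | hr
  · rw [List.getD_append _ _ _ _ hr, List.getD_append _ _ _ _ hr]
  · rw [List.getD_append_right _ _ _ _ hr, List.getD_append_right _ _ _ _ hr]
    obtain ⟨m, hm⟩ : ∃ m, r - L.length = m + 2 := ⟨r - L.length - 2, by omega⟩
    rw [hm]; simp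

theorem resSeq_agreeOff {L Q : List SignedNode} (a b a' b' : SignedNode) {k : ℕ} (h : k + 1 < n)
    (hk : k = L.length) :
    (resSeq δ n (L ++ a :: b :: Q)).AgreeOff (resSeq δ n (L ++ a' :: b' :: Q)) h := by
  subst hk
  intro r h1 h2
  apply Subtype.ext
  rw [resSeq_val, resSeq_val, getD_append_cons_cons a b a' b' (fun h3 => h1 (Fin.ext h3))
    fun h3 => h2 (Fin.ext h3)]

theorem resSeq_swap {L Q : List SignedNode} (a b : SignedNode) {k : ℕ} (h : k + 1 < n)
    (hk : k = L.length) :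
    (resSeq δ n (L ++ a :: b :: Q)).swap h = resSeq δ n (L ++ b :: a :: Q) := by
  funext r
  apply Subtype.ext
  unfold Seq.swap
  by_cases h1 : r = lo h
  · rw [h1, Equiv.swap_apply_left, resSeq_hi a b h hk, resSeq_lo b a h hk]
  · by_cases h2 : r = hi h
    · rw [h2, Equiv.swap_apply_right, resSeq_hi b a h hk, resSeq_lo a b h hk]
    · rw [Equiv.swap_apply_of_ne_of_ne h1 h2, resSeq_agreeOff a b b a h hk r h1 h2]

theorem resSeq_zeroSum {L Q : List SignedNode} {a b : SignedNode} {k : ℕ} (h : k + 1 < n)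
    (hk : k = L.length) (hab : signedRes δ a + signedRes δ b = 0) :
    (resSeq δ n (L ++ a :: b :: Q)).ZeroSum h := by
  rw [Seq.ZeroSum, resSeq_lo a b h hk, resSeq_hi a b h hk, hab]

theorem signedRes_true (b : ℕ × ℕ) : signedRes δ (true, b) = nodeRes δ b := rfl

theorem signedRes_false (b : ℕ × ℕ) : signedRes δ (false, b) = -nodeRes δ b := rfl

/-- Each cup-cap replaces the pair (-a, a) by (c, -c), where c is the next node of `ps`, and the
pair (-c, c) is then ready for the next cup-cap. The degree contributed by c on the right of one
cup-cap is cancelled by that of -c on the left of the next, so only the ends of the chain remain. -/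
theorem homWord_epsRun [CharZero R] (ps : List SignedNode) :
    ∀ (L Q : List SignedNode) (a b : ℕ × ℕ) (lam lam' mu mu' : YoungDiagram) (d d' : ℤ),
      Walk δ ⊥ L lam d → IsStep lam lam' (false, a) → Walk δ lam ps mu d' →
      (∀ c ∈ ps, c.1 = true) → IsStep mu mu' (true, b) → L.length + ps.length + 1 < n →
      HomWord (resSeq δ n (L ++ (false, a) :: (true, a) :: (ps ++ Q)))
        (resSeq δ n (L ++ ps ++ (true, b) :: (false, b) :: Q))
        (remDeg δ mu b - remDeg δ lam' a)
        ((List.range' L.length (ps.length + 1)).flatMap (epsLetter δ n)) := by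
  induction ps with
  | nil =>
    intro L Q a b lam lam' mu mu' d d' hL ha hps _ hb hn
    obtain ⟨⟩ := hps
    have h : L.length + 1 < n := by simpa using hn
    have := HomWord.eps (resSeq δ n (L ++ (false, a) :: (true, a) :: Q))
      (resSeq δ n (L ++ (true, b) :: (false, b) :: Q)) h
    rw [degK_remove hL (isStep_false_iff.1 ha) _ rfl, degK_add hL hb.isAddable _ rfl] at this
    simpa [epsLetter, h, neg_add_eq_sub] using this
  | cons c ps ih =>
    intro L Q a b lam lam' mu mu' d d' hL ha hps hpos hb hn
    obtain ⟨ka, e, hc, hps₁, rfl⟩ := walk_cons_iff.1 hps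
    obtain ⟨s, c⟩ := c
    obtain rfl : s = true := hpos _ List.mem_cons_self
    rw [List.length_cons] at hn
    have h : L.length + 1 < n := by omega
    have h' : L.length + 1 + 1 < n := by omega
    have hw := ih (L ++ [(true, c)]) Q c b ka lam mu mu' _ e (hL.append (Walk.singleton hc))
      (isStep_false_iff.2 hc) hps₁ (fun x hx => hpos x (List.mem_cons_of_mem _ hx)) hb
      (by rw [List.length_append, List.length_singleton]; omega)
    simp only [List.append_assoc, List.cons_append, List.nil_append, List.length_append,
      List.length_singleton] at hw
    rw [List.range'_succ, List.flatMap_cons] at hw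
    rw [List.length_cons, List.range'_succ, List.range'_succ, List.flatMap_cons, List.flatMap_cons]
    simp only [epsLetter, h, h', dif_pos, List.cons_append, List.nil_append,
      List.append_assoc] at hw ⊢
    have hd := degK_remove (n := n) (Q := (true, a) :: (true, c) :: (ps ++ Q)) hL
      (isStep_false_iff.1 ha) (lo h) rfl
    have hd' := degK_add (n := n) (Q := (false, c) :: (true, c) :: (ps ++ Q)) hL
      hc.isAddable (lo h) rfl
    -- The intermediate sequence is the one with (c, -c) in place of (-a, a). The three open goals
    -- are the conditions that single it out.
    have key := HomWord.eps_cons (i := resSeq δ n (L ++ (false, a) :: (true, a) ::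
      ((true, c) :: (ps ++ Q)))) h h' ⟨?_, ?_, ?_⟩ hw
    · rw [hd, hd'] at key
      convert key using 1
      ring
    · exact resSeq_agreeOff _ _ _ _ h rfl
    · exact resSeq_zeroSum h rfl (by rw [signedRes_true, signedRes_false]; ring)
    · have := resSeq_zeroSum (δ := δ) (n := n) (L := L ++ [(true, c)]) (a := (false, c))
        (b := (true, c)) (Q := ps ++ Q) h' (by simp)
        (by rw [signedRes_true, signedRes_false]; ring)
      simpa using this

theorem Walk.subset {lam mu : YoungDiagram} {w : List SignedNode} {d : ℤ}
    (h : Walk δ lam w mu d) (hpos : ∀ a ∈ w, a.1 = true) : lam.cells ⊆ mu.cells := by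
  induction h with
  | nil => exact subset_rfl
  | @cons lam mu nu a w d h hw ih =>
    obtain ⟨s, b⟩ := a
    obtain rfl : s = true := hpos _ List.mem_cons_self
    rw [isStep_true_iff] at h
    refine subset_trans ?_ (ih fun a ha => hpos a (List.mem_cons_of_mem _ ha))
    rw [h.2]
    exact Finset.subset_insert _ _

/-- If the node `b` can still be removed after the addition of `c`, the additions of `b` and `c`
can be exchanged. -/
theorem exists_isStep_exchange {nu nu' nu'' lam mu : YoungDiagram} {b c : ℕ × ℕ}
    (hb : IsStep nu nu' (true, b)) (hc : IsStep nu' nu'' (true, c))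
    (hsub : nu''.cells ⊆ lam.cells) (hrem : IsStep lam mu (false, b)) :
    ∃ nu2, IsStep nu nu2 (true, c) ∧ IsStep nu2 nu'' (true, b) := by
  have hrem' : IsRemovable lam b := by
    simp only [IsStep, Bool.false_eq_true, if_false] at hrem
    exact ⟨hrem.1, mu, hrem.2⟩
  rw [isStep_true_iff] at hb hc
  have hcb : c ≠ b := by
    rintro rfl
    apply hc.1
    rw [← YoungDiagram.mem_cells, hb.2]
    simp
  refine ⟨⟨nu''.cells.erase b, ?_⟩, ?_, ?_⟩
  · intro x y hyx hx
    rw [Finset.mem_coe, Finset.mem_erase] at hx ⊢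
    refine ⟨?_, nu''.isLowerSet hyx hx.2⟩
    rintro rfl
    -- Erasing `b` could only fail to leave a diagram if some other node of `nu''`, hence of `lam`,
    -- were weakly below and to the right of `b`. Removability of `b` from `lam` excludes this.
    exact hx.1 (hrem'.eq_of_le (hsub hx.2) hyx).symm
  · rw [isStep_true_iff]
    refine ⟨fun h => hc.1 ?_, ?_⟩
    · rw [← YoungDiagram.mem_cells, hb.2]
      exact Finset.mem_insert_of_mem h
    · change nu''.cells.erase b = _
      rw [hc.2, hb.2, Finset.insert_comm, Finset.erase_insert]
      rw [Finset.mem_insert]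
      rintro (h | h)
      · exact hcb h.symm
      · exact hb.1 h
  · rw [isStep_true_iff]
    refine ⟨fun h => (Finset.mem_erase.1 h).1 rfl, ?_⟩
    change _ = insert b (nu''.cells.erase b)
    rw [Finset.insert_erase]
    rw [hc.2, hb.2]
    simp

/-- The removal of `b` moves to the right past the additions `q`. By `crossDeg_eq` each crossing
contributes the increment of `remDeg` of `b`, so the sum telescopes. The second conclusion says that
`q` can be added without `b` being present, which is the walk needed for the reduced tableau. -/
theorem rigidWord_psiRun [CharZero R] (q : List SignedNode) :
    ∀ (L Q : List SignedNode) (b : ℕ × ℕ) (nu nu' lam mu : YoungDiagram) (d : ℤ),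
      IsStep nu nu' (true, b) → Walk δ nu' q lam d → (∀ c ∈ q, c.1 = true) →
      IsStep lam mu (false, b) → L.length + q.length < n →
      RigidWord (resSeq δ n (L ++ (false, b) :: (q ++ Q)))
          (resSeq δ n (L ++ q ++ (false, b) :: Q)) (remDeg δ mu b - remDeg δ nu b)
          ((List.range' L.length q.length).flatMap (psiLetter δ n)) ∧
        ∃ d', Walk δ nu q mu d' := by
  induction q with
  | nil =>
    intro L Q b nu nu' lam mu d hb hq _ hrem _
    obtain ⟨⟩ := hq
    obtain rfl := hrem.unique (isStep_false_iff.2 hb)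
    refine ⟨?_, 0, Walk.nil _⟩
    simpa using RigidWord.nil (resSeq δ n (L ++ (false, b) :: Q))
  | cons c q ih =>
    intro L Q b nu nu' lam mu d hb hq hpos hrem hn
    obtain ⟨nu'', e, hc, hq₁, rfl⟩ := walk_cons_iff.1 hq
    obtain ⟨s, c⟩ := c
    obtain rfl : s = true := hpos _ List.mem_cons_self
    have hpos' : ∀ x ∈ q, x.1 = true := fun x hx => hpos x (List.mem_cons_of_mem _ hx)
    obtain ⟨nu2, hc2, hb2⟩ := exists_isStep_exchange hb hc (hq₁.subset hpos') hrem
    rw [List.length_cons] at hn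
    have h : L.length + 1 < n := by omega
    obtain ⟨hw, d', hd'⟩ := ih (L ++ [(true, c)]) Q b nu2 nu'' lam mu e hb2 hq₁ hpos' hrem
      (by rw [List.length_append, List.length_singleton]; omega)
    refine ⟨?_, _, Walk.cons hc2 hd'⟩
    simp only [List.append_assoc, List.cons_append, List.nil_append, List.length_append,
      List.length_singleton] at hw
    rw [← resSeq_swap (L := L) (false, b) (true, c) h rfl] at hw
    have key := RigidWord.psi_cons h hw
    rw [psiDeg_eq_crossDeg, resSeq_lo _ _ h rfl, resSeq_hi _ _ h rfl, signedRes_true,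
      signedRes_false, crossDeg_eq δ hb.isAddable hb2.isAddable hc2] at key
    rw [List.length_cons, List.range'_succ, List.flatMap_cons, psiLetter, dif_pos h]
    simp only [List.append_assoc, List.cons_append, List.nil_append] at key ⊢
    convert key using 1
    ring

end Chains

/-! ## Combinatorics of the reduction -/

section Reduction

/-- The word that consists of `h` pairs `(α₀, -α₀)`. -/
def pairs : ℕ → List SignedNode
  | 0 => []
  | h + 1 => alpha0 :: negNode alpha0 :: pairs h

theorem length_pairs (h : ℕ) : (pairs h).length = 2 * h := by
  induction h with
  | zero => rfl
  | succ h ih => simp only [pairs, List.length_cons, ih]; ring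

theorem pairs_append_pair (h : ℕ) (w : List SignedNode) :
    pairs h ++ alpha0 :: negNode alpha0 :: w = alpha0 :: negNode alpha0 :: (pairs h ++ w) := by
  induction h with
  | zero => rfl
  | succ h ih => simp only [pairs, List.cons_append, ih]

theorem head_pairs_append (h : ℕ) (w : List SignedNode) : head (pairs h ++ w) = h + head w := by
  induction h with
  | zero => simp [pairs]
  | succ h ih => simp [pairs, head, ih]; ring

theorem exists_eq_pairs_append (w : List SignedNode) :
    ∃ tl, w = pairs (head w) ++ tl ∧ head tl = 0 := by
  induction w using head.induct with
  | case1 a b l h ih =>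
    obtain ⟨tl, h1, h2⟩ := ih
    refine ⟨tl, ?_, h2⟩
    rw [head, if_pos h, pairs, List.cons_append, List.cons_append, ← h1, h.1, h.2]
  | case2 a b l h =>
    have h0 : head (a :: b :: l) = 0 := by rw [head, if_neg h]
    exact ⟨a :: b :: l, by rw [h0]; rfl, h0⟩
  | case3 l h =>
    have h0 : head l = 0 := by
      unfold head
      split
      · exact absurd rfl (h _ _ _)
      · rfl
    exact ⟨l, by rw [h0]; rfl, h0⟩

theorem countP_pairs (h : ℕ) : (pairs h).countP (fun a => !a.1) = h := by
  induction h with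
  | zero => rfl
  | succ h ih => simp [pairs, ih, alpha0, negNode]

theorem find?_range_eq {N m : ℕ} {p : ℕ → Bool} (hm : m < N) (h : p m = true)
    (h' : ∀ j < m, p j = false) : (List.range N).find? p = some m := by
  rw [List.find?_range_eq_some]
  refine ⟨h, List.mem_range.2 hm, fun j hj => by simp [h' j hj]⟩

theorem find?_range_reverse_eq {N m : ℕ} {p : ℕ → Bool} (hm : m < N) (h : p m = true)
    (h' : ∀ j, m < j → j < N → p j = false) : (List.range N).reverse.find? p = some m := by
  induction N with
  | zero => omega
  | succ N ih =>
    rw [List.range_succ, List.reverse_append, List.reverse_singleton, List.singleton_append]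
    rcases Nat.lt_succ_iff_lt_or_eq.1 hm with hlt | rfl
    · rw [List.find?_cons_of_neg (by simp [h' N hlt (Nat.lt_succ_self N)])]
      exact ih hlt fun j h1 h2 => h' j h1 (by omega)
    · rw [List.find?_cons_of_pos h]

variable {h : ℕ} {p q rest : List SignedNode} {b : ℕ × ℕ}

theorem posB_eq (hh : head (pairs h ++ (p ++ (true, b) :: (q ++ (false, b) :: rest))) = h)
    (hp : ∀ c ∈ p, c.1 = true) (hq : ∀ c ∈ q, c.1 = true) :
    posB (pairs h ++ (p ++ (true, b) :: (q ++ (false, b) :: rest)))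
      = 2 * h + p.length + 1 + q.length := by
  have hpq : ∀ c ∈ p ++ (true, b) :: q, c.1 = true := by
    intro c hc
    simp only [List.mem_append, List.mem_cons] at hc
    rcases hc with hc | rfl | hc
    · exact hp c hc
    · rfl
    · exact hq c hc
  have hw : pairs h ++ (p ++ (true, b) :: (q ++ (false, b) :: rest))
      = (pairs h ++ (p ++ (true, b) :: q)) ++ (false, b) :: rest := by simp
  have hl : (pairs h ++ (p ++ (true, b) :: q)).length = 2 * h + p.length + 1 + q.length := by
    simp [length_pairs]; omega
  unfold posB
  rw [find?_range_eq (m := 2 * h + p.length + 1 + q.length), Option.getD_some]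
  · simp [length_pairs]; omega
  · rw [hh, hw, List.getD_append_right _ _ _ _ (by omega), hl]
    simp; omega
  · intro j hj
    rw [hh]
    by_cases h1 : 2 * h ≤ j
    · rw [hw, List.getD_append _ _ _ _ (by omega),
        List.getD_append_right _ _ _ _ (by rw [length_pairs]; exact h1), length_pairs,
        List.getD_eq_getElem _ _ (by simp; omega)]
      simp only [hpq _ (List.getElem_mem _)]
      simp
    · simp [h1]

/-- Since `q` does not contain `b`, the displayed occurrence of `b` is the last one before its
removal. -/
theorem posA_eq (hh : head (pairs h ++ (p ++ (true, b) :: (q ++ (false, b) :: rest))) = h)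
    (hp : ∀ c ∈ p, c.1 = true) (hq : ∀ c ∈ q, c.1 = true) (hbq : (true, b) ∉ q) :
    posA (pairs h ++ (p ++ (true, b) :: (q ++ (false, b) :: rest))) = 2 * h + p.length := by
  have hw : pairs h ++ (p ++ (true, b) :: (q ++ (false, b) :: rest))
      = (pairs h ++ (p ++ (true, b) :: q)) ++ (false, b) :: rest := by simp
  have hw' : pairs h ++ (p ++ (true, b) :: (q ++ (false, b) :: rest))
      = (pairs h ++ p) ++ (true, b) :: (q ++ (false, b) :: rest) := by simp
  have hl : (pairs h ++ (p ++ (true, b) :: q)).length = 2 * h + p.length + 1 + q.length := by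
    simp [length_pairs]; omega
  have hl' : (pairs h ++ p).length = 2 * h + p.length := by simp [length_pairs]
  unfold posA
  rw [posB_eq hh hp hq]
  have hB : (pairs h ++ (p ++ (true, b) :: (q ++ (false, b) :: rest))).getD
      (2 * h + p.length + 1 + q.length) alpha0 = (false, b) := by
    rw [hw, List.getD_append_right _ _ _ _ (by omega), hl]; simp
  rw [hB, find?_range_reverse_eq (m := 2 * h + p.length), Option.getD_some]
  · omega
  · rw [hw', List.getD_append_right _ _ _ _ (by omega), hl']
    simp [negNode]
  · intro j h1 h2
    rw [hw', List.getD_append_right _ _ _ _ (by omega), hl']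
    obtain ⟨m, hm⟩ : ∃ m, j - (2 * h + p.length) = m + 1 := ⟨j - (2 * h + p.length) - 1, by omega⟩
    rw [hm, List.getD_cons_succ, List.getD_append _ _ _ _ (by omega),
      List.getD_eq_getElem _ _ (by omega)]
    rw [decide_eq_false_iff_not]
    intro h3
    apply hbq
    have : q[m]'(by omega) ∈ q := List.getElem_mem _
    rw [h3] at this
    exact this

theorem reduceStep_eq (hh : head (pairs h ++ (p ++ (true, b) :: (q ++ (false, b) :: rest))) = h)
    (hp : ∀ c ∈ p, c.1 = true) (hq : ∀ c ∈ q, c.1 = true) (hbq : (true, b) ∉ q) :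
    reduceStep (pairs h ++ (p ++ (true, b) :: (q ++ (false, b) :: rest)))
      = pairs h ++ alpha0 :: negNode alpha0 :: (p ++ (q ++ rest)) := by
  rw [reduceStep, posA_eq hh hp hq hbq, posB_eq hh hp hq, pairs_append_pair]
  have hw : pairs h ++ (p ++ (true, b) :: (q ++ (false, b) :: rest))
      = (pairs h ++ (p ++ (true, b) :: q)) ++ (false, b) :: rest := by simp
  have hl : (pairs h ++ (p ++ (true, b) :: q)).length = 2 * h + p.length + 1 + q.length := by
    simp [length_pairs]; omega
  have hl' : (pairs h ++ p).length = 2 * h + p.length := by simp [length_pairs]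
  have hw' : (pairs h ++ (p ++ (true, b) :: q)) ++ rest
      = (pairs h ++ p) ++ (true, b) :: (q ++ rest) := by simp
  rw [hw, List.eraseIdx_append_of_length_le (by omega), hl, Nat.sub_self, List.eraseIdx_cons_zero,
    hw', List.eraseIdx_append_of_length_le (by omega), hl', Nat.sub_self, List.eraseIdx_cons_zero]
  simp

/-- If all removals of `w` belong to its head, the reduction does not change `w`. -/
theorem posB_eq_zero {w : List SignedNode} (hw : ∀ c ∈ w, c.1 = true) :
    posB (pairs (h + 1) ++ w) = 0 := by
  unfold posB
  have : (List.range (pairs (h + 1) ++ w).length).find? (fun b =>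
      decide (2 * head (pairs (h + 1) ++ w) ≤ b ∧
        ((pairs (h + 1) ++ w).getD b alpha0).1 = false)) = none := by
    rw [List.find?_eq_none]
    intro j hj
    rw [List.mem_range] at hj
    rw [decide_eq_true_iff, head_pairs_append]
    rintro ⟨h1, h2⟩
    rw [List.getD_append_right _ _ _ _ (by rw [length_pairs]; omega),
      List.getD_eq_getElem _ _ (by rw [List.length_append] at hj; rw [length_pairs] at *; omega),
      hw _ (List.getElem_mem _)] at h2
    exact Bool.noConfusion h2
  rw [this]; rfl

theorem posA_eq_zero {w : List SignedNode} (hw : ∀ c ∈ w, c.1 = true) :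
    posA (pairs (h + 1) ++ w) = 0 := by
  unfold posA
  rw [posB_eq_zero hw]
  rfl

/-- Both searches fail and give the default position 0. Erasing position 0 twice deletes the first
pair (α₀, -α₀), which is then put back. -/
theorem reduceStep_eq_self {w : List SignedNode} (hw : ∀ c ∈ w, c.1 = true) :
    reduceStep (pairs (h + 1) ++ w) = pairs (h + 1) ++ w := by
  rw [reduceStep, posB_eq_zero hw, posA_eq_zero hw]
  rfl

/-! ### Walks: initial pairs and the first removable pair -/

variable {R : Type*} [Field R] {δ : R}

theorem Walk.mem_iff {lam mu : YoungDiagram} {w : List SignedNode} {d : ℤ}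
    (h : Walk δ lam w mu d) (hpos : ∀ a ∈ w, a.1 = true) (c : ℕ × ℕ) :
    c ∈ mu ↔ c ∈ lam ∨ (true, c) ∈ w := by
  induction h with
  | nil => simp
  | @cons lam mu nu a w d h hw ih =>
    obtain ⟨s, b⟩ := a
    obtain rfl : s = true := hpos _ List.mem_cons_self
    rw [isStep_true_iff] at h
    rw [ih fun a ha => hpos a (List.mem_cons_of_mem _ ha), ← YoungDiagram.mem_cells, h.2,
      Finset.mem_insert, YoungDiagram.mem_cells, List.mem_cons, Prod.mk_right_inj, or_assoc, or_left_comm]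

theorem Walk.notMem {lam mu : YoungDiagram} {w : List SignedNode} {d : ℤ}
    (h : Walk δ lam w mu d) (hpos : ∀ a ∈ w, a.1 = true) {c : ℕ × ℕ} (hc : (true, c) ∈ w) :
    c ∉ lam := by
  obtain ⟨u, v, rfl⟩ := List.append_of_mem hc
  obtain ⟨ka, d₁, d₂, h1, h2, rfl⟩ := walk_append_iff.1 h
  obtain ⟨ka', d₃, h3, h4, rfl⟩ := walk_cons_iff.1 h2
  rw [isStep_true_iff] at h3
  exact fun h5 => h3.1 (h1.subset (fun a ha => hpos a (List.mem_append_left _ ha)) h5)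

theorem isStep_bot {mu : YoungDiagram} {b : ℕ × ℕ} (h : IsStep ⊥ mu (true, b)) : b = (0, 0) := by
  by_contra hne
  exact YoungDiagram.notMem_bot _
    (h.isAddable.mem_of_lt (c := (0, 0)) (by rw [Prod.le_def]; simp) (Ne.symm hne))

theorem exists_isStep_bot : ∃ mu, IsStep ⊥ mu alpha0 := by
  refine ⟨⟨{(0, 0)}, ?_⟩, ?_⟩
  · intro x y hyx hx
    simp only [Finset.coe_singleton, Set.mem_singleton_iff] at hx ⊢
    subst hx
    rw [Prod.le_def] at hyx
    exact Prod.ext (Nat.le_zero.1 hyx.1) (Nat.le_zero.1 hyx.2)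
  · exact isStep_true_iff.2 ⟨YoungDiagram.notMem_bot _, rfl⟩

/-- The degree of a pair `(α₀, -α₀)` at the beginning of a walk. -/
theorem walk_pair [CharZero R] : Walk δ ⊥ [alpha0, negNode alpha0] ⊥ (remDeg δ ⊥ (0, 0)) := by
  obtain ⟨mu, h⟩ := exists_isStep_bot
  have h' : IsStep mu ⊥ (negNode alpha0) := isStep_false_iff.2 h
  have := Walk.cons (δ := δ) h (Walk.singleton h')
  have e : stepDeg δ ⊥ mu alpha0 + stepDeg δ mu ⊥ (negNode alpha0) = remDeg δ ⊥ (0, 0) := by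
    rw [show stepDeg δ ⊥ mu alpha0 = 0 from stepDeg_pos δ h.isAddable, zero_add]
    exact stepDeg_neg δ _ _ _
  rwa [e] at this

theorem walk_pairs [CharZero R] (h : ℕ) : Walk δ ⊥ (pairs h) ⊥ (h * remDeg δ ⊥ (0, 0)) := by
  induction h with
  | zero => simpa [pairs] using Walk.nil _
  | succ h ih =>
    have := walk_pair.append ih
    rwa [show remDeg δ ⊥ (0, 0) + h * remDeg δ ⊥ (0, 0) = (h + 1 : ℕ) * remDeg δ ⊥ (0, 0) by
      push_cast; ring] at this

theorem walk_pairs_append [CharZero R] {h : ℕ} {w : List SignedNode} {lam : YoungDiagram} {d : ℤ}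
    (hw : Walk δ ⊥ (pairs h ++ w) lam d) :
    ∃ d', Walk δ ⊥ w lam d' ∧ d = h * remDeg δ ⊥ (0, 0) + d' := by
  obtain ⟨mu, d₁, d₂, h1, h2, rfl⟩ := walk_append_iff.1 hw
  obtain ⟨rfl, rfl⟩ := h1.unique (walk_pairs h)
  exact ⟨d₂, h2, rfl⟩

theorem exists_first_neg (w : List SignedNode) : (∀ c ∈ w, c.1 = true) ∨
    ∃ P b rest, w = P ++ (false, b) :: rest ∧ ∀ c ∈ P, c.1 = true := by
  induction w with
  | nil => left; simp
  | cons a w ih =>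
    obtain ⟨s, c⟩ := a
    cases s
    · exact Or.inr ⟨[], c, w, rfl, by simp⟩
    · rcases ih with ih | ⟨P, b, rest, rfl, hP⟩
      · left; simpa using ih
      · refine Or.inr ⟨(true, c) :: P, b, rest, rfl, ?_⟩
        simpa using hP

/-- The first removable pair of a walk that does not begin with `(α₀, -α₀)`. -/
theorem exists_first_pair {w : List SignedNode} {lam : YoungDiagram} {d : ℤ}
    (hw : Walk δ ⊥ w lam d) (hh : head w = 0) : (∀ c ∈ w, c.1 = true) ∨
    ∃ p q rest b, w = (alpha0 :: p) ++ (true, b) :: (q ++ (false, b) :: rest) ∧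
      (∀ c ∈ p, c.1 = true) ∧ (∀ c ∈ q, c.1 = true) ∧ (true, b) ∉ q := by
  rcases exists_first_neg w with h | ⟨P, b, rest, rfl, hP⟩
  · exact Or.inl h
  right
  obtain ⟨mu, d₁, d₂, h1, h2, rfl⟩ := walk_append_iff.1 hw
  obtain ⟨mu', d₃, h3, h4, rfl⟩ := walk_cons_iff.1 h2
  have hrem : IsRemovable mu b := by
    simp only [IsStep, Bool.false_eq_true, if_false] at h3
    exact ⟨h3.1, mu', h3.2⟩
  have hbP : (true, b) ∈ P := by
    have := (h1.mem_iff hP b).1 hrem.1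
    exact this.resolve_left (YoungDiagram.notMem_bot _)
  obtain ⟨p, q, rfl⟩ := List.append_of_mem hbP
  have hp : ∀ c ∈ p, c.1 = true := fun c hc => hP c (List.mem_append_left _ hc)
  have hq : ∀ c ∈ q, c.1 = true := fun c hc =>
    hP c (List.mem_append_right _ (List.mem_cons_of_mem _ hc))
  obtain ⟨nu, d₄, d₅, h5, h6, -⟩ := walk_append_iff.1 h1
  obtain ⟨nu', d₆, h7, h8, -⟩ := walk_cons_iff.1 h6
  have hbnu : b ∈ nu' := by
    rw [isStep_true_iff] at h7
    rw [← YoungDiagram.mem_cells, h7.2]; simp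
  -- The node `b` is already present when the additions `q` start, so none of them can add it again.
  have hbq : (true, b) ∉ q := fun h => h8.notMem hq h hbnu
  cases p with
  | nil =>
    -- If `b` were the very first node it would be (0, 0), which is removable only from the one-box
    -- diagram. Then `q` is empty and the word begins with (α₀, -α₀), contrary to `hh`.
    exfalso
    obtain ⟨⟩ := h5
    obtain rfl := isStep_bot h7
    cases q with
    | nil => simp [head, alpha0, negNode] at hh
    | cons c q =>
      obtain ⟨s, c⟩ := c
      obtain rfl : s = true := hq _ List.mem_cons_self
      have hc : c ∈ mu := (h8.mem_iff hq c).2 (Or.inr List.mem_cons_self)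
      have := hrem.eq_of_le hc (by rw [Prod.le_def]; simp)
      rw [this] at hbq
      exact hbq List.mem_cons_self
  | cons a p =>
    obtain ⟨s, a⟩ := a
    obtain rfl : s = true := hp _ List.mem_cons_self
    obtain ⟨ka, d₇, h9, -, -⟩ := walk_cons_iff.1 h5
    obtain rfl := isStep_bot h9
    exact ⟨p, q, rest, b, by simp [alpha0], fun c hc => hp c (List.mem_cons_of_mem _ hc), hq, hbq⟩

end Reduction

/-! ### Homogeneity of the reduction sequence -/

section EpsSeq

variable {R : Type*} [Field R] {δ : R} {n : ℕ}

theorem head_lt_head_append (h : ℕ) (w : List SignedNode) :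
    h < head (pairs h ++ alpha0 :: negNode alpha0 :: w) := by
  rw [pairs_append_pair, show alpha0 :: negNode alpha0 :: (pairs h ++ w) = pairs (h + 1) ++ w
    from rfl, head_pairs_append]
  omega

/-- One step of the reduction sequence. -/
theorem rigidWord_epsStep_of_pair [CharZero R] {w p q rest : List SignedNode} {b : ℕ × ℕ} {h : ℕ}
    {lam : YoungDiagram} {d : ℤ}
    (hweq : w = pairs h ++ ((alpha0 :: p) ++ (true, b) :: (q ++ (false, b) :: rest)))
    (hw : Walk δ ⊥ w lam d) (hlen : w.length = n) (hh : head w = h)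
    (hp : ∀ c ∈ p, c.1 = true) (hq : ∀ c ∈ q, c.1 = true) (hbq : (true, b) ∉ q) :
    ∃ d', Walk δ ⊥ (reduceStep w) lam d' ∧ (reduceStep w).length = n ∧
      h < head (reduceStep w) ∧
      RigidWord (resSeq δ n (reduceStep w)) (resSeq δ n w) (d - d') (epsStep δ n w) := by
  have hp' : ∀ c ∈ alpha0 :: p, c.1 = true := by
    intro c hc
    rcases List.mem_cons.1 hc with rfl | hc
    · rfl
    · exact hp c hc
  have hA : posA w = 2 * h + (p.length + 1) := by
    rw [hweq, posA_eq (hweq ▸ hh) hp' hq hbq, List.length_cons]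
  have hB : posB w = 2 * h + (p.length + 1) + 1 + q.length := by
    rw [hweq, posB_eq (hweq ▸ hh) hp' hq, List.length_cons]
  have hr : reduceStep w = pairs h ++ alpha0 :: negNode alpha0 :: ((alpha0 :: p) ++ (q ++ rest)) := by
    rw [hweq, reduceStep_eq (hweq ▸ hh) hp' hq hbq]
  have hlen' := hlen
  rw [hweq] at hw hlen'
  simp only [List.length_append, List.length_cons, length_pairs] at hlen'
  obtain ⟨e, hw₁, rfl⟩ := walk_pairs_append hw
  obtain ⟨nu, dp, e₁, h1, hw₂, rfl⟩ := walk_append_iff.1 hw₁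
  obtain ⟨nu', e₂, h2, hw₃, rfl⟩ := walk_cons_iff.1 hw₂
  obtain ⟨ka, dq, e₃, h3, hw₄, rfl⟩ := walk_append_iff.1 hw₃
  obtain ⟨mu, dr, h4, h5, rfl⟩ := walk_cons_iff.1 hw₄
  obtain ⟨box, e₄, h6, h7, -⟩ := walk_cons_iff.1 h1
  -- The crossings act behind the added node `b`, which is the last letter of the fixed prefix. They
  -- bring its removal from directly after it to its place in `w`.
  have hpsi := rigidWord_psiRun (n := n) q (pairs h ++ (alpha0 :: p) ++ [(true, b)]) rest b nu nu'
    ka mu dq h2 h3 hq h4 (by simp [length_pairs]; omega)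
  obtain ⟨hpsi, dq', h8⟩ := hpsi
  -- The chain starts at the removal in the new pair (α₀, -α₀), followed by the α₀ that opens the
  -- remaining tableau. This is why the first removable pair is required to come after a leading α₀.
  have heps := homWord_epsRun (n := n) p (pairs h ++ [alpha0]) (q ++ rest) (0, 0) b box ⊥ nu nu' _ e₄
    ((walk_pairs h).append (Walk.singleton h6)) (isStep_false_iff.2 h6) h7 hp h2
    (by simp [length_pairs]; omega)
  have hD := h1.deg_eq_zero hp'
  have hq0 := h3.deg_eq_zero hq
  have hq0' := h8.deg_eq_zero hq
  subst hD hq0 hq0'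
  -- The degree of the reduction: h + 1 pairs (α₀, -α₀), additions of degree 0, and the unchanged
  -- rest. Compared with `w`, the removal of `b` is traded for one more removal of α₀.
  refine ⟨h * remDeg δ ⊥ (0, 0) + (remDeg δ ⊥ (0, 0) + (0 + (0 + dr))), ?_, ?_, ?_, ?_⟩
  · rw [hr]
    exact (walk_pairs h).append (walk_pair.append (h1.append (h8.append h5)))
  · rw [hr]
    simp only [List.length_append, List.length_cons, length_pairs]
    omega
  · rw [hr]
    exact head_lt_head_append h _
  · have e1 : List.Ico (2 * head w + 1) (posA w + 1)
        = List.range' (pairs h ++ [alpha0]).length (p.length + 1) := by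
      rw [List.Ico, hh, hA, List.length_append, length_pairs, List.length_singleton]
      congr 1; omega
    have e2 : List.Ico (posA w + 1) (posB w)
        = List.range' (pairs h ++ (alpha0 :: p) ++ [(true, b)]).length q.length := by
      rw [List.Ico, hA, hB]
      simp only [List.length_append, List.length_cons, length_pairs, List.length_nil]
      congr 1; omega
    have e3 : pairs h ++ [alpha0] ++ (false, (0, 0)) :: (true, (0, 0)) :: (p ++ (q ++ rest))
        = reduceStep w := by rw [hr]; simp [alpha0, negNode]
    have e4 : pairs h ++ [alpha0] ++ p ++ (true, b) :: (false, b) :: (q ++ rest)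
        = pairs h ++ (alpha0 :: p) ++ [(true, b)] ++ (false, b) :: (q ++ rest) := by simp
    have e5 : pairs h ++ (alpha0 :: p) ++ [(true, b)] ++ q ++ (false, b) :: rest = w := by
      rw [hweq]; simp
    rw [e3, e4] at heps
    rw [e5] at hpsi
    have key := ((heps.append_rigid hpsi).append_rigid (RigidWord.single_e _)).cons_e
    unfold epsStep
    rw [e1, e2]
    simp only [List.append_assoc, List.cons_append, List.nil_append] at key ⊢
    convert key using 1
    rw [stepDeg_pos δ h2.isAddable, stepDeg_neg]
    ring

/-- For a tableau that is already reduced both index ranges are empty, so the step is just the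
idempotent taken twice. -/
theorem rigidWord_epsStep_of_pos {w : List SignedNode} {h : ℕ} (hw : ∀ c ∈ w, c.1 = true) :
    RigidWord (resSeq δ n (pairs (h + 1) ++ w)) (resSeq δ n (pairs (h + 1) ++ w)) 0
      (epsStep δ n (pairs (h + 1) ++ w)) := by
  have e1 : List.Ico (2 * head (pairs (h + 1) ++ w) + 1) (posA (pairs (h + 1) ++ w) + 1) = [] :=
    List.Ico.eq_nil_of_le (by rw [head_pairs_append, posA_eq_zero hw]; omega)
  have e2 : List.Ico (posA (pairs (h + 1) ++ w) + 1) (posB (pairs (h + 1) ++ w)) = [] :=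
    List.Ico.eq_nil_of_le (by rw [posB_eq_zero hw]; omega)
  unfold epsStep
  rw [e1, e2, reduceStep_eq_self hw]
  exact (RigidWord.single_e _).append (RigidWord.single_e _)

theorem Walk.countP_eq {lam : YoungDiagram} {w : List SignedNode} {d : ℤ} {f : ℕ}
    (hw : Walk δ ⊥ w lam d) (hlen : w.length = n) (hf : lam.card + 2 * f = n) :
    w.countP (fun a => !a.1) = f := by
  have := hw.card
  have h0 : (⊥ : YoungDiagram).card = 0 := rfl
  omega

/-- Either a removal lies outside the head, and the head grows, or the head already contains all f
removals and the step is idle. The idle step needs a pair at the front, hence 0 < f. -/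
theorem rigidWord_epsStep [CharZero R] {w : List SignedNode} {lam : YoungDiagram} {d : ℤ} {f : ℕ}
    (hw : Walk δ ⊥ w lam d) (hlen : w.length = n) (hf : lam.card + 2 * f = n) (hf0 : 0 < f) :
    ∃ d', Walk δ ⊥ (reduceStep w) lam d' ∧ (reduceStep w).length = n ∧
      (f ≤ head (reduceStep w) ∨ head w < head (reduceStep w)) ∧
      RigidWord (resSeq δ n (reduceStep w)) (resSeq δ n w) (d - d') (epsStep δ n w) := by
  obtain ⟨tl, h1, h2⟩ := exists_eq_pairs_append w
  have hw' := hw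
  rw [h1] at hw'
  obtain ⟨e, h3, -⟩ := walk_pairs_append hw'
  rcases exists_first_pair h3 h2 with h4 | ⟨p, q, rest, b, rfl, hp, hq, hbq⟩
  · have hc := hw.countP_eq hlen hf
    have h5 : tl.countP (fun a => !a.1) = 0 := by
      rw [List.countP_eq_zero]; intro a ha; simp [h4 a ha]
    rw [h1, List.countP_append, countP_pairs, h5, add_zero] at hc
    obtain ⟨m, rfl⟩ : ∃ m, f = m + 1 := ⟨f - 1, by omega⟩
    rw [hc] at h1
    have hred : reduceStep w = w := by rw [h1, reduceStep_eq_self h4]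
    refine ⟨d, by rwa [hred], by rwa [hred], Or.inl (by rw [hred, hc]), ?_⟩
    rw [hred, sub_self, h1]
    exact rigidWord_epsStep_of_pos h4
  · obtain ⟨d', a1, a2, a3, a4⟩ := rigidWord_epsStep_of_pair h1 hw hlen rfl hp hq hbq
    exact ⟨d', a1, a2, Or.inr a3, a4⟩

/-- The degrees telescope over the steps. A single step may lengthen the head by more than one; the
remaining steps are then idle, so an inequality for the head suffices. -/
theorem rigidWord_epsSeq [CharZero R] {lam : YoungDiagram} {f : ℕ} (hf : lam.card + 2 * f = n) :
    ∀ (m : ℕ) (w : List SignedNode) (d : ℤ), Walk δ ⊥ w lam d → w.length = n →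
      f ≤ head w + m → (m = 0 ∨ 0 < f) →
      ∃ d', Walk δ ⊥ (reduceStep^[m] w) lam d' ∧ (reduceStep^[m] w).length = n ∧
        f ≤ head (reduceStep^[m] w) ∧
        RigidWord (resSeq δ n (reduceStep^[m] w)) (resSeq δ n w) (d - d') (epsSeq δ n m w)
  | 0, w, d, hw, hlen, hm, _ =>
    ⟨d, hw, hlen, hm, by rw [sub_self]; exact RigidWord.single_e _⟩
  | 1, w, d, hw, hlen, hm, h0 => by
    obtain ⟨d', h1, h2, h3, h4⟩ := rigidWord_epsStep hw hlen hf (by omega)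
    exact ⟨d', h1, h2, by rw [Function.iterate_one]; omega, h4⟩
  | m + 2, w, d, hw, hlen, hm, h0 => by
    obtain ⟨d', h1, h2, h3, h4⟩ := rigidWord_epsStep hw hlen hf (by omega)
    obtain ⟨d'', h5, h6, h7, h8⟩ := rigidWord_epsSeq hf (m + 1) (reduceStep w) d' h1 h2 (by omega)
      (by omega)
    refine ⟨d'', h5, h6, h7, ?_⟩
    have := h8.append h4
    rwa [sub_add_sub_comm, add_comm d' d, add_sub_add_right_eq_sub] at this

/-- The final idempotent allows the outer idempotents of `psiST` to be inserted without changing the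
element. -/
theorem epsSeq_eq_append (m : ℕ) (w : List SignedNode) :
    ∃ u, epsSeq δ n m w = u ++ [Gen.e (resSeq δ n w)] := by
  match m with
  | 0 => exact ⟨[], rfl⟩
  | 1 => exact ⟨_, rfl⟩
  | m + 2 => exact ⟨_, (List.append_assoc _ _ _).symm⟩

/-- The last term of a reduction sequence. -/
theorem eq_pairs_append_of_le_head {lam : YoungDiagram} {w : List SignedNode} {d : ℤ} {f : ℕ}
    (hw : Walk δ ⊥ w lam d) (hlen : w.length = n) (hf : lam.card + 2 * f = n)
    (hh : f ≤ head w) : ∃ tl, w = pairs f ++ tl ∧ ∀ c ∈ tl, c.1 = true := by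
  obtain ⟨tl, h1, -⟩ := exists_eq_pairs_append w
  have hc := hw.countP_eq hlen hf
  rw [h1, List.countP_append, countP_pairs] at hc
  -- The head contributes as many removals as its length, and there are only f in all.
  have hh' : head w = f := by omega
  rw [hh'] at h1 hc
  refine ⟨tl, h1, fun c hc' => ?_⟩
  have h5 : tl.countP (fun a => !a.1) = 0 := by omega
  rw [List.countP_eq_zero] at h5
  simpa using h5 c hc'

end EpsSeq

/-! ## Reduced expressions -/

section Reduced

theorem wordPerm_nil : wordPerm [] = 1 := rfl

theorem wordPerm_cons (k : ℕ) (a : List ℕ) :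
    wordPerm (k :: a) = Equiv.swap k (k + 1) * wordPerm a := by simp [wordPerm]

theorem wordPerm_append (a b : List ℕ) : wordPerm (a ++ b) = wordPerm a * wordPerm b := by
  simp [wordPerm]

theorem wordPerm_reverse (a : List ℕ) : wordPerm a.reverse = (wordPerm a)⁻¹ := by
  induction a with
  | nil => rfl
  | cons k a ih =>
    rw [List.reverse_cons, wordPerm_append, ih, wordPerm_cons, wordPerm_cons, wordPerm_nil,
      mul_inv_rev, Equiv.swap_inv, mul_one]

theorem swap_lt_swap_or {a x y : ℕ} (h : x < y) :
    Equiv.swap a (a + 1) x < Equiv.swap a (a + 1) y ∨ (x = a ∧ y = a + 1) := by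
  rw [Equiv.swap_apply_def, Equiv.swap_apply_def]
  split_ifs <;> omega

/-- The exchange condition: if `σ` inverts `k` and `k + 1`, then `σ s_k` is shorter. -/
theorem exists_shorter (a : List ℕ) (k : ℕ) (h : wordPerm a (k + 1) < wordPerm a k) :
    ∃ b : List ℕ, b.length < a.length ∧ wordPerm b = wordPerm (a ++ [k]) := by
  induction a with
  | nil => simp [wordPerm_nil] at h
  | cons c a ih =>
    rcases lt_trichotomy (wordPerm a (k + 1)) (wordPerm a k) with h1 | h1 | h1
    · obtain ⟨b, hb, hb'⟩ := ih h1
      exact ⟨c :: b, by simpa using hb, by rw [wordPerm_cons, hb', List.cons_append, wordPerm_cons]⟩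
    · have := (wordPerm a).injective h1
      omega
    · rw [wordPerm_cons, Equiv.Perm.mul_apply, Equiv.Perm.mul_apply] at h
      rcases swap_lt_swap_or (a := c) h1 with h2 | ⟨h2, h3⟩
      · omega
      -- Here s_c creates the inversion, so `wordPerm a` sends k, k + 1 to c, c + 1. Then s_c σ s_k
      -- = σ for σ = `wordPerm a`, and both letters can be dropped.
      · refine ⟨a, by simp, ?_⟩
        rw [List.cons_append, wordPerm_cons, wordPerm_append, wordPerm_cons, wordPerm_nil, mul_one,
          ← h3, ← h2, Equiv.mul_swap_eq_swap_mul, ← mul_assoc, Equiv.swap_mul_self, one_mul]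

/-- Otherwise the exchange condition shortens the prefix together with k, or the reversed suffix
together with k. For the letters swapped at k this means: they start in one order and end in the
opposite one. -/
theorem lt_of_reduced {a b : List ℕ} {k : ℕ}
    (hmin : ∀ ks', wordPerm ks' = wordPerm (a ++ k :: b) → (a ++ k :: b).length ≤ ks'.length) :
    wordPerm a k < wordPerm a (k + 1) ∧ (wordPerm b)⁻¹ k < (wordPerm b)⁻¹ (k + 1) := by
  constructor
  · by_contra hcon
    have hne : wordPerm a k ≠ wordPerm a (k + 1) := fun h => by
      have := (wordPerm a).injective h
      omega
    obtain ⟨c, hc, hc'⟩ := exists_shorter a k (by omega)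
    have := hmin (c ++ b) (by
      rw [wordPerm_append, hc', ← wordPerm_append, List.append_assoc, List.singleton_append])
    simp only [List.length_append, List.length_cons] at this
    omega
  · by_contra hcon
    have hne : (wordPerm b)⁻¹ k ≠ (wordPerm b)⁻¹ (k + 1) := fun h => by
      have := (wordPerm b)⁻¹.injective h
      omega
    obtain ⟨c, hc, hc'⟩ := exists_shorter b.reverse k (by rw [wordPerm_reverse]; omega)
    have := hmin (a ++ c.reverse) (by
      rw [wordPerm_append, wordPerm_reverse, hc', ← wordPerm_reverse, List.reverse_append,
        List.reverse_reverse, List.reverse_singleton, ← wordPerm_append, List.singleton_append])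
    simp only [List.length_append, List.length_cons, List.length_reverse] at this hc
    omega

theorem wordPerm_mem_Ico {A N : ℕ} {ks : List ℕ} (h : ∀ k ∈ ks, A ≤ k ∧ k + 1 < N) {r : ℕ}
    (hr : A ≤ r ∧ r < N) : A ≤ wordPerm ks r ∧ wordPerm ks r < N := by
  induction ks with
  | nil => exact hr
  | cons k ks ih =>
    have h1 := ih fun k hk => h k (List.mem_cons_of_mem _ hk)
    have h2 := h k List.mem_cons_self
    rw [wordPerm_cons, Equiv.Perm.mul_apply, Equiv.swap_apply_def]
    split_ifs <;> omega

theorem wordPerm_of_lt {A : ℕ} {ks : List ℕ} (h : ∀ k ∈ ks, A ≤ k) {r : ℕ} (hr : r < A) :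
    wordPerm ks r = r := by
  induction ks with
  | nil => rfl
  | cons k ks ih =>
    have h2 := h k List.mem_cons_self
    rw [wordPerm_cons, Equiv.Perm.mul_apply, ih fun k hk => h k (List.mem_cons_of_mem _ hk),
      Equiv.swap_apply_of_ne_of_ne (by omega) (by omega)]

theorem length_swapAt (w : List SignedNode) (k : ℕ) : (swapAt w k).length = w.length := by
  simp [swapAt]

theorem getD_swapAt {w : List SignedNode} {k : ℕ} (hk : k + 1 < w.length) (r : ℕ) :
    (swapAt w k).getD r alpha0 = w.getD (Equiv.swap k (k + 1) r) alpha0 := by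
  unfold swapAt
  by_cases h1 : r = k
  · subst h1
    rw [Equiv.swap_apply_left, List.getD_eq_getElem?_getD, List.getElem?_set_ne (by omega),
      List.getElem?_set_self (by omega), Option.getD_some]
  · by_cases h2 : r = k + 1
    · subst h2
      rw [Equiv.swap_apply_right, List.getD_eq_getElem?_getD,
        List.getElem?_set_self (by rw [List.length_set]; omega), Option.getD_some]
    · rw [Equiv.swap_apply_of_ne_of_ne h1 h2, List.getD_eq_getElem?_getD,
        List.getElem?_set_ne (by omega), List.getElem?_set_ne (by omega),
        ← List.getD_eq_getElem?_getD]

theorem length_foldl_swapAt (ks : List ℕ) (w : List SignedNode) :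
    (ks.foldl swapAt w).length = w.length := by
  induction ks generalizing w with
  | nil => rfl
  | cons k ks ih => rw [List.foldl_cons, ih, length_swapAt]

theorem getD_foldl_swapAt {ks : List ℕ} {w : List SignedNode} (h : ∀ k ∈ ks, k + 1 < w.length)
    (r : ℕ) : (ks.foldl swapAt w).getD r alpha0 = w.getD (wordPerm ks r) alpha0 := by
  induction ks generalizing w with
  | nil => rfl
  | cons k ks ih =>
    rw [List.foldl_cons, ih, getD_swapAt (h k List.mem_cons_self), wordPerm_cons,
      Equiv.Perm.mul_apply]
    intro k' hk'
    rw [length_swapAt]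
    exact h k' (List.mem_cons_of_mem _ hk')

variable {R : Type*} [Field R] {δ : R} {n : ℕ}

theorem resSeq_swapAt {w : List SignedNode} (hlen : w.length = n) {k : ℕ} (h : k + 1 < n) :
    (resSeq δ n w).swap h = resSeq δ n (swapAt w k) := by
  funext r
  apply Subtype.ext
  unfold Seq.swap
  rw [resSeq_val, resSeq_val, getD_swapAt (by omega)]
  congr 2
  rw [Equiv.swap_apply_def, Equiv.swap_apply_def]
  simp only [Fin.ext_iff, lo, hi]
  split_ifs <;> rfl

/-- Crossings always form rigid words; only the degree of each crossing has to be supplied, in terms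
of the letters that meet at that moment. -/
theorem rigidWord_psiWord [CharZero R] (ks : List ℕ) (w : List SignedNode) (hlen : w.length = n)
    (hks : ∀ k ∈ ks, k + 1 < n)
    (h : ∀ a k b, ks = a ++ k :: b → crossDeg (signedRes δ ((a.foldl swapAt w).getD k alpha0))
      (signedRes δ ((a.foldl swapAt w).getD (k + 1) alpha0)) = 0) :
    RigidWord (resSeq δ n w) (resSeq δ n (ks.foldl swapAt w)) 0 (psiWord δ n ks) := by
  induction ks generalizing w with
  | nil => exact RigidWord.nil _
  | cons k ks ih =>
    have hk : k + 1 < n := hks k List.mem_cons_self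
    have h1 := ih (swapAt w k) (by rw [length_swapAt, hlen])
      (fun k hk => hks k (List.mem_cons_of_mem _ hk))
      (fun a k' b hab => h (k :: a) k' b (by rw [hab]; rfl))
    rw [← resSeq_swapAt hlen hk] at h1
    have h2 := RigidWord.psi_cons hk h1
    have h3 : psiDeg (resSeq δ n w) hk = 0 := by
      rw [psiDeg_eq_crossDeg]
      exact h [] k ks rfl
    rw [h3, add_zero] at h2
    rw [psiWord, List.flatMap_cons, psiLetter, dif_pos hk]
    exact h2

/-- In a walk of additions, no node comes after a node to the lower right. -/
theorem Walk.not_le {tl : List SignedNode} {lam : YoungDiagram} {d : ℤ} (hw : Walk δ ⊥ tl lam d)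
    (hpos : ∀ c ∈ tl, c.1 = true) {i j : ℕ} (hij : i < j) (hj : j < tl.length) :
    ¬ (tl.getD j alpha0).2 ≤ (tl.getD i alpha0).2 := by
  intro hle
  have hi' : i < tl.length := by omega
  rw [List.getD_eq_getElem _ _ hj, List.getD_eq_getElem _ _ hi'] at hle
  have e1 : tl = tl.take j ++ tl[j] :: tl.drop (j + 1) := by
    rw [← List.drop_eq_getElem_cons hj, List.take_append_drop]
  have hmem : tl[i] ∈ tl.take j := by
    rw [List.mem_take_iff_getElem]
    exact ⟨i, by omega, rfl⟩
  have hpj : tl[j].1 = true := hpos _ (List.getElem_mem _)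
  have hpi : tl[i].1 = true := hpos _ (List.getElem_mem _)
  rw [e1] at hw
  obtain ⟨mu, d₁, d₂, h1, h2, -⟩ := walk_append_iff.1 hw
  obtain ⟨mu', d₃, h3, -, -⟩ := walk_cons_iff.1 h2
  have h4 : tl[i].2 ∈ mu := by
    rw [h1.mem_iff (fun c hc => hpos c (List.mem_of_mem_take hc))]
    right
    rw [← hpi]
    exact hmem
  have h5 : tl[j] = (true, tl[j].2) := Prod.ext hpj rfl
  rw [h5, isStep_true_iff] at h3
  exact h3.1 (mu.isLowerSet hle h4)

/-- Incomparable nodes lie at least two diagonals apart, so in characteristic zero their residues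
are neither equal nor adjacent. -/
theorem crossDeg_eq_zero [CharZero R] {b c : ℕ × ℕ} (h : ¬ b ≤ c) (h' : ¬ c ≤ b) :
    crossDeg (nodeRes δ b) (nodeRes δ c) = 0 := by
  have key : ¬ (((b.2 : ℤ) - b.1) - (c.2 - c.1) ≤ 1 ∧ -1 ≤ ((b.2 : ℤ) - b.1) - (c.2 - c.1)) :=
    fun h1 => (le_or_le_of_diagonal h1.1 h1.2).elim h h'
  unfold crossDeg
  rw [if_neg, if_neg]
  · rw [nodeRes_eq_iff]; omega
  · rw [eq_sub_iff_add_eq, eq_comm (a := nodeRes δ b + 1), nodeRes_eq_add_one_iff,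
      nodeRes_eq_add_one_iff]
    omega

theorem getD_pairs_append {f r : ℕ} {tl : List SignedNode} (hr : 2 * f ≤ r) :
    (pairs f ++ tl).getD r alpha0 = tl.getD (r - 2 * f) alpha0 := by
  rw [List.getD_append_right _ _ _ _ (by rw [length_pairs]; exact hr), length_pairs]

/-- The crossings of a reduced expression have degree zero. -/
theorem rigidWord_psiWord_of_reduced [CharZero R] {f : ℕ} {ks : List ℕ}
    {w tl tl' : List SignedNode} {lam : YoungDiagram} {d d' : ℤ} (hks : IsReducedWord n f ks)
    (hlen : w.length = n) (hweq : w = pairs f ++ tl) (hveq : ks.foldl swapAt w = pairs f ++ tl')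
    (htl : Walk δ ⊥ tl lam d) (htl' : Walk δ ⊥ tl' lam d') (hpos : ∀ c ∈ tl, c.1 = true)
    (hpos' : ∀ c ∈ tl', c.1 = true) :
    RigidWord (resSeq δ n w) (resSeq δ n (ks.foldl swapAt w)) 0 (psiWord δ n ks) := by
  refine rigidWord_psiWord ks w hlen (fun k hk => (hks.1 k hk).2) ?_
  intro a k b hab
  have hl : tl.length = n - 2 * f := by
    rw [hweq, List.length_append, length_pairs] at hlen; omega
  have hl' : tl'.length = n - 2 * f := by
    have := length_foldl_swapAt ks w
    rw [hveq, List.length_append, length_pairs] at this; omega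
  have ha : ∀ k ∈ a, 2 * f ≤ k ∧ k + 1 < n := fun k hk =>
    hks.1 k (by rw [hab]; exact List.mem_append_left _ hk)
  have hb : ∀ k ∈ b.reverse, 2 * f ≤ k ∧ k + 1 < n := fun k hk =>
    hks.1 k (by
      rw [hab]; exact List.mem_append_right _ (List.mem_cons_of_mem _ (List.mem_reverse.1 hk)))
  have hk : 2 * f ≤ k ∧ k + 1 < n := hks.1 k (by rw [hab]; simp)
  obtain ⟨h1, h2⟩ := lt_of_reduced (a := a) (b := b) (k := k) (hab ▸ hks.2)
  have a1 := wordPerm_mem_Ico ha (r := k) (by omega)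
  have a2 := wordPerm_mem_Ico ha (r := k + 1) (by omega)
  have b1 := wordPerm_mem_Ico hb (r := k) (by omega)
  have b2 := wordPerm_mem_Ico hb (r := k + 1) (by omega)
  rw [wordPerm_reverse] at b1 b2
  -- The two nodes that cross occur in this order in the initial tableau and in the opposite order
  -- in the final one. Each is a walk of additions, so neither node can be weakly above and to the
  -- left of the other.
  have hlow := htl.not_le hpos (i := wordPerm a k - 2 * f) (j := wordPerm a (k + 1) - 2 * f)
    (by omega) (by omega)
  have hupp := htl'.not_le hpos' (i := (wordPerm b)⁻¹ k - 2 * f)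
    (j := (wordPerm b)⁻¹ (k + 1) - 2 * f) (by omega) (by omega)
  -- Following the two positions through the suffix `b` leaves the prefix `a` and the exchange at k.
  have hperm : ∀ r, wordPerm ks ((wordPerm b)⁻¹ r) = wordPerm a (Equiv.swap k (k + 1) r) := by
    intro r
    rw [hab, wordPerm_append, wordPerm_cons]
    simp
  have hn : ∀ k ∈ ks, k + 1 < w.length := fun k hk => by rw [hlen]; exact (hks.1 k hk).2
  rw [← getD_pairs_append b1.1, ← getD_pairs_append b2.1, ← hveq, getD_foldl_swapAt hn,
    getD_foldl_swapAt hn, hperm, hperm, Equiv.swap_apply_left, Equiv.swap_apply_right, hweq,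
    getD_pairs_append a1.1, getD_pairs_append a2.1] at hupp
  have hna : ∀ k ∈ a, k + 1 < w.length := fun k hk => by rw [hlen]; exact (ha k hk).2
  rw [getD_foldl_swapAt hna, getD_foldl_swapAt hna, hweq, getD_pairs_append a1.1,
    getD_pairs_append a2.1]
  have hres : ∀ r, r < tl.length →
      signedRes δ (tl.getD r alpha0) = nodeRes δ (tl.getD r alpha0).2 := by
    intro r hr
    rw [List.getD_eq_getElem _ _ hr, signedRes, if_pos (hpos _ (List.getElem_mem _))]
  rw [hres _ (by omega), hres _ (by omega)]
  exact crossDeg_eq_zero hupp hlow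

end Reduced

/-! ### The middle factor and the final degree count -/

section Main

variable {R : Type*} [Field R] {δ : R} {n : ℕ}

theorem pairs_add (a b : ℕ) : pairs (a + b) = pairs a ++ pairs b := by
  induction a with
  | zero => simp [pairs]
  | succ a ih => rw [Nat.succ_add, pairs, ih]; rfl

theorem isAddable_bot : IsAddable ⊥ (0, 0) := by
  obtain ⟨mu, h⟩ := exists_isStep_bot
  exact IsStep.isAddable h

/-- After m pairs the walk is back at the empty partition and about to add α₀, so `degK_add`
applies. -/
theorem degK_pairs [CharZero R] {f m : ℕ} (hm : m < f) (tl : List SignedNode)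
    (h : 2 * m + 1 < n) :
    (resSeq δ n (pairs f ++ tl)).degK (lo h) = remDeg δ ⊥ (0, 0) := by
  obtain ⟨k, rfl⟩ : ∃ k, f = m + (k + 1) := ⟨f - m - 1, by omega⟩
  rw [pairs_add, List.append_assoc]
  exact degK_add (walk_pairs m) isAddable_bot (lo h) (length_pairs m).symm

/-- The word `ε_0 ε_2 ⋯ ε_{2m-2}`. -/
noncomputable def cupWord (δ : R) (n m : ℕ) : List (Gen δ n) :=
  (List.range m).flatMap fun m => epsLetter δ n (2 * m)

theorem cupWord_succ {m : ℕ} (h : 2 * m + 1 < n) :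
    cupWord δ n (m + 1) = cupWord δ n m ++ [Gen.eps (2 * m) h] := by
  simp [cupWord, List.range_succ, epsLetter, h]

/-- The word `ε_0 ε_2 ⋯ ε_{2m-2}` only changes the first `2m` entries of a sequence. -/
theorem eG_mul_cupWord_mul_eG {i : Seq δ n} {m : ℕ} (hm : 2 * m ≤ n) {j : Seq δ n} {r : Fin n}
    (hr : 2 * m ≤ r.val) (hij : i r ≠ j r) : eG i * evalWord (cupWord δ n m) * eG j = 0 := by
  induction m generalizing j with
  | zero =>
    rw [show cupWord δ n 0 = [] from rfl, evalWord_nil, mul_one, eG_mul_of_ne]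
    exact fun h => hij (by rw [h])
  | succ m ih =>
    have h : 2 * m + 1 < n := by omega
    rw [cupWord_succ h, evalWord_append, evalWord_singleton, ← mul_assoc, mul_assoc]
    refine mul_eq_zero_of_forall _ _ fun l => ?_
    by_cases hl : i r = l r
    · rw [mul_assoc, ← mul_assoc (eG l), eG_mul_epsG_mul_eG h, mul_zero]
      intro h1
      refine hij (hl.trans (h1 r (fun h2 => ?_) fun h2 => ?_))
      · rw [h2] at hr; simp only [lo] at hr; omega
      · rw [h2] at hr; simp only [hi] at hr; omega
    · rw [ih (by omega) (by omega) hl, zero_mul]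

/-- Every cup-cap occurs with α₀ about to be added to the empty partition on both sides, and so
contributes 2·`remDeg δ ⊥ (0, 0)` once all inner idempotents are known to be e(i). -/
theorem cupWord_mem [CharZero R] {f : ℕ} (tl : List SignedNode) (hf : 2 * f ≤ n) {m : ℕ}
    (hm : m ≤ f) :
    eG (resSeq δ n (pairs f ++ tl)) * evalWord (cupWord δ n m) * eG (resSeq δ n (pairs f ++ tl))
      ∈ homogeneous δ n (m * (2 * remDeg δ ⊥ (0, 0))) := by
  set i := resSeq δ n (pairs f ++ tl) with hi_def
  induction m with
  | zero =>
    rw [show cupWord δ n 0 = [] from rfl, evalWord_nil, mul_one, eG_mul_self]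
    simpa using mem_homogeneous (HomMonomial.idem i)
  | succ m ih =>
    have h : 2 * m + 1 < n := by omega
    have e : eG i * evalWord (cupWord δ n (m + 1)) * eG i
        = (eG i * evalWord (cupWord δ n m) * eG i) * (eG i * epsG h * eG i) := by
      calc _ = (eG i * evalWord (cupWord δ n m)) * (epsG h * eG i) := by
            rw [cupWord_succ h, evalWord_append, evalWord_singleton]; simp only [mul_assoc]
        _ = eG i * evalWord (cupWord δ n m) * eG i * (epsG h * eG i) := by
            -- An inner sequence agrees with `i` from position 2m on, because the earlier cup-caps
            -- act before it, and agrees with `i` before 2m, because the last cup-cap does not act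
            -- there.
            refine mul_eq_mul_eG_mul _ _ i fun j hj => ?_
            obtain ⟨r, hr⟩ : ∃ r, i r ≠ j r := by
              by_contra hcon
              push Not at hcon
              exact hj (funext fun r => (hcon r).symm)
            by_cases h1 : 2 * m ≤ r.val
            · rw [eG_mul_cupWord_mul_eG (by omega) h1 hr, zero_mul]
            · rw [mul_assoc, ← mul_assoc (eG j), eG_mul_epsG_mul_eG h, mul_zero]
              intro h2
              refine hr (h2 r (fun h3 => h1 ?_) fun h3 => h1 ?_).symm
              · rw [h3]; simp [lo]
              · rw [h3]; simp [hi]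
        _ = eG i * evalWord (cupWord δ n m) * (eG i * eG i) * (epsG h * eG i) := by rw [eG_mul_self]
        _ = _ := by simp only [mul_assoc]
    have h1 := (HomWord.eps i i h).mem
    rw [evalWord_singleton, degK_pairs (by omega) tl h] at h1
    rw [e, show ((m + 1 : ℕ) : ℤ) * (2 * remDeg δ ⊥ (0, 0))
      = m * (2 * remDeg δ ⊥ (0, 0)) + (remDeg δ ⊥ (0, 0) + remDeg δ ⊥ (0, 0)) by push_cast; ring]
    exact mul_mem_homogeneous (ih (by omega)) h1

/-- The reduced tableau is f initial pairs followed by additions, so its degree is f·`remDeg δ ⊥ (0,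
0)`, independently of the shape of the tableau. -/
theorem UpDownTableau.rigidWord_epsSeq [CharZero R] {f : ℕ} {lam : YoungDiagram}
    (hn : lam.card + 2 * f = n) (t : UpDownTableau n lam f) :
    ∃ tl e, t.reduced = pairs f ++ tl ∧ (∀ c ∈ tl, c.1 = true) ∧ Walk δ ⊥ tl lam e ∧
      RigidWord (resSeq δ n t.reduced) (resSeq δ n t.word) (t.deg δ - f * remDeg δ ⊥ (0, 0))
        (epsSeq δ n t.redLength t.word) := by
  obtain ⟨d', h1, h2, h3, h4⟩ := BrauerKLR.rigidWord_epsSeq (n := n) (f := f) hn t.redLength t.word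
    (t.deg δ) t.walk t.length_word (by unfold UpDownTableau.redLength; omega)
    (by unfold UpDownTableau.redLength; omega)
  obtain ⟨tl, h5, h6⟩ := eq_pairs_append_of_le_head h1 h2 hn h3
  have h1' := h1
  rw [h5] at h1'
  obtain ⟨e, h7, rfl⟩ := walk_pairs_append h1'
  obtain rfl := h7.deg_eq_zero h6
  rw [add_zero] at h4
  exact ⟨tl, 0, h5, h6, h7, h4⟩

/-- The permutation d(t) fixes the first 2f positions, so `t0` begins with the same f pairs as h(t).
These account for all its f removals, and the rest are additions. -/
theorem UpDownTableau.word_eq_of_isExpression [CharZero R] {f : ℕ} {lam : YoungDiagram}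
    (hn : lam.card + 2 * f = n) {t0 t : UpDownTableau n lam f} {ks : List ℕ}
    (hks : t0.IsExpression t ks) {tl : List SignedNode} (htl : t.reduced = pairs f ++ tl) :
    ∃ tl0 e, t0.word = pairs f ++ tl0 ∧ (∀ c ∈ tl0, c.1 = true) ∧ Walk δ ⊥ tl0 lam e := by
  obtain ⟨⟨h1, -⟩, h2⟩ := hks
  have hl := t0.length_word
  have h3 : t0.word.take (2 * f) = pairs f := by
    apply List.ext_getElem
    · rw [List.length_take, length_pairs]; omega
    · intro r hr hr'
      rw [length_pairs] at hr'
      have h4 := getD_foldl_swapAt (w := t0.word) (ks := ks)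
        (fun k hk => by rw [hl]; exact (h1 k hk).2) r
      rw [wordPerm_of_lt (fun k hk => (h1 k hk).1) hr', h2, htl,
        List.getD_append _ _ _ _ (by rw [length_pairs]; exact hr'),
        List.getD_eq_getElem _ _ (by rw [length_pairs]; exact hr'),
        List.getD_eq_getElem _ _ (by omega)] at h4
      rw [List.getElem_take, h4]
  have h5 : t0.word = pairs f ++ t0.word.drop (2 * f) := by
    rw [← h3, List.take_append_drop]
  have hw := t0.walk (δ := δ)
  have hc := hw.countP_eq hl hn
  rw [h5, List.countP_append, countP_pairs] at hc
  have h6 : (t0.word.drop (2 * f)).countP (fun a => !a.1) = 0 := by omega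
  rw [List.countP_eq_zero] at h6
  rw [h5] at hw
  obtain ⟨e, h7, -⟩ := walk_pairs_append hw
  exact ⟨_, e, h5, fun c hc => by simpa using h6 c hc, h7⟩

/-- The word `ψ_t ε_t` is homogeneous between the idempotents of `t0` and `t`. -/
theorem UpDownTableau.rigidWord_psi_eps [CharZero R] {f : ℕ} {lam : YoungDiagram}
    (hn : lam.card + 2 * f = n) {t0 t : UpDownTableau n lam f} {ks : List ℕ}
    (hks : t0.IsExpression t ks) :
    RigidWord (resSeq δ n t0.word) (resSeq δ n t.word) (t.deg δ - f * remDeg δ ⊥ (0, 0))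
      (psiWord δ n ks ++ epsSeq δ n t.redLength t.word) := by
  obtain ⟨tl, e, h1, h2, h3, h4⟩ := t.rigidWord_epsSeq (δ := δ) hn
  obtain ⟨tl0, e0, h5, h6, h7⟩ := UpDownTableau.word_eq_of_isExpression (δ := δ) hn hks h1
  have h8 := rigidWord_psiWord_of_reduced hks.1 t0.length_word h5 (hks.2.trans h1) h7 h3 h6 h2
  rw [hks.2] at h8
  have := h8.append h4
  rwa [zero_add] at this

/-- The element `ψ_st` is homogeneous. -/
theorem UpDownTableau.psiST_mem_homogeneous [CharZero R] {f : ℕ} {lam : YoungDiagram}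
    (hn : lam.card + 2 * f = n) {t0 s t : UpDownTableau n lam f} {ws wt : List ℕ}
    (hws : t0.IsExpression s ws) (hwt : t0.IsExpression t wt) :
    UpDownTableau.psiST δ t0 s t ws wt ∈ homogeneous δ n (s.deg δ + t.deg δ) := by
  have hs := (UpDownTableau.rigidWord_psi_eps (δ := δ) hn hws).rev_mem
  have ht := (UpDownTableau.rigidWord_psi_eps (δ := δ) hn hwt).mem
  obtain ⟨tl, e, h1, -⟩ := t.rigidWord_epsSeq (δ := δ) hn
  obtain ⟨tl0, e0, h2, -⟩ := UpDownTableau.word_eq_of_isExpression (δ := δ) hn hwt h1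
  have hc := cupWord_mem (δ := δ) (n := n) tl0 (by omega) (le_refl f)
  rw [← h2] at hc
  set i := resSeq δ n t0.word
  have e1 : evalWord (idemWord δ n f t0.word) = eG i * evalWord (cupWord δ n f) * eG i := by
    rw [idemWord, evalWord_append, evalWord_append, evalWord_singleton]; rfl
  obtain ⟨us, hus⟩ := epsSeq_eq_append (δ := δ) (n := n) s.redLength s.word
  obtain ⟨ut, hut⟩ := epsSeq_eq_append (δ := δ) (n := n) t.redLength t.word
  have e2 : evalWord (epsSeq δ n s.redLength s.word).reverse
      = eG (resSeq δ n s.word) * evalWord (epsSeq δ n s.redLength s.word).reverse := by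
    rw [hus, List.reverse_append, List.reverse_singleton, evalWord_append, evalWord_singleton,
      ← mul_assoc, eG_mul_self]
  have e3 : evalWord (epsSeq δ n t.redLength t.word)
      = evalWord (epsSeq δ n t.redLength t.word) * eG (resSeq δ n t.word) := by
    rw [hut, evalWord_append, evalWord_singleton, mul_assoc, eG_mul_self]
  have key : UpDownTableau.psiST δ t0 s t ws wt
      = (eG (resSeq δ n s.word) * evalWord (psiWord δ n ws
            ++ epsSeq δ n s.redLength s.word).reverse * eG i)
        * (eG i * evalWord (cupWord δ n f) * eG i)
        * (eG i * evalWord (psiWord δ n wt ++ epsSeq δ n t.redLength t.word)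
            * eG (resSeq δ n t.word)) := by
    have e4 : ∀ x : G δ n, eG i * (eG i * x) = eG i * x := fun x => by
      rw [← mul_assoc, eG_mul_self]
    rw [UpDownTableau.psiST, List.reverse_append]
    simp only [evalWord_append]
    rw [e1]
    generalize evalWord (epsSeq δ n s.redLength s.word).reverse = x at e2 ⊢
    generalize evalWord (epsSeq δ n t.redLength t.word) = z at e3 ⊢
    conv_lhs => rw [e2, e3]
    simp only [mul_assoc, e4]
  -- Each outer factor lacks f·`remDeg δ ⊥ (0, 0)`, and the middle factor supplies exactly twice
  -- that amount.
  rw [key, show s.deg δ + t.deg δ = s.deg δ - f * remDeg δ ⊥ (0, 0)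
    + f * (2 * remDeg δ ⊥ (0, 0)) + (t.deg δ - f * remDeg δ ⊥ (0, 0)) by ring]
  exact mul_mem_homogeneous (mul_mem_homogeneous hs hc) ht

end Main

end BrauerKLR

theorem mainTheorem4 {R : Type*} [Field R] [CharZero R] (δ : R) (n f : ℕ) (lam : YoungDiagram)
    (hn : lam.card + 2 * f = n)
    (t0 : BrauerKLR.UpDownTableau n lam f) (ht0 : t0.IsMaximal)
    (s t : BrauerKLR.UpDownTableau n lam f)
    (ws wt : List ℕ) (hws : t0.IsExpression s ws) (hwt : t0.IsExpression t wt) :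
    BrauerKLR.UpDownTableau.psiST δ t0 s t ws wt ∈
      BrauerKLR.homogeneous δ n (s.deg δ + t.deg δ) := by
  exact BrauerKLR.UpDownTableau.psiST_mem_homogeneous hn hws hwt
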